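/- Let $W=W(3,2,2)$ be a smooth three-web on a smooth $4$-dimensional manifold $M$, i.e. three foliations of codimension $2$ whose leaves are in general position (the tangent planes of leaves of two different foliations meet only in $0$). A \emph{transversal bivector} at a point $x$ is a $2$-dimensional subspace of $T_xM$ that meets the tangent plane of each of the three leaves through $x$ along a line; $W$ is \emph{transversally geodesic} if every transversal bivector, at every point $x$, is the tangent plane at $x$ of a smooth surface through $x$ all of whose tangent planes are transversal bivectors. $W$ is a \emph{group web} if it is locally equivalent to the web formed by the foliations $g_1=\mathrm{const}$, $g_2=\mathrm{const}$, $g_1g_2=\mathrm{const}$ on $G\times G$, for some $2$-dimensional Lie group $G$. Let $\omega_1^i,\omega_2^i$ ($i=1,2$) be smooth one-forms on a coordinate domain $U\subseteq M$ such that the three foliations are given there by $\omega_1^i=0$, by $\omega_2^i=0$ and by $\omega_1^i+\omega_2^i=0$ (an adapted coframe). Let the forms $\omega_j^i$ and the functions $a_j$, $b^i_{jkl}$, $p_{ij}$, $q_{ij}$ on $U$ be determined by $$d\omega_1^i=\omega_1^j\wedge\omega_j^i+a_j\,\omega_1^j\wedge\omega_1^i,\qquad d\omega_2^i=\omega_2^j\wedge\omega_j^i-a_j\,\omega_2^j\wedge\omega_2^i,$$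 $$d\omega_j^i-\omega_j^k\wedge\omega_k^i=b^i_{jkl}\,\omega_1^k\wedge\omega_2^l,\qquad da_i-a_j\omega_i^j=p_{ij}\,\omega_1^j+q_{ij}\,\omega_2^j,$$ and put $p=\tfrac12(p_{12}-p_{21})$, $q=\tfrac12(q_{12}-q_{21})$. The web is \emph{nonisoclinic} at a point if $p^2+q^2>0$ there. (a) If some component $b^i_{jjj}$ with $i\neq j$ is nonzero at some point of $U$, then $W$ is not transversally geodesic. (b) Suppose that $W$ is nonisoclinic at some point of $U$ and is not a group web. If $b^1_{jkl}=0$ on $U$ for all $j,k,l$, or $b^2_{jkl}=0$ on $U$ for all $j,k,l$, then $W$ is not transversally geodesic. -/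

import Mathlib

open scoped Manifold ContDiff Topology

noncomputable section

/-- The model space of the four-dimensional manifold that carries the web. -/
abbrev R4 : Type := EuclideanSpace ℝ (Fin 4)

/-- The plane: target of the local first integrals, parameter space of surfaces. -/
abbrev R2 : Type := EuclideanSpace ℝ (Fin 2)

/-- A three-web `W(3,2,2)` on a smooth four-dimensional manifold `M`: three foliations of
codimension two in general position.  A foliation is given by its tangent distribution, which
is locally the kernel of the differential of a smooth submersion onto the plane (the leaves are
locally the level sets of this submersion).  General position: the tangent planes of leaves of
different foliations meet only in `0`. -/
structure ThreeWeb (M : Type*) [TopologicalSpace M] [ChartedSpace R4 M] where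
  /-- tangent distribution of the foliation with the number `ξ` -/
  dist : Fin 3 → ∀ x : M, Submodule ℝ (TangentSpace 𝓘(ℝ, R4) x)
  foliation : ∀ (ξ : Fin 3) (x : M), ∃ (V : Set M) (u : M → R2),
    IsOpen V ∧ x ∈ V ∧ ContMDiffOn 𝓘(ℝ, R4) 𝓘(ℝ, R2) ∞ u V ∧
    ∀ y ∈ V, Function.Surjective (mfderiv 𝓘(ℝ, R4) 𝓘(ℝ, R2) u y) ∧
      ∀ v : TangentSpace 𝓘(ℝ, R4) y,
        v ∈ dist ξ y ↔ mfderiv 𝓘(ℝ, R4) 𝓘(ℝ, R2) u y v = 0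
  transversal : ∀ (x : M) (ξ η : Fin 3), ξ ≠ η → Disjoint (dist ξ x) (dist η x)

namespace ThreeWeb

variable {M : Type*} [TopologicalSpace M] [ChartedSpace R4 M]

/-- A transversal bivector at `x`: a two-dimensional subspace of the tangent space that meets the
tangent plane of each of the three leaves through `x` along a line.  In terms of a coframe with
`ω₃ = -(ω₁ + ω₂)` these are exactly the planes
`ξ² ω₁¹ - ξ¹ ω₁² = 0`, `ξ² ω₂¹ - ξ¹ ω₂² = 0` with `ξ ≠ 0`. -/
def IsTransversalBivector (W : ThreeWeb M) (x : M)
    (P : Submodule ℝ (TangentSpace 𝓘(ℝ, R4) x)) : Prop :=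
  Module.finrank ℝ P = 2 ∧
    ∀ ξ : Fin 3, Module.finrank ℝ (P ⊓ W.dist ξ x : Submodule ℝ (TangentSpace 𝓘(ℝ, R4) x)) = 1

/-- `s`, on the open set `N` of parameters, is a (smooth, immersed) transversally geodesic surface:
all its tangent planes are transversal bivectors, that is, the three foliations cut
on it a two-dimensional three-web of curves. -/
def IsTransversallyGeodesicSurface (W : ThreeWeb M) (N : Set R2) (s : R2 → M) : Prop :=
  ContMDiffOn 𝓘(ℝ, R2) 𝓘(ℝ, R4) ∞ s N ∧
    ∀ t ∈ N, W.IsTransversalBivector (s t)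
      (LinearMap.range (mfderiv 𝓘(ℝ, R2) 𝓘(ℝ, R4) s t).toLinearMap)

/-- A web is transversally geodesic if every transversal bivector, at every point, is tangent to a
transversally geodesic surface through this point. -/
def IsTransversallyGeodesic (W : ThreeWeb M) : Prop :=
  ∀ (x : M) (P : Submodule ℝ (TangentSpace 𝓘(ℝ, R4) x)), W.IsTransversalBivector x P →
    ∃ (N : Set R2) (s : R2 → M) (hs : x = s 0), IsOpen N ∧ (0 : R2) ∈ N ∧
      W.IsTransversallyGeodesicSurface N s ∧
      LinearMap.range (mfderiv 𝓘(ℝ, R2) 𝓘(ℝ, R4) s 0).toLinearMap = hs ▸ P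

/-- A group web: locally equivalent to the web that the foliations `g₁ = const`, `g₂ = const`,
`g₁ g₂ = const` form on `G × G`, for a two-dimensional Lie group `G`. -/
def IsGroupWeb (W : ThreeWeb M) : Prop :=
  ∀ x : M, ∃ (G : Type) (_ : TopologicalSpace G) (_ : ChartedSpace R2 G) (_ : Group G)
    (_ : LieGroup 𝓘(ℝ, R2) ∞ G) (V : Set M) (g₁ g₂ : M → G),
    IsOpen V ∧ x ∈ V ∧
    ContMDiffOn 𝓘(ℝ, R4) 𝓘(ℝ, R2) ∞ g₁ V ∧ ContMDiffOn 𝓘(ℝ, R4) 𝓘(ℝ, R2) ∞ g₂ V ∧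
    ∀ y ∈ V, ∀ v : TangentSpace 𝓘(ℝ, R4) y,
      (v ∈ W.dist 0 y ↔ mfderiv 𝓘(ℝ, R4) 𝓘(ℝ, R2) g₁ y v = 0) ∧
      (v ∈ W.dist 1 y ↔ mfderiv 𝓘(ℝ, R4) 𝓘(ℝ, R2) g₂ y v = 0) ∧
      (v ∈ W.dist 2 y ↔ mfderiv 𝓘(ℝ, R4) 𝓘(ℝ, R2) (fun z => g₁ z * g₂ z) y v = 0)

/-- An adapted coframe of a web on a coordinate domain: in a chart of the smooth structure,
one-forms `ω₁ⁱ` (`form 0 i`) and `ω₂ⁱ` (`form 1 i`), `i = 1, 2`, such that the three foliations are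
defined by `ω₁ⁱ = 0`, by `ω₂ⁱ = 0`, and by `ω₃ⁱ = 0`, where `ω₁ⁱ + ω₂ⁱ + ω₃ⁱ = 0`. -/
structure AdaptedCoframe (W : ThreeWeb M) where
  chart : OpenPartialHomeomorph M R4
  chart_mem : chart ∈ IsManifold.maximalAtlas 𝓘(ℝ, R4) ∞ M
  form : Fin 2 → Fin 2 → R4 → R4 →L[ℝ] ℝ
  smooth : ∀ α i, ContDiffOn ℝ ∞ (form α i) chart.target
  mem_dist₁ : ∀ x ∈ chart.source, ∀ v : TangentSpace 𝓘(ℝ, R4) x, v ∈ W.dist 0 x ↔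
    ∀ i, form 0 i (chart x) (mfderiv 𝓘(ℝ, R4) 𝓘(ℝ, R4) chart x v) = 0
  mem_dist₂ : ∀ x ∈ chart.source, ∀ v : TangentSpace 𝓘(ℝ, R4) x, v ∈ W.dist 1 x ↔
    ∀ i, form 1 i (chart x) (mfderiv 𝓘(ℝ, R4) 𝓘(ℝ, R4) chart x v) = 0
  mem_dist₃ : ∀ x ∈ chart.source, ∀ v : TangentSpace 𝓘(ℝ, R4) x, v ∈ W.dist 2 x ↔
    ∀ i, -(form 0 i (chart x) + form 1 i (chart x)) (mfderiv 𝓘(ℝ, R4) 𝓘(ℝ, R4) chart x v) = 0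

/-- Exterior differential of a one-form on a domain of `ℝ⁴`:
`dθ(u, v) = (D_u θ)(v) - (D_v θ)(u)`. -/
def extD (θ : R4 → R4 →L[ℝ] ℝ) (y u v : R4) : ℝ :=
  fderiv ℝ θ y u v - fderiv ℝ θ y v u

/-- Exterior product of covectors, evaluated on two vectors. -/
def wedge (φ ψ : R4 →L[ℝ] ℝ) (u v : R4) : ℝ := φ u * ψ v - φ v * ψ u

namespace AdaptedCoframe

variable {W : ThreeWeb M} (C : W.AdaptedCoframe)

/-- The coframe at `y` as a map `ℝ⁴ → (ℝ²)²` (an isomorphism at each point of the domain). -/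
def coframeMap (y : R4) : R4 →L[ℝ] (Fin 2 → Fin 2 → ℝ) :=
  ContinuousLinearMap.pi fun α => ContinuousLinearMap.pi fun i => C.form α i y

/-- The dual frame: `form β j (frame α k) = 1` if `(β, j) = (α, k)`, and `0` otherwise. -/
def frame (α k : Fin 2) (y : R4) : R4 :=
  (C.coframeMap y).inverse (Pi.single α (Pi.single k 1))

/-- The connection forms `ω_jⁱ` of the web (`conn j i`).  They and the covector `a` are the unique
solution of
`dω₁ⁱ = ω₁ʲ ∧ ω_jⁱ + a_j ω₁ʲ ∧ ω₁ⁱ`, `dω₂ⁱ = ω₂ʲ ∧ ω_jⁱ - a_j ω₂ʲ ∧ ω₂ⁱ`: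
the equations give `ω_jⁱ(e_{1k}) = dω₂ⁱ(e_{2j}, e_{1k})`, `ω_jⁱ(e_{2k}) = dω₁ⁱ(e_{1j}, e_{2k})`. -/
def conn (j i : Fin 2) (y : R4) : R4 →L[ℝ] ℝ :=
  ∑ k, (extD (C.form 1 i) y (C.frame 1 j y) (C.frame 0 k y) • C.form 0 k y
    + extD (C.form 0 i) y (C.frame 0 j y) (C.frame 1 k y) • C.form 1 k y)

/-- The covector `a_j`: the first structure equation gives
`a_j δⁱ_k - a_k δⁱ_j = (dω₁ⁱ - ω₁ᵐ ∧ ω_mⁱ)(e_{1j}, e_{1k})`; contract `i` with `k`. -/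
def a (j : Fin 2) (y : R4) : ℝ :=
  ∑ k, (extD (C.form 0 k) y (C.frame 0 j y) (C.frame 0 k y)
    - ∑ m, wedge (C.form 0 m y) (C.conn m k y) (C.frame 0 j y) (C.frame 0 k y))

/-- The curvature tensor `bⁱ_{jkl}` (`b i j k l`), the coefficients in
`dω_jⁱ - ω_jᵐ ∧ ω_mⁱ = bⁱ_{jkl} ω₁ᵏ ∧ ω₂ˡ`. -/
def b (i j k l : Fin 2) (y : R4) : ℝ :=
  extD (C.conn j i) y (C.frame 0 k y) (C.frame 1 l y)
    - ∑ m, wedge (C.conn j m y) (C.conn m i y) (C.frame 0 k y) (C.frame 1 l y)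

/-- The Pfaffian derivatives `p_{ij}` of the covector `a`, the coefficients of `ω₁ʲ` in
`da_i - a_m ω_iᵐ = p_{ij} ω₁ʲ + q_{ij} ω₂ʲ`. -/
def p (i j : Fin 2) (y : R4) : ℝ :=
  fderiv ℝ (C.a i) y (C.frame 0 j y) - ∑ m, C.a m y * C.conn i m y (C.frame 0 j y)

/-- The Pfaffian derivatives `q_{ij}` of the covector `a`, the coefficients of `ω₂ʲ` in
`da_i - a_m ω_iᵐ = p_{ij} ω₁ʲ + q_{ij} ω₂ʲ`. -/
def q (i j : Fin 2) (y : R4) : ℝ :=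
  fderiv ℝ (C.a i) y (C.frame 1 j y) - ∑ m, C.a m y * C.conn i m y (C.frame 1 j y)

/-- The web is nonisoclinic at the point with coordinates `y`: `p² + q² > 0`, where
`p = p_{[12]}` and `q = q_{[12]}`. -/
def IsNonisoclinicAt (y : R4) : Prop :=
  0 < ((C.p 0 1 y - C.p 1 0 y) / 2) ^ 2 + ((C.q 0 1 y - C.q 1 0 y) / 2) ^ 2

end AdaptedCoframe

end ThreeWeb

end

/-! Part (a) and the start of (b) rest on one integrability condition. On a transversally geodesic
surface the pulled-back forms are `ω₁ⁱ = ζⁱθ₁`, `ω₂ⁱ = ζⁱθ₂`. The structure equations then say that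
the direction `ζ` is parallel up to a factor for the web connection, so the curvature must map `ζ`
to a multiple of itself: `b(ξ,ξ,ξ)` is proportional to `ξ` for every direction `ξ`
(`cubic_of_isTransversallyGeodesic`). The choice `ξ = e_j` gives (a).

For (b), let `b¹ = 0`; the case `b² = 0` follows by renaming the indices. The cubic condition forces
the symmetrization of `b²` to vanish (`isSpecial_relabel`). The first Bianchi identities express the
skew parts of `b` through the Pfaffian derivatives of the covector `a`. Hence `p_{2j} = q_{2j} = 0`,
while `b²` is linear in `p_{1j}, q_{1j}` (`IsSpecial.covA_one`, `IsSpecial.three_mul_b`). It remains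
to show `p₁₂² + q₁₂² = 0`.

On the open set where this sum is nonzero, it is a unit in the ring of smooth functions, and the
argument becomes algebra with derivations of that ring. The second Bianchi identity for `ω₂¹` and
the Ricci identity for `a₂` give `ω₂¹ = 0` and `a₂ = 0` (`w_and_a_eq_zero`). The remaining Bianchi
identities and the equation `d²a₁ = 0` leave four free functions `B, F, G, R` among the second
covariant derivatives of `a₁` (`exists_sndDeriv`).

One more prolongation produces an algebraic relation without derivatives of these functions
(`ReducedWeb.relation`). Differentiating it three times along each of `X₂`, `Y₂` yields `B p₂² = 2B
p₂q₂ = B q₂²`, so `B = 0`. The known covariant derivatives of `B` then become two quadratic forms in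
`p₂, q₂` without a common nontrivial zero, a contradiction (`ReducedWeb.not_isUnit`). Thus the open
set is empty.

Indices `0, 1` in the code stand for `1, 2` here; `w j i` and `conn j i` are `ω_jⁱ`, `curv j i` is
its curvature form `Ω_jⁱ`, and `covA i` collects `p_{ij}` and `q_{ij}`. -/

open scoped Manifold ContDiff Topology

noncomputable section

/-! ### Smooth functions on an open set as an algebra, vector fields as derivations. -/

section SmoothFunctions

open TopologicalSpace

variable {E : Type*} [NormedAddCommGroup E] [NormedSpace ℝ E]

/-- The algebra of smooth real functions on an open subset of a normed space. -/
def smoothFunctions (V : Opens E) : Subalgebra ℝ (V → ℝ) where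
  carrier := {f | ∃ g : E → ℝ, ContDiffOn ℝ ∞ g V ∧ f = fun y : V => g y}
  mul_mem' := by
    rintro _ _ ⟨g, hg, rfl⟩ ⟨h, hh, rfl⟩
    exact ⟨fun y => g y * h y, hg.mul hh, rfl⟩
  add_mem' := by
    rintro _ _ ⟨g, hg, rfl⟩ ⟨h, hh, rfl⟩
    exact ⟨fun y => g y + h y, hg.add hh, rfl⟩
  algebraMap_mem' r := ⟨fun _ => r, contDiffOn_const, rfl⟩

namespace smoothFunctions

variable {V : Opens E}

/-- The restriction to `V` of a function that is smooth on `V`. -/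
def mk (g : E → ℝ) (hg : ContDiffOn ℝ ∞ g V) : smoothFunctions V :=
  ⟨fun y => g y, g, hg, rfl⟩

@[simp] lemma mk_apply (g : E → ℝ) (hg : ContDiffOn ℝ ∞ g V) (y : V) :
    (mk g hg : V → ℝ) y = g y := rfl

@[ext] lemma ext' {f g : smoothFunctions V} (h : ∀ y : V, (f : V → ℝ) y = (g : V → ℝ) y) : f = g :=
  Subtype.ext (funext h)

lemma exists_eq_mk (f : smoothFunctions V) : ∃ g hg, f = mk g hg := by
  obtain ⟨f, g, hg, rfl⟩ := f
  exact ⟨g, hg, rfl⟩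

/-- The directional derivative of a smooth function along a vector field, as a function. -/
def dirDeriv (e : E → E) (f : smoothFunctions V) (y : V) : ℝ :=
  fderiv ℝ f.2.choose y (e y)

lemma dirDeriv_mk (e : E → E) (g : E → ℝ) (hg : ContDiffOn ℝ ∞ g V) (y : V) :
    dirDeriv e (mk g hg) y = fderiv ℝ g y (e y) := by
  have hc := (mk g hg).2.choose_spec
  have : (mk g hg).2.choose =ᶠ[𝓝 (y : E)] g := by
    filter_upwards [V.isOpen.mem_nhds y.2] with z hz
    exact (congrFun hc.2 ⟨z, hz⟩).symm
  rw [dirDeriv, this.fderiv_eq]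

lemma contDiffAt_of_mem {F : Type*} [NormedAddCommGroup F] [NormedSpace ℝ F] {g : E → F}
    (hg : ContDiffOn ℝ ∞ g V) {y : E} (hy : y ∈ V) : ContDiffAt ℝ ∞ g y :=
  hg.contDiffAt (V.isOpen.mem_nhds hy)

lemma differentiableAt_of_mem {F : Type*} [NormedAddCommGroup F] [NormedSpace ℝ F] {g : E → F}
    (hg : ContDiffOn ℝ ∞ g V) {y : E} (hy : y ∈ V) : DifferentiableAt ℝ g y :=
  (contDiffAt_of_mem hg hy).differentiableAt (by simp)

lemma contDiffOn_fderiv {F : Type*} [NormedAddCommGroup F] [NormedSpace ℝ F] {g : E → F}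
    (hg : ContDiffOn ℝ ∞ g V) : ContDiffOn ℝ ∞ (fderiv ℝ g) V :=
  hg.fderiv_of_isOpen V.isOpen (by simp)

lemma contDiffOn_fderiv_apply {F : Type*} [NormedAddCommGroup F] [NormedSpace ℝ F] {g : E → F}
    (hg : ContDiffOn ℝ ∞ g V) {e : E → E} (he : ContDiffOn ℝ ∞ e V) :
    ContDiffOn ℝ ∞ (fun y => fderiv ℝ g y (e y)) V :=
  (contDiffOn_fderiv hg).clm_apply he

/-- A smooth vector field as a derivation of the algebra of smooth functions. -/
def vectorField (e : E → E) (he : ContDiffOn ℝ ∞ e V) :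
    Derivation ℝ (smoothFunctions V) (smoothFunctions V) :=
  Derivation.mk'
    { toFun := fun f => ⟨dirDeriv e f, by
        obtain ⟨g, hg, rfl⟩ := exists_eq_mk f
        exact ⟨_, contDiffOn_fderiv_apply hg he, funext (dirDeriv_mk e g hg)⟩⟩
      map_add' := by
        intro f₁ f₂
        obtain ⟨g₁, h₁, rfl⟩ := exists_eq_mk f₁
        obtain ⟨g₂, h₂, rfl⟩ := exists_eq_mk f₂
        ext y
        change dirDeriv e (mk (fun y => g₁ y + g₂ y) (h₁.add h₂)) y = dirDeriv e _ y + dirDeriv e _ y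
        simp only [dirDeriv_mk]
        rw [fderiv_fun_add (differentiableAt_of_mem h₁ y.2) (differentiableAt_of_mem h₂ y.2)]
        rfl
      map_smul' := by
        intro c f
        obtain ⟨g, hg, rfl⟩ := exists_eq_mk f
        ext y
        change dirDeriv e (mk (fun y => c * g y) (contDiffOn_const.mul hg)) y = c * dirDeriv e _ y
        simp only [dirDeriv_mk]
        rw [fderiv_const_mul (differentiableAt_of_mem hg y.2)]
        rfl }
    (by
      intro f₁ f₂
      obtain ⟨g₁, h₁, rfl⟩ := exists_eq_mk f₁
      obtain ⟨g₂, h₂, rfl⟩ := exists_eq_mk f₂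
      ext y
      change dirDeriv e (mk (fun y => g₁ y * g₂ y) (h₁.mul h₂)) y =
        g₁ y * dirDeriv e _ y + g₂ y * dirDeriv e _ y
      simp only [dirDeriv_mk]
      rw [fderiv_fun_mul (differentiableAt_of_mem h₁ y.2) (differentiableAt_of_mem h₂ y.2)]
      rfl)

lemma vectorField_mk (e : E → E) (he : ContDiffOn ℝ ∞ e V) (g : E → ℝ)
    (hg : ContDiffOn ℝ ∞ g V) :
    vectorField e he (mk g hg) = mk _ (contDiffOn_fderiv_apply hg he) := by
  ext y
  exact dirDeriv_mk e g hg y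

lemma contDiffOn_lieBracket {e f : E → E} (he : ContDiffOn ℝ ∞ e V) (hf : ContDiffOn ℝ ∞ f V) :
    ContDiffOn ℝ ∞ (VectorField.lieBracket ℝ e f) V :=
  (contDiffOn_fderiv_apply hf he).sub (contDiffOn_fderiv_apply he hf)

lemma fderiv_fderiv_apply {g : E → ℝ} (hg : ContDiffOn ℝ ∞ g V) {e : E → E}
    (he : ContDiffOn ℝ ∞ e V) {y : E} (hy : y ∈ V) (v : E) :
    fderiv ℝ (fun z => fderiv ℝ g z (e z)) y v =
      fderiv ℝ (fderiv ℝ g) y v (e y) + fderiv ℝ g y (fderiv ℝ e y v) := by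
  rw [fderiv_clm_apply (differentiableAt_of_mem (contDiffOn_fderiv hg) hy)
    (differentiableAt_of_mem he hy)]
  simp [add_comm]

lemma isSymmSndFDerivAt_of_mem {F : Type*} [NormedAddCommGroup F] [NormedSpace ℝ F] {g : E → F}
    (hg : ContDiffOn ℝ ∞ g V) {y : E} (hy : y ∈ V) :
    IsSymmSndFDerivAt ℝ g y :=
  (contDiffAt_of_mem hg hy).isSymmSndFDerivAt (by
    simpa using (WithTop.coe_le_coe.2 le_top : (((2 : ℕ∞) : WithTop ℕ∞)) ≤ ∞))

lemma bracket_vectorField {e f : E → E} (he : ContDiffOn ℝ ∞ e V) (hf : ContDiffOn ℝ ∞ f V) :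
    ⁅vectorField e he, vectorField f hf⁆ =
      vectorField (VectorField.lieBracket ℝ e f) (contDiffOn_lieBracket he hf) := by
  ext a y
  obtain ⟨g, hg, rfl⟩ := exists_eq_mk a
  rw [Derivation.commutator_apply]
  simp only [vectorField_mk, mk_apply, AddSubgroupClass.coe_sub, Pi.sub_apply]
  rw [fderiv_fderiv_apply hg hf y.2, fderiv_fderiv_apply hg he y.2,
    isSymmSndFDerivAt_of_mem hg y.2 (e y) (f y)]
  simp [VectorField.lieBracket]

lemma sum_smul_apply {ι A : Type*} [Fintype ι] [CommRing A] [Algebra ℝ A]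
    (c : ι → A) (D : ι → Derivation ℝ A A) (a : A) :
    (∑ i, c i • D i) a = ∑ i, c i * D i a := by
  classical
  refine (congrFun (map_sum (Derivation.coeFnAddMonoidHom (R := ℝ) (A := A) (M := A))
    (fun i => c i • D i) Finset.univ) a).trans ?_
  rw [Finset.sum_apply]
  rfl

lemma coe_sum_apply {ι : Type*} [Fintype ι] (c : ι → smoothFunctions V) (y : V) :
    ((∑ i, c i : smoothFunctions V) : V → ℝ) y = ∑ i, (c i : V → ℝ) y := by
  rw [AddSubmonoidClass.coe_finsetSum, Finset.sum_apply]

lemma vectorField_eq_sum {ι : Type*} [Fintype ι] {e : E → E} (he : ContDiffOn ℝ ∞ e V)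
    {f : ι → E → E} (hf : ∀ i, ContDiffOn ℝ ∞ (f i) V) {c : ι → smoothFunctions V}
    (h : ∀ y : V, e y = ∑ i, (c i : V → ℝ) y • f i y) :
    vectorField e he = ∑ i, c i • vectorField (f i) (hf i) := by
  ext a y
  obtain ⟨g, hg, rfl⟩ := exists_eq_mk a
  rw [sum_smul_apply, coe_sum_apply]
  simp [vectorField_mk, h y]

/-- Linear functionals are smooth functions, and a derivation acts on them by evaluation on the
vector. The coefficient at a point `y` is therefore detected by the functional `θ i y`, frozen at
`y`. -/
lemma linearIndependent_vectorField {ι : Type*} [Fintype ι] [DecidableEq ι] {f : ι → E → E}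
    (hf : ∀ i, ContDiffOn ℝ ∞ (f i) V) {θ : ι → E → E →L[ℝ] ℝ}
    (hθ : ∀ y ∈ V, ∀ i j, θ i y (f j y) = if i = j then 1 else 0) (c : ι → smoothFunctions V)
    (h : ∑ i, c i • vectorField (f i) (hf i) = 0) (i : ι) : c i = 0 := by
  ext y
  have key : ∀ L : E →L[ℝ] ℝ, ∑ i, (c i : V → ℝ) y * L (f i y) = 0 := by
    intro L
    have := congrArg (fun D : Derivation ℝ (smoothFunctions V) (smoothFunctions V) =>
      (D (mk L L.contDiff.contDiffOn) : V → ℝ) y) h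
    simp only [sum_smul_apply, coe_sum_apply] at this
    simpa [vectorField_mk] using this
  have := key (θ i y)
  simpa [hθ y y.2] using this

end smoothFunctions

end SmoothFunctions


/-! ### The overdetermined system of a reduced web and its inconsistency. -/

section ReducedStructure

set_option linter.unusedSimpArgs false

variable {A : Type*} [CommRing A] [Algebra ℝ A]

lemma Derivation.map_ofNat_eq_zero (D : Derivation ℝ A A) (n : ℕ) [n.AtLeastTwo] :
    D (ofNat(n) : A) = 0 := by
  rw [← Nat.cast_ofNat (R := A) (n := n)]
  exact D.map_natCast _

lemma eq_zero_of_ofNat_mul (n : ℕ) [n.AtLeastTwo] {x : A} (h : (OfNat.ofNat n : A) * x = 0) :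
    x = 0 := by
  have hn : (n : ℝ) ≠ 0 := Nat.cast_ne_zero.2 (NeZero.ne n)
  have h' : (n : ℝ) • x = 0 := by
    rw [← h, Nat.cast_smul_eq_nsmul, nsmul_eq_mul]
    rfl
  simpa [hn] using h'

/-- The structure equations of a web `W(3,2,2)` whose connection has the parallel covector
`(1, 0)`, in terms of a moving frame `X₁, X₂, Y₁, Y₂` acting by derivations on a ring of functions.
The forms `γ = ω₁¹`, `α = ω₁²`, `β = ω₂²` have the components `g`, `l`, `m`, the covector of the web
is `(3a, 0)`, and `3p₁, 3p₂, 3q₁, 3q₂` are the Pfaffian derivatives `p₁₁, p₁₂, q₁₁, q₁₂`.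
The functions `B, F, G, R` parametrize the second covariant derivatives of `a`. -/
structure ReducedWeb (A : Type*) [CommRing A] [Algebra ℝ A] where
  X1 : Derivation ℝ A A
  X2 : Derivation ℝ A A
  Y1 : Derivation ℝ A A
  Y2 : Derivation ℝ A A
  g1 : A
  g2 : A
  g3 : A
  g4 : A
  l1 : A
  l2 : A
  l3 : A
  l4 : A
  m1 : A
  m2 : A
  m3 : A
  m4 : A
  a : A
  p1 : A
  p2 : A
  q1 : A
  q2 : A
  B : A
  F : A
  G : A
  R : A
  b12 (f : A) : X1 (X2 f) - X2 (X1 f) = -g2 * X1 f + (m1 - l2 - 3 * a) * X2 f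
  b14 (f : A) : X1 (Y2 f) - Y2 (X1 f) = -g4 * X1 f - l4 * X2 f + m1 * Y2 f
  b23 (f : A) : X2 (Y1 f) - Y1 (X2 f) = -m3 * X2 f + g2 * Y1 f + l2 * Y2 f
  b24 (f : A) : X2 (Y2 f) - Y2 (X2 f) = -m4 * X2 f + m2 * Y2 f
  b34 (f : A) : Y1 (Y2 f) - Y2 (Y1 f) = -g4 * Y1 f + (m3 - l4 + 3 * a) * Y2 f
  cg12 : X1 g2 - X2 g1 = -g2 * g1 + (m1 - l2 - 3 * a) * g2
  cg14 : X1 g4 - Y2 g1 = -g4 * g1 - l4 * g2 + m1 * g4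
  cg23 : X2 g3 - Y1 g2 = -m3 * g2 + g2 * g3 + l2 * g4
  cg24 : X2 g4 - Y2 g2 = -m4 * g2 + m2 * g4
  cg34 : Y1 g4 - Y2 g3 = -g4 * g3 + (m3 - l4 + 3 * a) * g4
  cl12 : X1 l2 - X2 l1 = -g2 * l1 + (m1 - l2 - 3 * a) * l2
    + (g1 * l2 - g2 * l1) + (l1 * m2 - l2 * m1)
  cl14 : X1 l4 - Y2 l1 = -g4 * l1 - l4 * l2 + m1 * l4
    + (g1 * l4 - g4 * l1) + (l1 * m4 - l4 * m1) + (2 * p1 - q1)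
  cl23 : X2 l3 - Y1 l2 = -m3 * l2 + g2 * l3 + l2 * l4
    + (g2 * l3 - g3 * l2) + (l2 * m3 - l3 * m2) + (2 * q1 - p1)
  cl34 : Y1 l4 - Y2 l3 = -g4 * l3 + (m3 - l4 + 3 * a) * l4
    + (g3 * l4 - g4 * l3) + (l3 * m4 - l4 * m3)
  cm12 : X1 m2 - X2 m1 = -g2 * m1 + (m1 - l2 - 3 * a) * m2
  cm14 : X1 m4 - Y2 m1 = -g4 * m1 - l4 * m2 + m1 * m4 + (p2 - 2 * q2)
  cm23 : X2 m3 - Y1 m2 = -m3 * m2 + g2 * m3 + l2 * m4 + (q2 - 2 * p2)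
  cm24 : X2 m4 - Y2 m2 = -m4 * m2 + m2 * m4
  cm34 : Y1 m4 - Y2 m3 = -g4 * m3 + (m3 - l4 + 3 * a) * m4
  da_1 : X1 a = a * g1 + (p1)
  da_2 : X2 a = a * g2 + (p2)
  da_3 : Y1 a = a * g3 + (q1)
  da_4 : Y2 a = a * g4 + (q2)
  dp1_1 : X1 p1 = 2 * (p1 * g1) + p2 * l1 + (2 * R + 3 * (a * (2 * q1 - p1)))
  dp1_2 : X2 p1 = 2 * (p1 * g2) + p2 * l2 + (F + G + 3 * (a * q2))
  dp1_3 : Y1 p1 = 2 * (p1 * g3) + p2 * l3 + (R)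
  dp1_4 : Y2 p1 = 2 * (p1 * g4) + p2 * l4 + (G)
  dp2_1 : X1 p2 = p2 * (g1 + m1) + (F + G + 3 * (a * (q2 - p2)))
  dp2_2 : X2 p2 = p2 * (g2 + m2) + (2 * B)
  dp2_3 : Y1 p2 = p2 * (g3 + m3) + (F)
  dp2_4 : Y2 p2 = p2 * (g4 + m4) + (B)
  dq1_1 : X1 q1 = 2 * (q1 * g1) + q2 * l1 + (R)
  dq1_2 : X2 q1 = 2 * (q1 * g2) + q2 * l2 + (F)
  dq1_3 : Y1 q1 = 2 * (q1 * g3) + q2 * l3 + (2 * R - 3 * (a * (2 * p1 - q1)))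
  dq1_4 : Y2 q1 = 2 * (q1 * g4) + q2 * l4 + (F + G - 3 * (a * p2))
  dq2_1 : X1 q2 = q2 * (g1 + m1) + (G)
  dq2_2 : X2 q2 = q2 * (g2 + m2) + (B)
  dq2_3 : Y1 q2 = q2 * (g3 + m3) + (F + G + 3 * (a * (q2 - p2)))
  dq2_4 : Y2 q2 = q2 * (g4 + m4) + (2 * B)

namespace ReducedWeb

variable (W : ReducedWeb A)

/-- A covariant derivative of `B`. -/
def δB1 : A := W.X1 W.B - (W.g1 + 2 * W.m1) * W.B

/-- A covariant derivative of `B`. -/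
def δB2 : A := W.X2 W.B - (W.g2 + 2 * W.m2) * W.B

/-- A covariant derivative of `B`. -/
def δB3 : A := W.Y1 W.B - (W.g3 + 2 * W.m3) * W.B

/-- A covariant derivative of `B`. -/
def δB4 : A := W.Y2 W.B - (W.g4 + 2 * W.m4) * W.B

/-- A covariant derivative of `F`. -/
def δF1 : A := W.X1 W.F - ((2 * W.g1 + W.m1) * W.F + W.l1 * W.B)

/-- A covariant derivative of `F`. -/
def δF2 : A := W.X2 W.F - ((2 * W.g2 + W.m2) * W.F + W.l2 * W.B)

/-- A covariant derivative of `F`. -/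
def δF3 : A := W.Y1 W.F - ((2 * W.g3 + W.m3) * W.F + W.l3 * W.B)

/-- A covariant derivative of `F`. -/
def δF4 : A := W.Y2 W.F - ((2 * W.g4 + W.m4) * W.F + W.l4 * W.B)

/-- A covariant derivative of `G`. -/
def δG1 : A := W.X1 W.G - ((2 * W.g1 + W.m1) * W.G + W.l1 * W.B)

/-- A covariant derivative of `G`. -/
def δG2 : A := W.X2 W.G - ((2 * W.g2 + W.m2) * W.G + W.l2 * W.B)

/-- A covariant derivative of `G`. -/
def δG3 : A := W.Y1 W.G - ((2 * W.g3 + W.m3) * W.G + W.l3 * W.B)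

/-- A covariant derivative of `G`. -/
def δG4 : A := W.Y2 W.G - ((2 * W.g4 + W.m4) * W.G + W.l4 * W.B)

/-- A covariant derivative of `R`. -/
def δR2 : A := W.X2 W.R - (3 * W.g2 * W.R + W.l2 * (W.F + W.G))

/-- A covariant derivative of `R`. -/
def δR4 : A := W.Y2 W.R - (3 * W.g4 * W.R + W.l4 * (W.F + W.G))

/-- This and the following `comm_*` lemmas prolong the system: the bracket of two frame fields is
applied to `p₁, p₂, q₁, q₂`, whose derivatives are known. The structure equations for `g, l, m`
remove the derivatives of the connection, and what is left is linear in the first covariant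
derivatives of `B, F, G, R`. -/
lemma comm_p1_23 :
    -3 * W.F * W.a - W.δF3 - 3 * W.G * W.a - W.δG3 + W.δR2 + 9 * W.a^2 * W.p2 - 9 * W.a^2 * W.q2 - W.p1 * W.p2 + 2 * W.p2 * W.q1 - 3 * W.q1 * W.q2 = 0 := by
  have h := W.b23 W.p1
  simp only [W.da_1, W.da_2, W.da_3, W.da_4, W.dp1_1, W.dp1_2, W.dp1_3, W.dp1_4, W.dp2_1, W.dp2_2, W.dp2_3, W.dp2_4, W.dq1_1, W.dq1_2, W.dq1_3, W.dq1_4, W.dq2_1, W.dq2_2, W.dq2_3, W.dq2_4, map_add, map_sub, Derivation.map_ofNat_eq_zero, mul_zero, add_zero,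
    Derivation.leibniz, smul_eq_mul] at h
  simp only [δF3, δG3, δR2]
  linear_combination h - 2 * W.p1 * W.cg23 - W.p2 * W.cl23

lemma comm_p1_14 :
    -6 * W.F * W.a - 3 * W.G * W.a + W.δG1 - 2 * W.δR4 + 18 * W.a^2 * W.p2 + 2 * W.p1 * W.p2 + 3 * W.p1 * W.q2 - W.p2 * W.q1 - 6 * W.q1 * W.q2 = 0 := by
  have h := W.b14 W.p1
  simp only [W.da_1, W.da_2, W.da_3, W.da_4, W.dp1_1, W.dp1_2, W.dp1_3, W.dp1_4, W.dp2_1, W.dp2_2, W.dp2_3, W.dp2_4, W.dq1_1, W.dq1_2, W.dq1_3, W.dq1_4, W.dq2_1, W.dq2_2, W.dq2_3, W.dq2_4, map_add, map_sub, Derivation.map_ofNat_eq_zero, mul_zero, add_zero,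
    Derivation.leibniz, smul_eq_mul] at h
  simp only [δG1, δR4]
  linear_combination h - 2 * W.p1 * W.cg14 - W.p2 * W.cl14

lemma comm_q1_34 :
    -9 * W.F * W.a + W.δF3 + W.δG3 - 2 * W.δR4 + 18 * W.a^2 * W.p2 + 6 * W.p1 * W.q2 - 3 * W.p2 * W.q1 - 3 * W.q1 * W.q2 = 0 := by
  have h := W.b34 W.q1
  simp only [W.da_1, W.da_2, W.da_3, W.da_4, W.dp1_1, W.dp1_2, W.dp1_3, W.dp1_4, W.dp2_1, W.dp2_2, W.dp2_3, W.dp2_4, W.dq1_1, W.dq1_2, W.dq1_3, W.dq1_4, W.dq2_1, W.dq2_2, W.dq2_3, W.dq2_4, map_add, map_sub, Derivation.map_ofNat_eq_zero, mul_zero, add_zero,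
    Derivation.leibniz, smul_eq_mul] at h
  simp only [δF3, δG3, δR4]
  linear_combination h - 2 * W.q1 * W.cg34 - W.q2 * W.cl34

lemma comm_p1_12 :
    W.δF1 + 9 * W.G * W.a + W.δG1 - 2 * W.δR2 + 18 * W.a^2 * W.q2 + 3 * W.p1 * W.p2 + 3 * W.p1 * W.q2 - 6 * W.p2 * W.q1 = 0 := by
  have h := W.b12 W.p1
  simp only [W.da_1, W.da_2, W.da_3, W.da_4, W.dp1_1, W.dp1_2, W.dp1_3, W.dp1_4, W.dp2_1, W.dp2_2, W.dp2_3, W.dp2_4, W.dq1_1, W.dq1_2, W.dq1_3, W.dq1_4, W.dq2_1, W.dq2_2, W.dq2_3, W.dq2_4, map_add, map_sub, Derivation.map_ofNat_eq_zero, mul_zero, add_zero,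
    Derivation.leibniz, smul_eq_mul] at h
  simp only [δF1, δG1, δR2]
  linear_combination h - 2 * W.p1 * W.cg12 - W.p2 * W.cl12

lemma comm_q1_12 :
    3 * W.F * W.a + W.δF1 - W.δR2 = 0 := by
  have h := W.b12 W.q1
  simp only [W.da_1, W.da_2, W.da_3, W.da_4, W.dp1_1, W.dp1_2, W.dp1_3, W.dp1_4, W.dp2_1, W.dp2_2, W.dp2_3, W.dp2_4, W.dq1_1, W.dq1_2, W.dq1_3, W.dq1_4, W.dq2_1, W.dq2_2, W.dq2_3, W.dq2_4, map_add, map_sub, Derivation.map_ofNat_eq_zero, mul_zero, add_zero,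
    Derivation.leibniz, smul_eq_mul] at h
  simp only [δF1, δR2]
  linear_combination h - 2 * W.q1 * W.cg12 - W.q2 * W.cl12

lemma comm_p2_24 :
    W.δB2 - 2 * W.δB4 = 0 := by
  have h := W.b24 W.p2
  simp only [W.da_1, W.da_2, W.da_3, W.da_4, W.dp1_1, W.dp1_2, W.dp1_3, W.dp1_4, W.dp2_1, W.dp2_2, W.dp2_3, W.dp2_4, W.dq1_1, W.dq1_2, W.dq1_3, W.dq1_4, W.dq2_1, W.dq2_2, W.dq2_3, W.dq2_4, map_add, map_sub, Derivation.map_ofNat_eq_zero, mul_zero, add_zero,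
    Derivation.leibniz, smul_eq_mul] at h
  simp only [δB2, δB4]
  linear_combination h - W.p2 * W.cg24 - W.p2 * W.cm24

lemma comm_q2_24 :
    2 * W.δB2 - W.δB4 = 0 := by
  have h := W.b24 W.q2
  simp only [W.da_1, W.da_2, W.da_3, W.da_4, W.dp1_1, W.dp1_2, W.dp1_3, W.dp1_4, W.dp2_1, W.dp2_2, W.dp2_3, W.dp2_4, W.dq1_1, W.dq1_2, W.dq1_3, W.dq1_4, W.dq2_1, W.dq2_2, W.dq2_3, W.dq2_4, map_add, map_sub, Derivation.map_ofNat_eq_zero, mul_zero, add_zero,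
    Derivation.leibniz, smul_eq_mul] at h
  simp only [δB2, δB4]
  linear_combination h - W.q2 * W.cg24 - W.q2 * W.cm24

lemma comm_p2_12 :
    9 * W.B * W.a + 2 * W.δB1 - W.δF2 - W.δG2 - 3 * W.p2 * W.q2 + 3 * W.p2^2 = 0 := by
  have h := W.b12 W.p2
  simp only [W.da_1, W.da_2, W.da_3, W.da_4, W.dp1_1, W.dp1_2, W.dp1_3, W.dp1_4, W.dp2_1, W.dp2_2, W.dp2_3, W.dp2_4, W.dq1_1, W.dq1_2, W.dq1_3, W.dq1_4, W.dq2_1, W.dq2_2, W.dq2_3, W.dq2_4, map_add, map_sub, Derivation.map_ofNat_eq_zero, mul_zero, add_zero,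
    Derivation.leibniz, smul_eq_mul] at h
  simp only [δB1, δF2, δG2]
  linear_combination h - W.p2 * W.cg12 - W.p2 * W.cm12

lemma comm_p2_23 :
    -2 * W.δB3 + W.δF2 + W.p2 * W.q2 - 2 * W.p2^2 = 0 := by
  have h := W.b23 W.p2
  simp only [W.da_1, W.da_2, W.da_3, W.da_4, W.dp1_1, W.dp1_2, W.dp1_3, W.dp1_4, W.dp2_1, W.dp2_2, W.dp2_3, W.dp2_4, W.dq1_1, W.dq1_2, W.dq1_3, W.dq1_4, W.dq2_1, W.dq2_2, W.dq2_3, W.dq2_4, map_add, map_sub, Derivation.map_ofNat_eq_zero, mul_zero, add_zero,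
    Derivation.leibniz, smul_eq_mul] at h
  simp only [δB3, δF2]
  linear_combination h - W.p2 * W.cg23 - W.p2 * W.cm23

lemma comm_p2_34 :
    -3 * W.B * W.a + W.δB3 - W.δF4 = 0 := by
  have h := W.b34 W.p2
  simp only [W.da_1, W.da_2, W.da_3, W.da_4, W.dp1_1, W.dp1_2, W.dp1_3, W.dp1_4, W.dp2_1, W.dp2_2, W.dp2_3, W.dp2_4, W.dq1_1, W.dq1_2, W.dq1_3, W.dq1_4, W.dq2_1, W.dq2_2, W.dq2_3, W.dq2_4, map_add, map_sub, Derivation.map_ofNat_eq_zero, mul_zero, add_zero,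
    Derivation.leibniz, smul_eq_mul] at h
  simp only [δB3, δF4]
  linear_combination h - W.p2 * W.cg34 - W.p2 * W.cm34

lemma comm_q2_12 :
    3 * W.B * W.a + W.δB1 - W.δG2 = 0 := by
  have h := W.b12 W.q2
  simp only [W.da_1, W.da_2, W.da_3, W.da_4, W.dp1_1, W.dp1_2, W.dp1_3, W.dp1_4, W.dp2_1, W.dp2_2, W.dp2_3, W.dp2_4, W.dq1_1, W.dq1_2, W.dq1_3, W.dq1_4, W.dq2_1, W.dq2_2, W.dq2_3, W.dq2_4, map_add, map_sub, Derivation.map_ofNat_eq_zero, mul_zero, add_zero,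
    Derivation.leibniz, smul_eq_mul] at h
  simp only [δB1, δG2]
  linear_combination h - W.q2 * W.cg12 - W.q2 * W.cm12

lemma comm_q2_14 :
    2 * W.δB1 - W.δG4 + W.p2 * W.q2 - 2 * W.q2^2 = 0 := by
  have h := W.b14 W.q2
  simp only [W.da_1, W.da_2, W.da_3, W.da_4, W.dp1_1, W.dp1_2, W.dp1_3, W.dp1_4, W.dp2_1, W.dp2_2, W.dp2_3, W.dp2_4, W.dq1_1, W.dq1_2, W.dq1_3, W.dq1_4, W.dq2_1, W.dq2_2, W.dq2_3, W.dq2_4, map_add, map_sub, Derivation.map_ofNat_eq_zero, mul_zero, add_zero,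
    Derivation.leibniz, smul_eq_mul] at h
  simp only [δB1, δG4]
  linear_combination h - W.q2 * W.cg14 - W.q2 * W.cm14

lemma comm_q2_34 :
    -9 * W.B * W.a + 2 * W.δB3 - W.δF4 - W.δG4 + 3 * W.p2 * W.q2 - 3 * W.q2^2 = 0 := by
  have h := W.b34 W.q2
  simp only [W.da_1, W.da_2, W.da_3, W.da_4, W.dp1_1, W.dp1_2, W.dp1_3, W.dp1_4, W.dp2_1, W.dp2_2, W.dp2_3, W.dp2_4, W.dq1_1, W.dq1_2, W.dq1_3, W.dq1_4, W.dq2_1, W.dq2_2, W.dq2_3, W.dq2_4, map_add, map_sub, Derivation.map_ofNat_eq_zero, mul_zero, add_zero,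
    Derivation.leibniz, smul_eq_mul] at h
  simp only [δB3, δF4, δG4]
  linear_combination h - W.q2 * W.cg34 - W.q2 * W.cm34

lemma δB2_eq_zero :
    W.δB2 = 0 := by
  exact eq_zero_of_ofNat_mul 3 (by linear_combination -W.comm_p2_24 + 2 * W.comm_q2_24)

lemma δB4_eq_zero :
    W.δB4 = 0 := by
  exact eq_zero_of_ofNat_mul 3 (by linear_combination -2 * W.comm_p2_24 + W.comm_q2_24)

/-- The six commutators of `p₂` and `q₂` other than those along `X₂, Y₂` form a solvable linear
system for the six quantities `δB1, δB3, δF2, δG2, δF4, δG4`. This lemma and the next five are its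
solution. -/
lemma three_mul_δB1 :
    3 * W.δB1 = -6 * (W.B * W.a) + 2 * W.p2 * W.q2 + W.p2 ^ 2 - 2 * W.q2 ^ 2 := by
  linear_combination (2) * W.comm_q2_14 + (2) * W.comm_p2_34 + (-1) * W.comm_p2_23 + (-1) * W.comm_p2_12 + (-2) * W.comm_q2_34 + (1) * W.comm_q2_12

lemma three_mul_δB3 :
    3 * W.δB3 = 6 * (W.B * W.a) - 2 * W.p2 * W.q2 + 2 * W.p2 ^ 2 - W.q2 ^ 2 := by
  linear_combination (1) * W.comm_q2_14 + (1) * W.comm_p2_34 + (-2) * W.comm_p2_23 + (-2) * W.comm_p2_12 + (-1) * W.comm_q2_34 + (2) * W.comm_q2_12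

lemma three_mul_δF2 :
    3 * W.δF2 = 12 * (W.B * W.a) - 7 * W.p2 * W.q2 + 10 * W.p2 ^ 2 - 2 * W.q2 ^ 2 := by
  linear_combination (2) * W.comm_q2_14 + (2) * W.comm_p2_34 + (-1) * W.comm_p2_23 + (-4) * W.comm_p2_12 + (-2) * W.comm_q2_34 + (4) * W.comm_q2_12

lemma three_mul_δG2 :
    3 * W.δG2 = 3 * (W.B * W.a) + 2 * W.p2 * W.q2 + W.p2 ^ 2 - 2 * W.q2 ^ 2 := by
  linear_combination (2) * W.comm_q2_14 + (2) * W.comm_p2_34 + (-1) * W.comm_p2_23 + (-1) * W.comm_p2_12 + (-2) * W.comm_q2_34 + (-2) * W.comm_q2_12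

lemma three_mul_δF4 :
    3 * W.δF4 = -3 * (W.B * W.a) - 2 * W.p2 * W.q2 + 2 * W.p2 ^ 2 - W.q2 ^ 2 := by
  linear_combination (1) * W.comm_q2_14 + (-2) * W.comm_p2_34 + (-2) * W.comm_p2_23 + (-2) * W.comm_p2_12 + (-1) * W.comm_q2_34 + (2) * W.comm_q2_12

lemma three_mul_δG4 :
    3 * W.δG4 = -12 * (W.B * W.a) + 7 * W.p2 * W.q2 + 2 * W.p2 ^ 2 - 10 * W.q2 ^ 2 := by
  linear_combination (1) * W.comm_q2_14 + (4) * W.comm_p2_34 + (-2) * W.comm_p2_23 + (-2) * W.comm_p2_12 + (-4) * W.comm_q2_34 + (2) * W.comm_q2_12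

/-- The five commutators of `p₁` and `q₁` involve the six unknowns `δF1, δF3, δG1, δG3, δR2, δR4`,
yet this combination cancels all of them. It is the compatibility condition that starts the
elimination. -/
lemma relation :
    3 * (W.a * (W.G - W.F)) + 3 * (W.a ^ 2 * (W.p2 + W.q2)) + 2 * (W.p1 * W.q2 - W.p2 * W.q1) = 0 := by
  exact eq_zero_of_ofNat_mul 3 (by linear_combination W.comm_p1_23 - W.comm_p1_14 + W.comm_q1_34 + W.comm_p1_12 - W.comm_q1_12)

/-- Differentiation is along `X₂`, and along `Y₂` in `relation_4`, because all derivatives that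
occur are then known. The multiple of `relation` by `3 g₂ + m₂` subtracted at the end is the weight
of that relation under the connection, which makes the derivative covariant. -/
lemma relation_2 :
    2 * (W.B * W.p1) - 4 * (W.B * W.q1) - 5 * (W.F * W.p2) + 2 * (W.F * W.q2) + 3 * (W.G * W.p2) + 2 * (W.G * W.q2)
      + 15 * (W.a * (W.p2 * W.q2)) - 3 * (W.a * W.p2 ^ 2) + 6 * (W.a * W.q2 ^ 2) = 0 := by
  have h := congrArg W.X2 W.relation
  have hF := W.three_mul_δF2
  have hG := W.three_mul_δG2
  simp only [δF2, δG2] at hF hG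
  simp only [W.da_2, W.dp1_2, W.dp2_2, W.dq1_2, W.dq2_2, map_add, map_sub, map_zero,
    Derivation.map_ofNat_eq_zero, mul_zero, add_zero, zero_add, Derivation.leibniz, smul_eq_mul, Derivation.leibniz_pow,
    nsmul_eq_mul, Nat.cast_ofNat, Nat.reduceSub, pow_one] at h
  linear_combination h + W.a * hF - W.a * hG - (3 * W.g2 + W.m2) * W.relation

lemma relation_4 :
    4 * (W.B * W.p1) - 2 * (W.B * W.q1) - 2 * (W.F * W.p2) - 3 * (W.F * W.q2) - 2 * (W.G * W.p2) + 5 * (W.G * W.q2)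
      + 15 * (W.a * (W.p2 * W.q2)) + 6 * (W.a * W.p2 ^ 2) - 3 * (W.a * W.q2 ^ 2) = 0 := by
  have h := congrArg W.Y2 W.relation
  have hF := W.three_mul_δF4
  have hG := W.three_mul_δG4
  simp only [δF4, δG4] at hF hG
  simp only [W.da_4, W.dp1_4, W.dp2_4, W.dq1_4, W.dq2_4, map_add, map_sub, map_zero,
    Derivation.map_ofNat_eq_zero, mul_zero, add_zero, zero_add, Derivation.leibniz, smul_eq_mul, Derivation.leibniz_pow,
    nsmul_eq_mul, Nat.cast_ofNat, Nat.reduceSub, pow_one] at h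
  linear_combination h + W.a * hF - W.a * hG - (3 * W.g4 + W.m4) * W.relation

/-- In the second derivative `p₁` and `q₁` drop out, and `F, G` survive only in the product `B(G -
F)`; `relation_44` is the counterpart along `Y₂`. -/
lemma relation_22 :
    30 * (W.B * (W.G - W.F)) - 42 * (W.B * (W.a * W.p2)) + 174 * (W.B * (W.a * W.q2)) + 12 * (W.p2 * W.q2 ^ 2)
      + 108 * (W.p2 ^ 2 * W.q2) - 56 * W.p2 ^ 3 - 8 * W.q2 ^ 3 = 0 := by
  have h := congrArg W.X2 W.relation_2
  have hB := W.δB2_eq_zero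
  have hF := W.three_mul_δF2
  have hG := W.three_mul_δG2
  simp only [δB2, δF2, δG2] at hB hF hG
  simp only [W.da_2, W.dp1_2, W.dp2_2, W.dq1_2, W.dq2_2, map_add, map_sub, map_zero,
    Derivation.map_ofNat_eq_zero, mul_zero, add_zero, zero_add, Derivation.leibniz, smul_eq_mul, Derivation.leibniz_pow,
    nsmul_eq_mul, Nat.cast_ofNat, Nat.reduceSub, pow_one] at h
  linear_combination 3 * h - 3 * (2 * W.p1 - 4 * W.q1) * hB + (5 * W.p2 - 2 * W.q2) * hF
    - (3 * W.p2 + 2 * W.q2) * hG - 3 * (3 * W.g2 + 2 * W.m2) * W.relation_2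

lemma relation_44 :
    30 * (W.B * (W.G - W.F)) + 174 * (W.B * (W.a * W.p2)) - 42 * (W.B * (W.a * W.q2)) + 108 * (W.p2 * W.q2 ^ 2)
      + 12 * (W.p2 ^ 2 * W.q2) - 8 * W.p2 ^ 3 - 56 * W.q2 ^ 3 = 0 := by
  have h := congrArg W.Y2 W.relation_4
  have hB := W.δB4_eq_zero
  have hF := W.three_mul_δF4
  have hG := W.three_mul_δG4
  simp only [δB4, δF4, δG4] at hB hF hG
  simp only [W.da_4, W.dp1_4, W.dp2_4, W.dq1_4, W.dq2_4, map_add, map_sub, map_zero,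
    Derivation.map_ofNat_eq_zero, mul_zero, add_zero, zero_add, Derivation.leibniz, smul_eq_mul, Derivation.leibniz_pow,
    nsmul_eq_mul, Nat.cast_ofNat, Nat.reduceSub, pow_one] at h
  linear_combination 3 * h - 3 * (4 * W.p1 - 2 * W.q1) * hB + (2 * W.p2 + 3 * W.q2) * hF
    - (-2 * W.p2 + 5 * W.q2) * hG - 3 * (3 * W.g4 + 2 * W.m4) * W.relation_4

/-- In the third derivative of `relation` along `X₂` the terms with `a`, `F` and `G` cancel as well,
leaving a condition on `B, p₂, q₂` alone; three derivatives along `Y₂` give `B_mul_q2_sq`. -/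
lemma B_mul_p2_sq :
    W.B * W.p2 ^ 2 = 2 * (W.B * (W.p2 * W.q2)) := by
  have h := congrArg W.X2 W.relation_22
  have hB := W.δB2_eq_zero
  have hF := W.three_mul_δF2
  have hG := W.three_mul_δG2
  simp only [δB2, δF2, δG2] at hB hF hG
  simp only [W.da_2, W.dp1_2, W.dp2_2, W.dq1_2, W.dq2_2, map_add, map_sub, map_zero,
    Derivation.map_ofNat_eq_zero, mul_zero, add_zero, zero_add, Derivation.leibniz, smul_eq_mul, Derivation.leibniz_pow,
    nsmul_eq_mul, Nat.cast_ofNat, Nat.reduceSub, pow_one] at h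
  refine sub_eq_zero.1 (eq_zero_of_ofNat_mul 360 ?_)
  linear_combination -h + (30 * (W.G - W.F) - 42 * (W.a * W.p2) + 174 * (W.a * W.q2)) * hB - 10 * W.B * hF + 10 * W.B * hG
    + (3 * W.g2 + 3 * W.m2) * W.relation_22

lemma B_mul_q2_sq :
    W.B * W.q2 ^ 2 = 2 * (W.B * (W.p2 * W.q2)) := by
  have h := congrArg W.Y2 W.relation_44
  have hB := W.δB4_eq_zero
  have hF := W.three_mul_δF4
  have hG := W.three_mul_δG4
  simp only [δB4, δF4, δG4] at hB hF hG
  simp only [W.da_4, W.dp1_4, W.dp2_4, W.dq1_4, W.dq2_4, map_add, map_sub, map_zero,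
    Derivation.map_ofNat_eq_zero, mul_zero, add_zero, zero_add, Derivation.leibniz, smul_eq_mul, Derivation.leibniz_pow,
    nsmul_eq_mul, Nat.cast_ofNat, Nat.reduceSub, pow_one] at h
  refine sub_eq_zero.1 (eq_zero_of_ofNat_mul 360 ?_)
  linear_combination -h + (30 * (W.G - W.F) + 174 * (W.a * W.p2) - 42 * (W.a * W.q2)) * hB - 10 * W.B * hF + 10 * W.B * hG
    + (3 * W.g4 + 3 * W.m4) * W.relation_44

/-- The covariant derivatives `p₁₂`, `q₁₂` of the covector of such a web cannot be nonzero
everywhere. -/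
theorem not_isUnit [Nontrivial A] : ¬ IsUnit (W.p2 ^ 2 + W.q2 ^ 2) := by
  rintro ⟨u, hu⟩
  have cancel : ∀ x : A, x * (W.p2 ^ 2 + W.q2 ^ 2) ^ 2 = 0 → x = 0 := by
    intro x hx
    rw [← hu, ← Units.val_pow_eq_pow_val] at hx
    exact (Units.mul_left_eq_zero _).1 hx
  have h1 := W.B_mul_p2_sq
  have h2 := W.B_mul_q2_sq
  -- The forms `p₂² - 2p₂q₂` and `q₂² - 2p₂q₂` have no common zero except the origin, so a power of
  -- `p₂² + q₂²` lies in their ideal. The next lines exhibit this membership.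
  have h3 : W.B * (W.p2 ^ 2 * W.q2) = 0 :=
    eq_zero_of_ofNat_mul 3 (by linear_combination -W.q2 * h1 - 2 * W.p2 * h2)
  have hB : W.B = 0 := by
    apply cancel
    linear_combination W.p2 ^ 2 * h1 + W.q2 ^ 2 * h2 + 2 * (W.p2 + 3 * W.q2) * h3
      + 2 * W.p2 * W.q2 * h2
  have h4 := W.three_mul_δB1
  have h5 := W.three_mul_δB3
  -- With `B = 0` these read `p₂² + 2p₂q₂ - 2q₂² = 0` and `2p₂² - 2p₂q₂ - q₂² = 0`; their sum is
  -- `3(p₂² - q₂²)`.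
  simp only [δB1, δB3, hB, map_zero] at h4 h5
  have h6 : W.p2 ^ 2 - W.q2 ^ 2 = 0 := eq_zero_of_ofNat_mul 3 (by linear_combination -h4 - h5)
  have h7 : W.q2 ^ 4 = 0 := by
    refine eq_zero_of_ofNat_mul 3 ?_
    -- Modulo `p₂² = q₂²` the first form is `2p₂q₂ - q₂²`; multiplied by `2p₂q₂ + q₂²` it becomes
    -- `3q₂⁴`.
    linear_combination -(2 * W.p2 * W.q2 + W.q2 ^ 2) * (h4 + h6) - 4 * W.q2 ^ 2 * h6
  refine one_ne_zero (cancel (1 : A) ?_)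
  linear_combination (W.p2 ^ 2 + 3 * W.q2 ^ 2) * h6 + 4 * h7

end ReducedWeb

end ReducedStructure


/-! ### Moving frames on a ring of functions: the Jacobi identity and `d² = 0` on one-forms. -/

section MovingFrames

variable {A ι : Type*} [CommRing A] [Algebra ℝ A] [Fintype ι]

lemma Derivation.lie_smul_right (D D' : Derivation ℝ A A) (f : A) :
    ⁅D, f • D'⁆ = f • ⁅D, D'⁆ + D f • D' := by
  ext x
  simp only [Derivation.commutator_apply, Derivation.smul_apply, Derivation.add_apply,
    Derivation.leibniz, smul_eq_mul]
  ring

/-- A moving frame on a ring of functions: derivations `e i` that are linearly independent and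
span a Lie algebra, with the structure functions `c`. -/
structure MovingFrame (A ι : Type*) [CommRing A] [Algebra ℝ A] [Fintype ι] where
  e : ι → Derivation ℝ A A
  c : ι → ι → ι → A
  lie_e (i j : ι) : ⁅e i, e j⁆ = ∑ k, c i j k • e k
  independent (f : ι → A) (h : ∑ k, f k • e k = 0) (k : ι) : f k = 0

namespace MovingFrame

variable (M : MovingFrame A ι)

lemma commutator_apply (i j : ι) (f : A) :
    M.e i (M.e j f) - M.e j (M.e i f) = ∑ k, M.c i j k * M.e k f := by
  rw [← Derivation.commutator_apply, M.lie_e, smoothFunctions.sum_smul_apply]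

lemma lie_lie_e (i j k : ι) :
    ⁅M.e i, ⁅M.e j, M.e k⁆⁆ =
      ∑ n, (M.e i (M.c j k n) - ∑ m, M.c j k m * M.c m i n) • M.e n := by
  rw [M.lie_e, lie_sum]
  simp_rw [Derivation.lie_smul_right, sub_smul, Finset.sum_add_distrib, Finset.sum_sub_distrib]
  have : ∀ m, M.c j k m • ⁅M.e i, M.e m⁆ = -∑ n, (M.c j k m * M.c m i n) • M.e n := by
    intro m
    rw [← lie_skew, M.lie_e, smul_neg, Finset.smul_sum]
    simp_rw [smul_smul]
  simp_rw [this, Finset.sum_neg_distrib, Finset.sum_smul]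
  rw [Finset.sum_comm, add_comm, sub_eq_add_neg]

lemma jacobi (i j k n : ι) :
    (M.e i (M.c j k n) - ∑ m, M.c j k m * M.c m i n)
      + (M.e j (M.c k i n) - ∑ m, M.c k i m * M.c m j n)
      + (M.e k (M.c i j n) - ∑ m, M.c i j m * M.c m k n) = 0 := by
  refine M.independent (fun n => (M.e i (M.c j k n) - ∑ m, M.c j k m * M.c m i n)
      + (M.e j (M.c k i n) - ∑ m, M.c k i m * M.c m j n)
      + (M.e k (M.c i j n) - ∑ m, M.c i j m * M.c m k n)) ?_ n
  have := lie_jacobi (M.e i) (M.e j) (M.e k)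
  simpa only [lie_lie_e, ← Finset.sum_add_distrib, ← add_smul] using this

/-- The exterior differential of the one-form with the components `φ` in the moving frame. -/
def extDeriv (φ : ι → A) (i j : ι) : A :=
  M.e i (φ j) - M.e j (φ i) - ∑ k, M.c i j k * φ k

lemma extDeriv_extDeriv (φ : ι → A) (i j k : ι) :
    (M.e i (M.extDeriv φ j k) - ∑ m, M.c j k m * M.extDeriv φ m i)
      + (M.e j (M.extDeriv φ k i) - ∑ m, M.c k i m * M.extDeriv φ m j)
      + (M.e k (M.extDeriv φ i j) - ∑ m, M.c i j m * M.extDeriv φ m k) = 0 := by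
  -- Each cyclic term splits into derivatives of `φ`, which pair up into commutators, and a Jacobi
  -- term multiplied by `φ`, which sums to zero.
  have key : ∀ i j k, M.e i (M.extDeriv φ j k) - ∑ m, M.c j k m * M.extDeriv φ m i =
      M.e i (M.e j (φ k)) - M.e i (M.e k (φ j)) - ∑ m, M.c j k m * M.e m (φ i)
        - ∑ n, (M.e i (M.c j k n) - ∑ m, M.c j k m * M.c m i n) * φ n := by
    intro i j k
    have h : ∑ m, M.c j k m * ∑ n, M.c m i n * φ n =
        ∑ n, (∑ m, M.c j k m * M.c m i n) * φ n := by
      simp_rw [Finset.mul_sum, Finset.sum_mul]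
      rw [Finset.sum_comm]
      simp_rw [mul_assoc]
    simp only [extDeriv, map_sub, map_sum, Derivation.leibniz, smul_eq_mul, mul_sub, sub_mul,
      Finset.sum_sub_distrib, Finset.sum_add_distrib, h]
    simp_rw [mul_comm (φ _)]
    ring
  have hJ : ∑ n, ((M.e i (M.c j k n) - ∑ m, M.c j k m * M.c m i n)
      + (M.e j (M.c k i n) - ∑ m, M.c k i m * M.c m j n)
      + (M.e k (M.c i j n) - ∑ m, M.c i j m * M.c m k n)) * φ n = 0 := by
    simp [M.jacobi]
  simp only [add_mul, Finset.sum_add_distrib] at hJ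
  rw [key, key, key]
  linear_combination M.commutator_apply i j (φ k) + M.commutator_apply j k (φ i)
    + M.commutator_apply k i (φ j) - hJ

end MovingFrame

end MovingFrames

/-! ### Web frames and the first Bianchi identities. -/

section AdaptedMovingFrames

set_option linter.flexible false

variable {A : Type*} [CommRing A] [Algebra ℝ A]

/-- The structure functions of a moving frame adapted to a web `W(3,2,2)`; the frame vectors
`inl k` and `inr k` are dual to `ω₁ᵏ` and `ω₂ᵏ`, `w j i` are the components of the connection form
`ω_jⁱ` and `a` is the covector of the web. -/
def webCoeff (w : Fin 2 → Fin 2 → Fin 2 ⊕ Fin 2 → A) (a : Fin 2 → A) :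
    Fin 2 ⊕ Fin 2 → Fin 2 ⊕ Fin 2 → Fin 2 ⊕ Fin 2 → A
  | .inl k, .inl l, .inl i => w l i (.inl k) - w k i (.inl l)
      - (if l = i then a k else 0) + (if k = i then a l else 0)
  | .inl _, .inl _, .inr _ => 0
  | .inl k, .inr l, .inl i => -w k i (.inr l)
  | .inl k, .inr l, .inr i => w l i (.inl k)
  | .inr l, .inl k, .inl i => w k i (.inr l)
  | .inr l, .inl k, .inr i => -w l i (.inl k)
  | .inr _, .inr _, .inl _ => 0
  | .inr k, .inr l, .inr i => w l i (.inr k) - w k i (.inr l)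
      + (if l = i then a k else 0) - (if k = i then a l else 0)

/-- A moving frame adapted to a web `W(3,2,2)`. -/
structure WebFrame (A : Type*) [CommRing A] [Algebra ℝ A] extends
    MovingFrame A (Fin 2 ⊕ Fin 2) where
  w : Fin 2 → Fin 2 → Fin 2 ⊕ Fin 2 → A
  a : Fin 2 → A
  c_eq : c = webCoeff w a

namespace WebFrame

variable (W : WebFrame A)

/-- The components of the curvature form `dω_jⁱ - ω_jᵐ ∧ ω_mⁱ`. -/
def curv (j i : Fin 2) (r s : Fin 2 ⊕ Fin 2) : A :=
  W.extDeriv (W.w j i) r s - ∑ m, (W.w j m r * W.w m i s - W.w j m s * W.w m i r)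

/-- The curvature tensor of the web. -/
def b (i j k l : Fin 2) : A := W.curv j i (.inl k) (.inr l)

/-- The covariant differential of the covector of the web; its components along the two halves of
the frame are the Pfaffian derivatives `p` and `q`. -/
def covA (i : Fin 2) (r : Fin 2 ⊕ Fin 2) : A := W.e r (W.a i) - ∑ m, W.a m * W.w i m r

/-- This is the `ω₁ ∧ ω₁ ∧ ω₂` part of `d²ω₂ⁱ = 0`: the terms with `a` contain two factors `ω₂`, so
only the `ω₁ ∧ ω₁` part of the curvature contributes. -/
lemma curv_inl (j i : Fin 2) : W.curv j i (.inl 0) (.inl 1) = 0 := by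
  have h := W.jacobi (.inl 0) (.inl 1) (.inr j) (.inr i)
  rw [W.c_eq] at h
  fin_cases i <;> fin_cases j <;>
  · simp [webCoeff, Fintype.sum_sum_type, Fin.sum_univ_two] at h
    simp [curv, MovingFrame.extDeriv, W.c_eq, webCoeff, Fintype.sum_sum_type, Fin.sum_univ_two]
    linear_combination h

lemma curv_inr (j i : Fin 2) : W.curv j i (.inr 0) (.inr 1) = 0 := by
  have h := W.jacobi (.inr 0) (.inr 1) (.inl j) (.inl i)
  rw [W.c_eq] at h
  fin_cases i <;> fin_cases j <;>
  · simp [webCoeff, Fintype.sum_sum_type, Fin.sum_univ_two] at h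
    simp [curv, MovingFrame.extDeriv, W.c_eq, webCoeff, Fintype.sum_sum_type, Fin.sum_univ_two]
    linear_combination h

/-- The `ω₁ ∧ ω₁ ∧ ω₂` part of `d²ω₁ⁱ = 0`: skewing `b` in its first two lower indices gives the
torsion's derivative, hence `q`. Exchanging the two halves of the frame skews the first and third
indices and gives `p`, which is `b_sub_b_eq_inl`. -/
lemma b_sub_b_eq_inr (i m : Fin 2) :
    W.b i 0 1 m - W.b i 1 0 m =
      (if i = 1 then W.covA 0 (.inr m) else 0) - (if i = 0 then W.covA 1 (.inr m) else 0) := by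
  have h := W.jacobi (.inl 0) (.inl 1) (.inr m) (.inl i)
  rw [W.c_eq] at h
  fin_cases i <;> fin_cases m <;>
  · simp [webCoeff, Fintype.sum_sum_type, Fin.sum_univ_two] at h
    simp [b, covA, curv, MovingFrame.extDeriv, W.c_eq, webCoeff, Fintype.sum_sum_type,
      Fin.sum_univ_two]
    linear_combination h

lemma b_sub_b_eq_inl (i m : Fin 2) :
    W.b i 0 m 1 - W.b i 1 m 0 =
      (if i = 1 then W.covA 0 (.inl m) else 0) - (if i = 0 then W.covA 1 (.inl m) else 0) := by
  have h := W.jacobi (.inr 0) (.inr 1) (.inl m) (.inr i)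
  rw [W.c_eq] at h
  fin_cases i <;> fin_cases m <;>
  · simp [webCoeff, Fintype.sum_sum_type, Fin.sum_univ_two] at h
    simp [b, covA, curv, MovingFrame.extDeriv, W.c_eq, webCoeff, Fintype.sum_sum_type,
      Fin.sum_univ_two]
    linear_combination -h

end WebFrame

end AdaptedMovingFrames


/-! ### Exterior differentials of two-forms. -/

section TwoForms

variable {A ι : Type*} [CommRing A] [Algebra ℝ A] [Fintype ι]

namespace MovingFrame

variable (M : MovingFrame A ι)

/-- The exterior differential of the two-form with the components `T` in the moving frame. -/
def extDeriv₂ (T : ι → ι → A) (i j k : ι) : A :=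
  (M.e i (T j k) - ∑ m, M.c j k m * T m i) + (M.e j (T k i) - ∑ m, M.c k i m * T m j)
    + (M.e k (T i j) - ∑ m, M.c i j m * T m k)

lemma extDeriv₂_extDeriv (φ : ι → A) (i j k : ι) : M.extDeriv₂ (M.extDeriv φ) i j k = 0 :=
  M.extDeriv_extDeriv φ i j k

lemma extDeriv₂_add (S T : ι → ι → A) (i j k : ι) :
    M.extDeriv₂ (fun r s => S r s + T r s) i j k = M.extDeriv₂ S i j k + M.extDeriv₂ T i j k := by
  simp only [extDeriv₂, map_add, mul_add, Finset.sum_add_distrib]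
  ring

lemma extDeriv₂_wedge (φ ψ : ι → A) (i j k : ι) :
    M.extDeriv₂ (fun r s => φ r * ψ s - φ s * ψ r) i j k =
      (M.extDeriv φ i j * ψ k + M.extDeriv φ j k * ψ i + M.extDeriv φ k i * ψ j)
      - (φ i * M.extDeriv ψ j k + φ j * M.extDeriv ψ k i + φ k * M.extDeriv ψ i j) := by
  have h : ∀ r s t, ∑ m, M.c r s m * (φ m * ψ t - φ t * ψ m) =
      (∑ m, M.c r s m * φ m) * ψ t - φ t * ∑ m, M.c r s m * ψ m := by
    intro r s t
    rw [Finset.sum_mul, Finset.mul_sum, ← Finset.sum_sub_distrib]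
    exact Finset.sum_congr rfl fun m _ => by ring
  simp only [extDeriv₂, extDeriv, h, map_sub, Derivation.leibniz, smul_eq_mul]
  ring

end MovingFrame

/-- The quadratic forms `p² - 2pq` and `q² - 2pq` have only the trivial common zero, so `(p² + q²)²`
is in the ideal they generate. -/
lemma eq_zero_of_mul_quadratic {A : Type*} [CommRing A] [Algebra ℝ A] {x p q : A}
    (hu : IsUnit (p ^ 2 + q ^ 2)) (h1 : x * p ^ 2 = 2 * (x * (p * q)))
    (h2 : x * q ^ 2 = 2 * (x * (p * q))) : x = 0 := by
  have h3 : x * (p ^ 2 * q) = 0 :=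
    eq_zero_of_ofNat_mul 3 (by linear_combination -q * h1 - 2 * p * h2)
  have h4 : x * (p ^ 2 + q ^ 2) ^ 2 = 0 := by
    linear_combination p ^ 2 * h1 + q ^ 2 * h2 + 2 * (p + 3 * q) * h3 + 2 * p * q * h2
  exact (hu.pow 2).mul_left_eq_zero.1 h4

end TwoForms

/-! ### Special webs: the vanishing of `ω₂¹` and `a₂`. -/

section Reduction

set_option linter.flexible false

variable {A : Type*} [CommRing A] [Algebra ℝ A]

lemma webCoeff_swap {A : Type*} [CommRing A] (w : Fin 2 → Fin 2 → Fin 2 ⊕ Fin 2 → A) (a : Fin 2 → A)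
    (r s t : Fin 2 ⊕ Fin 2) : webCoeff w a r s t = -webCoeff w a s r t := by
  rcases r with r | r <;> rcases s with s | s <;> rcases t with t | t <;> simp [webCoeff] <;> ring

namespace WebFrame

variable (W : WebFrame A)

lemma extDeriv_swap (φ : Fin 2 ⊕ Fin 2 → A) (r s : Fin 2 ⊕ Fin 2) :
    W.extDeriv φ r s = -W.extDeriv φ s r := by
  simp only [MovingFrame.extDeriv, W.c_eq, webCoeff_swap _ _ r s]
  simp only [neg_mul, Finset.sum_neg_distrib]
  ring

lemma curv_swap (j i : Fin 2) (r s : Fin 2 ⊕ Fin 2) : W.curv j i r s = -W.curv j i s r := by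
  simp only [curv, W.extDeriv_swap _ r s, Fin.sum_univ_two]
  ring

lemma curv_self (j i : Fin 2) (r : Fin 2 ⊕ Fin 2) : W.curv j i r r = 0 :=
  eq_zero_of_ofNat_mul 2 (by linear_combination W.curv_swap j i r r)

lemma curv_inl_inl (j i k l : Fin 2) : W.curv j i (.inl k) (.inl l) = 0 := by
  fin_cases k <;> fin_cases l
  · exact W.curv_self _ _ _
  · exact W.curv_inl _ _
  · exact (W.curv_swap _ _ _ _).trans (by simp [W.curv_inl])
  · exact W.curv_self _ _ _

lemma curv_inr_inr (j i k l : Fin 2) : W.curv j i (.inr k) (.inr l) = 0 := by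
  fin_cases k <;> fin_cases l
  · exact W.curv_self _ _ _
  · exact W.curv_inr _ _
  · exact (W.curv_swap _ _ _ _).trans (by simp [W.curv_inr])
  · exact W.curv_self _ _ _

lemma curv_inl_inr (j i k l : Fin 2) : W.curv j i (.inl k) (.inr l) = W.b i j k l := rfl

lemma curv_inr_inl (j i k l : Fin 2) : W.curv j i (.inr l) (.inl k) = -W.b i j k l :=
  W.curv_swap _ _ _ _

lemma curv_eq_zero {j i : Fin 2} (h : ∀ k l, W.b i j k l = 0) (r s : Fin 2 ⊕ Fin 2) :
    W.curv j i r s = 0 := by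
  rcases r with r | r <;> rcases s with s | s <;>
    simp [W.curv_inl_inl, W.curv_inr_inr, W.curv_inl_inr, W.curv_inr_inl, h]

lemma extDeriv_w (j i : Fin 2) (r s : Fin 2 ⊕ Fin 2) :
    W.extDeriv (W.w j i) r s = ∑ m, (W.w j m r * W.w m i s - W.w j m s * W.w m i r)
      + W.curv j i r s := by
  rw [curv]
  ring

lemma e_a (i : Fin 2) (r : Fin 2 ⊕ Fin 2) :
    W.e r (W.a i) = W.covA i r + ∑ m, W.a m * W.w i m r := by
  rw [covA]
  ring

/-- The curvature conditions on a transversally geodesic web with `b¹ = 0`. -/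
structure IsSpecial : Prop where
  b_zero (j k l : Fin 2) : W.b 0 j k l = 0
  b_one_zero : W.b 1 0 0 0 = 0
  b_one_one : W.b 1 1 1 1 = 0
  b_sum_zero : W.b 1 0 0 1 + W.b 1 0 1 0 + W.b 1 1 0 0 = 0
  b_sum_one : W.b 1 0 1 1 + W.b 1 1 0 1 + W.b 1 1 1 0 = 0

namespace IsSpecial

variable {W} (hW : W.IsSpecial)
include hW

/-- In the first Bianchi identities for `b¹` the derivatives of `a₂` are the only other term. -/
lemma covA_one (r : Fin 2 ⊕ Fin 2) : W.covA 1 r = 0 := by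
  rcases r with m | m
  · simpa [hW.b_zero] using W.b_sub_b_eq_inl 0 m
  · simpa [hW.b_zero] using W.b_sub_b_eq_inr 0 m

/-- This is `ω₂¹ ∧ Ω₂² = 0`. Since `Ω_j¹ = 0`, `dω₂¹ = ω₂¹ ∧ (ω₁¹ - ω₂²)`. Applying `d` again, the
quadratic part of `d(ω₁¹ - ω₂²)` contains `ω₂¹` and is killed by the wedge, so only `Ω₂²` remains.
-/
lemma w_wedge_curv (r s t : Fin 2 ⊕ Fin 2) :
    W.w 1 0 r * W.curv 1 1 s t + W.w 1 0 s * W.curv 1 1 t r + W.w 1 0 t * W.curv 1 1 r s = 0 := by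
  have h0 : W.extDeriv (W.w 1 0) =
      fun r s => W.w 1 0 r * (W.w 0 0 s - W.w 1 1 s) - W.w 1 0 s * (W.w 0 0 r - W.w 1 1 r) := by
    ext r s
    rw [W.extDeriv_w, W.curv_eq_zero fun k l => hW.b_zero _ k l, Fin.sum_univ_two]
    ring
  have h1 : ∀ r s, W.extDeriv (fun r => W.w 0 0 r - W.w 1 1 r) r s =
      2 * (W.w 0 1 r * W.w 1 0 s - W.w 0 1 s * W.w 1 0 r) - W.curv 1 1 r s := by
    intro r s
    have : W.extDeriv (fun r => W.w 0 0 r - W.w 1 1 r) r s =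
        W.extDeriv (W.w 0 0) r s - W.extDeriv (W.w 1 1) r s := by
      simp only [MovingFrame.extDeriv, map_sub, mul_sub, Finset.sum_sub_distrib]
      ring
    rw [this, W.extDeriv_w, W.extDeriv_w, W.curv_eq_zero fun k l => hW.b_zero _ k l,
      Fin.sum_univ_two, Fin.sum_univ_two]
    ring
  have h2 := W.extDeriv₂_extDeriv (W.w 1 0) r s t
  rw [h0, W.extDeriv₂_wedge, h0, h1, h1, h1] at h2
  linear_combination h2

/-- The Ricci identity for `a₂`: since `da₂ = a₁ω₂¹ + a₂ω₂²`, the equation `d²a₂ = 0` reads `∇a₁ ∧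
ω₂¹ + a₂Ω₂² = 0`. -/
lemma covA_wedge_w (r s : Fin 2 ⊕ Fin 2) :
    W.covA 0 r * W.w 1 0 s - W.covA 0 s * W.w 1 0 r + W.a 1 * W.curv 1 1 r s = 0 := by
  have h := W.commutator_apply r s (W.a 1)
  have he : ∀ t, W.e t (W.a 1) = W.a 0 * W.w 1 0 t + W.a 1 * W.w 1 1 t := by
    intro t
    rw [W.e_a, hW.covA_one, Fin.sum_univ_two, zero_add]
  have he0 : ∀ t, W.e t (W.a 0) = W.covA 0 t + (W.a 0 * W.w 0 0 t + W.a 1 * W.w 0 1 t) := by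
    intro t
    rw [W.e_a, Fin.sum_univ_two]
  have h0 := W.extDeriv_w 1 0 r s
  have h1 := W.extDeriv_w 1 1 r s
  rw [W.curv_eq_zero fun k l => hW.b_zero _ k l] at h0
  have hs : ∑ k, W.c r s k * (W.a 0 * W.w 1 0 k + W.a 1 * W.w 1 1 k) =
      W.a 0 * ∑ k, W.c r s k * W.w 1 0 k + W.a 1 * ∑ k, W.c r s k * W.w 1 1 k := by
    rw [Finset.mul_sum, Finset.mul_sum, ← Finset.sum_add_distrib]
    exact Finset.sum_congr rfl fun _ _ => by ring
  simp only [he, hs, map_add, Derivation.leibniz, smul_eq_mul, he0] at h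
  simp only [MovingFrame.extDeriv, Fin.sum_univ_two] at h0 h1
  linear_combination h - W.a 0 * h0 - W.a 1 * h1

/-- For each type of indices there are three components of `b²`; the two Bianchi differences and the
vanishing cyclic sum determine them. -/
lemma three_mul_b :
    3 * W.b 1 1 0 0 = -(W.covA 0 (.inl 0) + W.covA 0 (.inr 0)) ∧
    3 * W.b 1 0 0 1 = 2 * W.covA 0 (.inl 0) - W.covA 0 (.inr 0) ∧
    3 * W.b 1 0 1 0 = 2 * W.covA 0 (.inr 0) - W.covA 0 (.inl 0) ∧
    3 * W.b 1 0 1 1 = W.covA 0 (.inl 1) + W.covA 0 (.inr 1) ∧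
    3 * W.b 1 1 1 0 = W.covA 0 (.inr 1) - 2 * W.covA 0 (.inl 1) ∧
    3 * W.b 1 1 0 1 = W.covA 0 (.inl 1) - 2 * W.covA 0 (.inr 1) := by
  have p0 : W.b 1 0 0 1 - W.b 1 1 0 0 = W.covA 0 (.inl 0) := by
    simpa using W.b_sub_b_eq_inl 1 0
  have p1 : W.b 1 0 1 1 - W.b 1 1 1 0 = W.covA 0 (.inl 1) := by
    simpa using W.b_sub_b_eq_inl 1 1
  have q0 : W.b 1 0 1 0 - W.b 1 1 0 0 = W.covA 0 (.inr 0) := by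
    simpa using W.b_sub_b_eq_inr 1 0
  have q1 : W.b 1 0 1 1 - W.b 1 1 0 1 = W.covA 0 (.inr 1) := by
    simpa using W.b_sub_b_eq_inr 1 1
  have s0 := hW.b_sum_zero
  have s1 := hW.b_sum_one
  refine ⟨?_, ?_, ?_, ?_, ?_, ?_⟩
  · linear_combination s0 - p0 - q0
  · linear_combination s0 + 2 * p0 - q0
  · linear_combination s0 - p0 + 2 * q0
  · linear_combination s1 + p1 + q1
  · linear_combination s1 - 2 * p1 + q1
  · linear_combination s1 + p1 - 2 * q1

/-- Components of `ω₂¹ ∧ Ω₂² = 0` and of the Ricci identity, with `Ω₂²` expressed by `p, q`, show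
that the unknowns are annihilated by quadratic forms in `p₁₂, q₁₂`. The order matters: first `ω₂¹`
on the vectors with second index, then `a₂`, then the other two components of `ω₂¹`. -/
lemma w_and_a_eq_zero (hu : IsUnit (W.covA 0 (.inl 1) ^ 2 + W.covA 0 (.inr 1) ^ 2)) :
    (∀ r, W.w 1 0 r = 0) ∧ W.a 1 = 0 := by
  obtain ⟨-, -, -, -, b3, b4⟩ := hW.three_mul_b
  have d1 := hW.w_wedge_curv (.inl 0) (.inl 1) (.inr 1)
  have d2 := hW.w_wedge_curv (.inl 1) (.inr 0) (.inr 1)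
  have e1 := hW.covA_wedge_w (.inl 1) (.inr 1)
  have e2 := hW.covA_wedge_w (.inl 0) (.inl 1)
  have e3 := hW.covA_wedge_w (.inr 0) (.inr 1)
  have e4 := hW.covA_wedge_w (.inl 0) (.inr 1)
  have e5 := hW.covA_wedge_w (.inl 1) (.inr 0)
  simp only [W.curv_inl_inl, W.curv_inr_inr, W.curv_inl_inr, W.curv_inr_inl, hW.b_one_one,
    mul_zero, add_zero, zero_add, neg_zero] at d1 d2 e1 e2 e3 e4 e5
  have x1 : W.w 1 0 (.inl 1) = 0 := by
    apply eq_zero_of_mul_quadratic hu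
    · linear_combination -3 * W.covA 0 (.inl 1) * d1 - W.covA 0 (.inl 1) * W.w 1 0 (.inl 1) * b4
    · linear_combination (2 * W.covA 0 (.inl 1) - W.covA 0 (.inr 1)) * e1
        + 3 * W.covA 0 (.inl 1) * d2 - W.covA 0 (.inl 1) * W.w 1 0 (.inr 1) * b3
  have y1 : W.w 1 0 (.inr 1) = 0 := by
    apply eq_zero_of_mul_quadratic hu
    · rw [x1] at e1
      linear_combination (W.covA 0 (.inl 1) - 2 * W.covA 0 (.inr 1)) * e1
    · rw [x1] at e1
      linear_combination 3 * W.covA 0 (.inr 1) * d2 - W.covA 0 (.inr 1) * W.w 1 0 (.inr 1) * b3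
  rw [x1] at e2 e5
  rw [y1] at e3 e4
  have a1 : W.a 1 = 0 := by
    apply eq_zero_of_mul_quadratic hu
    · linear_combination 3 * W.covA 0 (.inl 1) * e4 - 3 * W.covA 0 (.inr 1) * e2
        - W.a 1 * W.covA 0 (.inl 1) * b4
    · linear_combination 3 * W.covA 0 (.inr 1) * e5 + 3 * W.covA 0 (.inl 1) * e3
        - W.a 1 * W.covA 0 (.inr 1) * b3
  rw [a1] at e4 e5
  have x0 : W.w 1 0 (.inl 0) = 0 := by
    refine hu.mul_left_eq_zero.1 ?_
    linear_combination -W.covA 0 (.inl 1) * e2 - W.covA 0 (.inr 1) * e4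
  have y0 : W.w 1 0 (.inr 0) = 0 := by
    refine hu.mul_left_eq_zero.1 ?_
    linear_combination W.covA 0 (.inl 1) * e5 - W.covA 0 (.inr 1) * e3
  refine ⟨?_, a1⟩
  rintro (r | r) <;> fin_cases r <;> assumption

end IsSpecial

end WebFrame

end Reduction


/-! ### From a special web to the reduced system. -/

section Reduction

set_option linter.flexible false
set_option linter.unusedSimpArgs false

namespace WebFrame

lemma extDeriv_w_zero_one {A : Type*} [CommRing A] [Algebra ℝ A] (W : WebFrame A) :
    W.extDeriv (W.w 0 1) = fun r s =>
      ((W.w 0 0 r * W.w 0 1 s - W.w 0 0 s * W.w 0 1 r)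
        + (W.w 0 1 r * W.w 1 1 s - W.w 0 1 s * W.w 1 1 r)) + W.curv 0 1 r s := by
  ext r s
  rw [W.extDeriv_w, Fin.sum_univ_two]

lemma commutator_inl_zero_inr_zero {A : Type*} [CommRing A] [Algebra ℝ A] (W : WebFrame A) (f : A) :
    W.e (.inl 0) (W.e (.inr 0) f) - W.e (.inr 0) (W.e (.inl 0) f) =
      -W.w 0 0 (.inr 0) * W.e (.inl 0) f - W.w 0 1 (.inr 0) * W.e (.inl 1) f
        + W.w 0 0 (.inl 0) * W.e (.inr 0) f + W.w 0 1 (.inl 0) * W.e (.inr 1) f := by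
  rw [W.commutator_apply, W.c_eq]
  simp [webCoeff, Fintype.sum_sum_type, Fin.sum_univ_two]
  ring

/-- A web frame with `ω₂¹ = 0` and `a₂ = 0` that satisfies the curvature conditions of a
transversally geodesic web, together with names for the remaining covariants. -/
structure IsReduced {A : Type*} [CommRing A] [Algebra ℝ A] (W : WebFrame A)
    (a p1 p2 q1 q2 : A) : Prop where
  special : W.IsSpecial
  w_eq_zero (r : Fin 2 ⊕ Fin 2) : W.w 1 0 r = 0
  a_one : W.a 1 = 0
  a_zero : W.a 0 = 3 * a
  covA_inl_zero : W.covA 0 (.inl 0) = 3 * p1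
  covA_inl_one : W.covA 0 (.inl 1) = 3 * p2
  covA_inr_zero : W.covA 0 (.inr 0) = 3 * q1
  covA_inr_one : W.covA 0 (.inr 1) = 3 * q2

namespace IsReduced

variable {A : Type*} [CommRing A] [Algebra ℝ A] {W : WebFrame A} {a p1 p2 q1 q2 : A}
  (h : W.IsReduced a p1 p2 q1 q2)
include h

lemma comm12 (f : A) : W.e (.inl 0) (W.e (.inl 1) f) - W.e (.inl 1) (W.e (.inl 0) f) =
    -W.w 0 0 (.inl 1) * W.e (.inl 0) f + (W.w 1 1 (.inl 0) - W.w 0 1 (.inl 1) - 3 * a) * W.e (.inl 1) f := by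
  rw [W.commutator_apply, W.c_eq]
  simp [webCoeff, Fintype.sum_sum_type, Fin.sum_univ_two, h.w_eq_zero, h.a_one, h.a_zero]
  try ring

lemma comm14 (f : A) : W.e (.inl 0) (W.e (.inr 1) f) - W.e (.inr 1) (W.e (.inl 0) f) =
    -W.w 0 0 (.inr 1) * W.e (.inl 0) f - W.w 0 1 (.inr 1) * W.e (.inl 1) f + W.w 1 1 (.inl 0) * W.e (.inr 1) f := by
  rw [W.commutator_apply, W.c_eq]
  simp [webCoeff, Fintype.sum_sum_type, Fin.sum_univ_two, h.w_eq_zero, h.a_one, h.a_zero]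
  try ring

lemma comm23 (f : A) : W.e (.inl 1) (W.e (.inr 0) f) - W.e (.inr 0) (W.e (.inl 1) f) =
    -W.w 1 1 (.inr 0) * W.e (.inl 1) f + W.w 0 0 (.inl 1) * W.e (.inr 0) f + W.w 0 1 (.inl 1) * W.e (.inr 1) f := by
  rw [W.commutator_apply, W.c_eq]
  simp [webCoeff, Fintype.sum_sum_type, Fin.sum_univ_two, h.w_eq_zero, h.a_one, h.a_zero]
  try ring

lemma comm24 (f : A) : W.e (.inl 1) (W.e (.inr 1) f) - W.e (.inr 1) (W.e (.inl 1) f) =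
    -W.w 1 1 (.inr 1) * W.e (.inl 1) f + W.w 1 1 (.inl 1) * W.e (.inr 1) f := by
  rw [W.commutator_apply, W.c_eq]
  simp [webCoeff, Fintype.sum_sum_type, Fin.sum_univ_two, h.w_eq_zero, h.a_one, h.a_zero]
  try ring

lemma comm34 (f : A) : W.e (.inr 0) (W.e (.inr 1) f) - W.e (.inr 1) (W.e (.inr 0) f) =
    -W.w 0 0 (.inr 1) * W.e (.inr 0) f + (W.w 1 1 (.inr 0) - W.w 0 1 (.inr 1) + 3 * a) * W.e (.inr 1) f := by
  rw [W.commutator_apply, W.c_eq]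
  simp [webCoeff, Fintype.sum_sum_type, Fin.sum_univ_two, h.w_eq_zero, h.a_one, h.a_zero]
  try ring

/-- The normalization of `a, p, q` by the factor `3` is chosen to make these coefficients integral.
-/
lemma b_eq : W.b 1 1 0 0 = -(p1 + q1) ∧ W.b 1 0 0 1 = 2 * p1 - q1 ∧ W.b 1 0 1 0 = 2 * q1 - p1 ∧
    W.b 1 0 1 1 = p2 + q2 ∧ W.b 1 1 1 0 = q2 - 2 * p2 ∧ W.b 1 1 0 1 = p2 - 2 * q2 := by
  obtain ⟨h1, h2, h3, h4, h5, h6⟩ := h.special.three_mul_b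
  rw [h.covA_inl_zero, h.covA_inr_zero] at h1 h2 h3
  rw [h.covA_inl_one, h.covA_inr_one] at h4 h5 h6
  refine ⟨?_, ?_, ?_, ?_, ?_, ?_⟩ <;> refine sub_eq_zero.1 (eq_zero_of_ofNat_mul 3 ?_)
  · linear_combination h1
  · linear_combination h2
  · linear_combination h3
  · linear_combination h4
  · linear_combination h5
  · linear_combination h6

lemma curv_g12 : W.e (.inl 0) (W.w 0 0 (.inl 1)) - W.e (.inl 1) (W.w 0 0 (.inl 0)) =
    -W.w 0 0 (.inl 1) * W.w 0 0 (.inl 0) + (W.w 1 1 (.inl 0) - W.w 0 1 (.inl 1) - 3 * a) * W.w 0 0 (.inl 1) := by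
  have hc := W.extDeriv_w 0 0 (.inl 0) (.inl 1)
  obtain ⟨h1, h2, h3, h4, h5, h6⟩ := h.b_eq
  simp [MovingFrame.extDeriv, W.c_eq, webCoeff, Fintype.sum_sum_type, Fin.sum_univ_two,
    h.w_eq_zero, h.a_one, h.a_zero, W.curv_inl_inl, W.curv_inr_inr, W.curv_inl_inr,
    h.special.b_zero, h.special.b_one_zero, h.special.b_one_one, h1, h2, h3, h4, h5, h6] at hc
  linear_combination hc

lemma curv_g13 : W.e (.inl 0) (W.w 0 0 (.inr 0)) - W.e (.inr 0) (W.w 0 0 (.inl 0)) =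
    -W.w 0 0 (.inr 0) * W.w 0 0 (.inl 0) - W.w 0 1 (.inr 0) * W.w 0 0 (.inl 1) + W.w 0 0 (.inl 0) * W.w 0 0 (.inr 0) + W.w 0 1 (.inl 0) * W.w 0 0 (.inr 1) := by
  have hc := W.extDeriv_w 0 0 (.inl 0) (.inr 0)
  obtain ⟨h1, h2, h3, h4, h5, h6⟩ := h.b_eq
  simp [MovingFrame.extDeriv, W.c_eq, webCoeff, Fintype.sum_sum_type, Fin.sum_univ_two,
    h.w_eq_zero, h.a_one, h.a_zero, W.curv_inl_inl, W.curv_inr_inr, W.curv_inl_inr,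
    h.special.b_zero, h.special.b_one_zero, h.special.b_one_one, h1, h2, h3, h4, h5, h6] at hc
  linear_combination hc

lemma curv_g14 : W.e (.inl 0) (W.w 0 0 (.inr 1)) - W.e (.inr 1) (W.w 0 0 (.inl 0)) =
    -W.w 0 0 (.inr 1) * W.w 0 0 (.inl 0) - W.w 0 1 (.inr 1) * W.w 0 0 (.inl 1) + W.w 1 1 (.inl 0) * W.w 0 0 (.inr 1) := by
  have hc := W.extDeriv_w 0 0 (.inl 0) (.inr 1)
  obtain ⟨h1, h2, h3, h4, h5, h6⟩ := h.b_eq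
  simp [MovingFrame.extDeriv, W.c_eq, webCoeff, Fintype.sum_sum_type, Fin.sum_univ_two,
    h.w_eq_zero, h.a_one, h.a_zero, W.curv_inl_inl, W.curv_inr_inr, W.curv_inl_inr,
    h.special.b_zero, h.special.b_one_zero, h.special.b_one_one, h1, h2, h3, h4, h5, h6] at hc
  linear_combination hc

lemma curv_g23 : W.e (.inl 1) (W.w 0 0 (.inr 0)) - W.e (.inr 0) (W.w 0 0 (.inl 1)) =
    -W.w 1 1 (.inr 0) * W.w 0 0 (.inl 1) + W.w 0 0 (.inl 1) * W.w 0 0 (.inr 0) + W.w 0 1 (.inl 1) * W.w 0 0 (.inr 1) := by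
  have hc := W.extDeriv_w 0 0 (.inl 1) (.inr 0)
  obtain ⟨h1, h2, h3, h4, h5, h6⟩ := h.b_eq
  simp [MovingFrame.extDeriv, W.c_eq, webCoeff, Fintype.sum_sum_type, Fin.sum_univ_two,
    h.w_eq_zero, h.a_one, h.a_zero, W.curv_inl_inl, W.curv_inr_inr, W.curv_inl_inr,
    h.special.b_zero, h.special.b_one_zero, h.special.b_one_one, h1, h2, h3, h4, h5, h6] at hc
  linear_combination hc

lemma curv_g24 : W.e (.inl 1) (W.w 0 0 (.inr 1)) - W.e (.inr 1) (W.w 0 0 (.inl 1)) =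
    -W.w 1 1 (.inr 1) * W.w 0 0 (.inl 1) + W.w 1 1 (.inl 1) * W.w 0 0 (.inr 1) := by
  have hc := W.extDeriv_w 0 0 (.inl 1) (.inr 1)
  obtain ⟨h1, h2, h3, h4, h5, h6⟩ := h.b_eq
  simp [MovingFrame.extDeriv, W.c_eq, webCoeff, Fintype.sum_sum_type, Fin.sum_univ_two,
    h.w_eq_zero, h.a_one, h.a_zero, W.curv_inl_inl, W.curv_inr_inr, W.curv_inl_inr,
    h.special.b_zero, h.special.b_one_zero, h.special.b_one_one, h1, h2, h3, h4, h5, h6] at hc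
  linear_combination hc

lemma curv_g34 : W.e (.inr 0) (W.w 0 0 (.inr 1)) - W.e (.inr 1) (W.w 0 0 (.inr 0)) =
    -W.w 0 0 (.inr 1) * W.w 0 0 (.inr 0) + (W.w 1 1 (.inr 0) - W.w 0 1 (.inr 1) + 3 * a) * W.w 0 0 (.inr 1) := by
  have hc := W.extDeriv_w 0 0 (.inr 0) (.inr 1)
  obtain ⟨h1, h2, h3, h4, h5, h6⟩ := h.b_eq
  simp [MovingFrame.extDeriv, W.c_eq, webCoeff, Fintype.sum_sum_type, Fin.sum_univ_two,
    h.w_eq_zero, h.a_one, h.a_zero, W.curv_inl_inl, W.curv_inr_inr, W.curv_inl_inr,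
    h.special.b_zero, h.special.b_one_zero, h.special.b_one_one, h1, h2, h3, h4, h5, h6] at hc
  linear_combination hc

lemma curv_l12 : W.e (.inl 0) (W.w 0 1 (.inl 1)) - W.e (.inl 1) (W.w 0 1 (.inl 0)) =
    -W.w 0 0 (.inl 1) * W.w 0 1 (.inl 0) + (W.w 1 1 (.inl 0) - W.w 0 1 (.inl 1) - 3 * a) * W.w 0 1 (.inl 1)
    + (W.w 0 0 (.inl 0) * W.w 0 1 (.inl 1) - W.w 0 0 (.inl 1) * W.w 0 1 (.inl 0))
    + (W.w 0 1 (.inl 0) * W.w 1 1 (.inl 1) - W.w 0 1 (.inl 1) * W.w 1 1 (.inl 0)) := by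
  have hc := W.extDeriv_w 0 1 (.inl 0) (.inl 1)
  obtain ⟨h1, h2, h3, h4, h5, h6⟩ := h.b_eq
  simp [MovingFrame.extDeriv, W.c_eq, webCoeff, Fintype.sum_sum_type, Fin.sum_univ_two,
    h.w_eq_zero, h.a_one, h.a_zero, W.curv_inl_inl, W.curv_inr_inr, W.curv_inl_inr,
    h.special.b_zero, h.special.b_one_zero, h.special.b_one_one, h1, h2, h3, h4, h5, h6] at hc
  linear_combination hc

lemma curv_l14 : W.e (.inl 0) (W.w 0 1 (.inr 1)) - W.e (.inr 1) (W.w 0 1 (.inl 0)) =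
    -W.w 0 0 (.inr 1) * W.w 0 1 (.inl 0) - W.w 0 1 (.inr 1) * W.w 0 1 (.inl 1) + W.w 1 1 (.inl 0) * W.w 0 1 (.inr 1)
    + (W.w 0 0 (.inl 0) * W.w 0 1 (.inr 1) - W.w 0 0 (.inr 1) * W.w 0 1 (.inl 0))
    + (W.w 0 1 (.inl 0) * W.w 1 1 (.inr 1) - W.w 0 1 (.inr 1) * W.w 1 1 (.inl 0)) + (2 * p1 - q1) := by
  have hc := W.extDeriv_w 0 1 (.inl 0) (.inr 1)
  obtain ⟨h1, h2, h3, h4, h5, h6⟩ := h.b_eq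
  simp [MovingFrame.extDeriv, W.c_eq, webCoeff, Fintype.sum_sum_type, Fin.sum_univ_two,
    h.w_eq_zero, h.a_one, h.a_zero, W.curv_inl_inl, W.curv_inr_inr, W.curv_inl_inr,
    h.special.b_zero, h.special.b_one_zero, h.special.b_one_one, h1, h2, h3, h4, h5, h6] at hc
  linear_combination hc

lemma curv_l23 : W.e (.inl 1) (W.w 0 1 (.inr 0)) - W.e (.inr 0) (W.w 0 1 (.inl 1)) =
    -W.w 1 1 (.inr 0) * W.w 0 1 (.inl 1) + W.w 0 0 (.inl 1) * W.w 0 1 (.inr 0) + W.w 0 1 (.inl 1) * W.w 0 1 (.inr 1)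
    + (W.w 0 0 (.inl 1) * W.w 0 1 (.inr 0) - W.w 0 0 (.inr 0) * W.w 0 1 (.inl 1))
    + (W.w 0 1 (.inl 1) * W.w 1 1 (.inr 0) - W.w 0 1 (.inr 0) * W.w 1 1 (.inl 1)) + (2 * q1 - p1) := by
  have hc := W.extDeriv_w 0 1 (.inl 1) (.inr 0)
  obtain ⟨h1, h2, h3, h4, h5, h6⟩ := h.b_eq
  simp [MovingFrame.extDeriv, W.c_eq, webCoeff, Fintype.sum_sum_type, Fin.sum_univ_two,
    h.w_eq_zero, h.a_one, h.a_zero, W.curv_inl_inl, W.curv_inr_inr, W.curv_inl_inr,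
    h.special.b_zero, h.special.b_one_zero, h.special.b_one_one, h1, h2, h3, h4, h5, h6] at hc
  linear_combination hc

lemma curv_l34 : W.e (.inr 0) (W.w 0 1 (.inr 1)) - W.e (.inr 1) (W.w 0 1 (.inr 0)) =
    -W.w 0 0 (.inr 1) * W.w 0 1 (.inr 0) + (W.w 1 1 (.inr 0) - W.w 0 1 (.inr 1) + 3 * a) * W.w 0 1 (.inr 1)
    + (W.w 0 0 (.inr 0) * W.w 0 1 (.inr 1) - W.w 0 0 (.inr 1) * W.w 0 1 (.inr 0))
    + (W.w 0 1 (.inr 0) * W.w 1 1 (.inr 1) - W.w 0 1 (.inr 1) * W.w 1 1 (.inr 0)) := by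
  have hc := W.extDeriv_w 0 1 (.inr 0) (.inr 1)
  obtain ⟨h1, h2, h3, h4, h5, h6⟩ := h.b_eq
  simp [MovingFrame.extDeriv, W.c_eq, webCoeff, Fintype.sum_sum_type, Fin.sum_univ_two,
    h.w_eq_zero, h.a_one, h.a_zero, W.curv_inl_inl, W.curv_inr_inr, W.curv_inl_inr,
    h.special.b_zero, h.special.b_one_zero, h.special.b_one_one, h1, h2, h3, h4, h5, h6] at hc
  linear_combination hc

lemma curv_m12 : W.e (.inl 0) (W.w 1 1 (.inl 1)) - W.e (.inl 1) (W.w 1 1 (.inl 0)) =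
    -W.w 0 0 (.inl 1) * W.w 1 1 (.inl 0) + (W.w 1 1 (.inl 0) - W.w 0 1 (.inl 1) - 3 * a) * W.w 1 1 (.inl 1) := by
  have hc := W.extDeriv_w 1 1 (.inl 0) (.inl 1)
  obtain ⟨h1, h2, h3, h4, h5, h6⟩ := h.b_eq
  simp [MovingFrame.extDeriv, W.c_eq, webCoeff, Fintype.sum_sum_type, Fin.sum_univ_two,
    h.w_eq_zero, h.a_one, h.a_zero, W.curv_inl_inl, W.curv_inr_inr, W.curv_inl_inr,
    h.special.b_zero, h.special.b_one_zero, h.special.b_one_one, h1, h2, h3, h4, h5, h6] at hc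
  linear_combination hc

lemma curv_m14 : W.e (.inl 0) (W.w 1 1 (.inr 1)) - W.e (.inr 1) (W.w 1 1 (.inl 0)) =
    -W.w 0 0 (.inr 1) * W.w 1 1 (.inl 0) - W.w 0 1 (.inr 1) * W.w 1 1 (.inl 1) + W.w 1 1 (.inl 0) * W.w 1 1 (.inr 1) + (p2 - 2 * q2) := by
  have hc := W.extDeriv_w 1 1 (.inl 0) (.inr 1)
  obtain ⟨h1, h2, h3, h4, h5, h6⟩ := h.b_eq
  simp [MovingFrame.extDeriv, W.c_eq, webCoeff, Fintype.sum_sum_type, Fin.sum_univ_two,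
    h.w_eq_zero, h.a_one, h.a_zero, W.curv_inl_inl, W.curv_inr_inr, W.curv_inl_inr,
    h.special.b_zero, h.special.b_one_zero, h.special.b_one_one, h1, h2, h3, h4, h5, h6] at hc
  linear_combination hc

lemma curv_m23 : W.e (.inl 1) (W.w 1 1 (.inr 0)) - W.e (.inr 0) (W.w 1 1 (.inl 1)) =
    -W.w 1 1 (.inr 0) * W.w 1 1 (.inl 1) + W.w 0 0 (.inl 1) * W.w 1 1 (.inr 0) + W.w 0 1 (.inl 1) * W.w 1 1 (.inr 1) + (q2 - 2 * p2) := by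
  have hc := W.extDeriv_w 1 1 (.inl 1) (.inr 0)
  obtain ⟨h1, h2, h3, h4, h5, h6⟩ := h.b_eq
  simp [MovingFrame.extDeriv, W.c_eq, webCoeff, Fintype.sum_sum_type, Fin.sum_univ_two,
    h.w_eq_zero, h.a_one, h.a_zero, W.curv_inl_inl, W.curv_inr_inr, W.curv_inl_inr,
    h.special.b_zero, h.special.b_one_zero, h.special.b_one_one, h1, h2, h3, h4, h5, h6] at hc
  linear_combination hc

lemma curv_m24 : W.e (.inl 1) (W.w 1 1 (.inr 1)) - W.e (.inr 1) (W.w 1 1 (.inl 1)) =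
    -W.w 1 1 (.inr 1) * W.w 1 1 (.inl 1) + W.w 1 1 (.inl 1) * W.w 1 1 (.inr 1) := by
  have hc := W.extDeriv_w 1 1 (.inl 1) (.inr 1)
  obtain ⟨h1, h2, h3, h4, h5, h6⟩ := h.b_eq
  simp [MovingFrame.extDeriv, W.c_eq, webCoeff, Fintype.sum_sum_type, Fin.sum_univ_two,
    h.w_eq_zero, h.a_one, h.a_zero, W.curv_inl_inl, W.curv_inr_inr, W.curv_inl_inr,
    h.special.b_zero, h.special.b_one_zero, h.special.b_one_one, h1, h2, h3, h4, h5, h6] at hc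
  linear_combination hc

lemma curv_m34 : W.e (.inr 0) (W.w 1 1 (.inr 1)) - W.e (.inr 1) (W.w 1 1 (.inr 0)) =
    -W.w 0 0 (.inr 1) * W.w 1 1 (.inr 0) + (W.w 1 1 (.inr 0) - W.w 0 1 (.inr 1) + 3 * a) * W.w 1 1 (.inr 1) := by
  have hc := W.extDeriv_w 1 1 (.inr 0) (.inr 1)
  obtain ⟨h1, h2, h3, h4, h5, h6⟩ := h.b_eq
  simp [MovingFrame.extDeriv, W.c_eq, webCoeff, Fintype.sum_sum_type, Fin.sum_univ_two,
    h.w_eq_zero, h.a_one, h.a_zero, W.curv_inl_inl, W.curv_inr_inr, W.curv_inl_inr,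
    h.special.b_zero, h.special.b_one_zero, h.special.b_one_one, h1, h2, h3, h4, h5, h6] at hc
  linear_combination hc

lemma e_a_1 : W.e (.inl 0) a = a * W.w 0 0 (.inl 0) + p1 := by
  have ha := W.e_a 0 (.inl 0)
  rw [h.a_zero, Fin.sum_univ_two, h.a_zero, h.a_one, h.covA_inl_zero] at ha
  simp only [Derivation.leibniz, Derivation.map_ofNat_eq_zero, smul_eq_mul] at ha
  refine sub_eq_zero.1 (eq_zero_of_ofNat_mul 3 ?_)
  linear_combination ha

lemma e_a_2 : W.e (.inl 1) a = a * W.w 0 0 (.inl 1) + p2 := by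
  have ha := W.e_a 0 (.inl 1)
  rw [h.a_zero, Fin.sum_univ_two, h.a_zero, h.a_one, h.covA_inl_one] at ha
  simp only [Derivation.leibniz, Derivation.map_ofNat_eq_zero, smul_eq_mul] at ha
  refine sub_eq_zero.1 (eq_zero_of_ofNat_mul 3 ?_)
  linear_combination ha

lemma e_a_3 : W.e (.inr 0) a = a * W.w 0 0 (.inr 0) + q1 := by
  have ha := W.e_a 0 (.inr 0)
  rw [h.a_zero, Fin.sum_univ_two, h.a_zero, h.a_one, h.covA_inr_zero] at ha
  simp only [Derivation.leibniz, Derivation.map_ofNat_eq_zero, smul_eq_mul] at ha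
  refine sub_eq_zero.1 (eq_zero_of_ofNat_mul 3 ?_)
  linear_combination ha

lemma e_a_4 : W.e (.inr 1) a = a * W.w 0 0 (.inr 1) + q2 := by
  have ha := W.e_a 0 (.inr 1)
  rw [h.a_zero, Fin.sum_univ_two, h.a_zero, h.a_one, h.covA_inr_one] at ha
  simp only [Derivation.leibniz, Derivation.map_ofNat_eq_zero, smul_eq_mul] at ha
  refine sub_eq_zero.1 (eq_zero_of_ofNat_mul 3 ?_)
  linear_combination ha

lemma extDeriv_w_one_one : W.extDeriv (W.w 1 1) = W.curv 1 1 := by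
  ext r s
  simp [W.extDeriv_w, Fin.sum_univ_two, h.w_eq_zero, mul_comm]

lemma extDeriv_w_zero_zero : W.extDeriv (W.w 0 0) = 0 := by
  ext r s
  simp [W.extDeriv_w, Fin.sum_univ_two, h.w_eq_zero, mul_comm,
    W.curv_eq_zero fun k l => h.special.b_zero _ k l]

lemma extDeriv₂_curv_one_one (r s t : Fin 2 ⊕ Fin 2) : W.extDeriv₂ (W.curv 1 1) r s t = 0 := by
  rw [← h.extDeriv_w_one_one]
  exact W.extDeriv₂_extDeriv _ _ _ _

/-- The second Bianchi identity for `Ω₁²`, simplified by `ω₂¹ = 0` and `Ω₁¹ = 0`. -/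
lemma extDeriv₂_curv_zero_one (r s t : Fin 2 ⊕ Fin 2) : W.extDeriv₂ (W.curv 0 1) r s t =
    (W.w 0 0 r * W.curv 0 1 s t + W.w 0 0 s * W.curv 0 1 t r + W.w 0 0 t * W.curv 0 1 r s)
    - (W.curv 0 1 r s * W.w 1 1 t + W.curv 0 1 s t * W.w 1 1 r + W.curv 0 1 t r * W.w 1 1 s)
    + (W.w 0 1 r * W.curv 1 1 s t + W.w 0 1 s * W.curv 1 1 t r + W.w 0 1 t * W.curv 1 1 r s) := by
  have h2 := W.extDeriv₂_extDeriv (W.w 0 1) r s t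
  rw [W.extDeriv_w_zero_one, W.extDeriv₂_add, W.extDeriv₂_add, W.extDeriv₂_wedge,
    W.extDeriv₂_wedge, W.extDeriv_w_zero_one, h.extDeriv_w_zero_zero, h.extDeriv_w_one_one] at h2
  simp only [Pi.zero_apply] at h2
  linear_combination h2

/-- In the second Bianchi identities the curvature is linear in `p` and `q`, so each component
becomes a first-order equation on them. The digits number the frame vectors `X₁, X₂, Y₁, Y₂`; `one`
refers to `Ω₂²` and `zero` to `Ω₁²`. -/
lemma bianchi_one_124 :
    W.e (.inl 1) p2 - 2 * W.e (.inl 1) q2 - (W.w 0 0 (.inl 1) + W.w 1 1 (.inl 1)) * (p2 - 2 * q2) = 0 := by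
  have hc := h.extDeriv₂_curv_one_one (.inl 0) (.inl 1) (.inr 1)
  obtain ⟨h1, h2, h3, h4, h5, h6⟩ := h.b_eq
  simp [MovingFrame.extDeriv₂, W.c_eq, webCoeff, Fintype.sum_sum_type, Fin.sum_univ_two,
    h.w_eq_zero, h.a_one, h.a_zero, W.curv_inl_inl, W.curv_inr_inr, W.curv_inl_inr, W.curv_inr_inl,
    h.special.b_zero, h.special.b_one_zero, h.special.b_one_one, h1, h2, h3, h4, h5, h6,
    Derivation.map_ofNat_eq_zero] at hc
  linear_combination -hc

lemma bianchi_one_234 :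
    W.e (.inr 1) q2 - 2 * W.e (.inr 1) p2 - (W.w 0 0 (.inr 1) + W.w 1 1 (.inr 1)) * (q2 - 2 * p2) = 0 := by
  have hc := h.extDeriv₂_curv_one_one (.inl 1) (.inr 0) (.inr 1)
  obtain ⟨h1, h2, h3, h4, h5, h6⟩ := h.b_eq
  simp [MovingFrame.extDeriv₂, W.c_eq, webCoeff, Fintype.sum_sum_type, Fin.sum_univ_two,
    h.w_eq_zero, h.a_one, h.a_zero, W.curv_inl_inl, W.curv_inr_inr, W.curv_inl_inr, W.curv_inr_inl,
    h.special.b_zero, h.special.b_one_zero, h.special.b_one_one, h1, h2, h3, h4, h5, h6,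
    Derivation.map_ofNat_eq_zero] at hc
  linear_combination hc

lemma bianchi_one_123 :
    W.e (.inl 1) p1 + W.e (.inl 1) q1 + W.e (.inl 0) q2 - 2 * W.e (.inl 0) p2
    - 2 * W.w 0 0 (.inl 1) * (p1 + q1) - W.w 0 1 (.inl 1) * (p2 + q2)
    - (W.w 0 0 (.inl 0) + W.w 1 1 (.inl 0)) * (q2 - 2 * p2) + 3 * (a * (q2 - 2 * p2)) = 0 := by
  have hc := h.extDeriv₂_curv_one_one (.inl 0) (.inl 1) (.inr 0)
  obtain ⟨h1, h2, h3, h4, h5, h6⟩ := h.b_eq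
  simp [MovingFrame.extDeriv₂, W.c_eq, webCoeff, Fintype.sum_sum_type, Fin.sum_univ_two,
    h.w_eq_zero, h.a_one, h.a_zero, W.curv_inl_inl, W.curv_inr_inr, W.curv_inl_inr, W.curv_inr_inl,
    h.special.b_zero, h.special.b_one_zero, h.special.b_one_one, h1, h2, h3, h4, h5, h6,
    Derivation.map_ofNat_eq_zero] at hc
  linear_combination hc

lemma bianchi_one_134 :
    W.e (.inr 1) p1 + W.e (.inr 1) q1 + W.e (.inr 0) p2 - 2 * W.e (.inr 0) q2
    - 2 * W.w 0 0 (.inr 1) * (p1 + q1) - W.w 0 1 (.inr 1) * (p2 + q2)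
    - (W.w 0 0 (.inr 0) + W.w 1 1 (.inr 0)) * (p2 - 2 * q2) - 3 * (a * (p2 - 2 * q2)) = 0 := by
  have hc := h.extDeriv₂_curv_one_one (.inl 0) (.inr 0) (.inr 1)
  obtain ⟨h1, h2, h3, h4, h5, h6⟩ := h.b_eq
  simp [MovingFrame.extDeriv₂, W.c_eq, webCoeff, Fintype.sum_sum_type, Fin.sum_univ_two,
    h.w_eq_zero, h.a_one, h.a_zero, W.curv_inl_inl, W.curv_inr_inr, W.curv_inl_inr, W.curv_inr_inl,
    h.special.b_zero, h.special.b_one_zero, h.special.b_one_one, h1, h2, h3, h4, h5, h6,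
    Derivation.map_ofNat_eq_zero] at hc
  linear_combination -hc

lemma bianchi_zero_123 :
    2 * W.e (.inl 0) q1 - W.e (.inl 0) p1 - 2 * W.w 0 0 (.inl 0) * (2 * q1 - p1) - W.w 0 1 (.inl 0) * (2 * q2 - p2)
    + 3 * (a * (2 * q1 - p1)) = 0 := by
  have hc := h.extDeriv₂_curv_zero_one (.inl 0) (.inl 1) (.inr 0)
  obtain ⟨h1, h2, h3, h4, h5, h6⟩ := h.b_eq
  simp [MovingFrame.extDeriv₂, W.c_eq, webCoeff, Fintype.sum_sum_type, Fin.sum_univ_two,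
    h.w_eq_zero, h.a_one, h.a_zero, W.curv_inl_inl, W.curv_inr_inr, W.curv_inl_inr, W.curv_inr_inl,
    h.special.b_zero, h.special.b_one_zero, h.special.b_one_one, h1, h2, h3, h4, h5, h6,
    Derivation.map_ofNat_eq_zero] at hc
  linear_combination hc

lemma bianchi_zero_134 :
    2 * W.e (.inr 0) p1 - W.e (.inr 0) q1 - 2 * W.w 0 0 (.inr 0) * (2 * p1 - q1) - W.w 0 1 (.inr 0) * (2 * p2 - q2)
    - 3 * (a * (2 * p1 - q1)) = 0 := by
  have hc := h.extDeriv₂_curv_zero_one (.inl 0) (.inr 0) (.inr 1)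
  obtain ⟨h1, h2, h3, h4, h5, h6⟩ := h.b_eq
  simp [MovingFrame.extDeriv₂, W.c_eq, webCoeff, Fintype.sum_sum_type, Fin.sum_univ_two,
    h.w_eq_zero, h.a_one, h.a_zero, W.curv_inl_inl, W.curv_inr_inr, W.curv_inl_inr, W.curv_inr_inl,
    h.special.b_zero, h.special.b_one_zero, h.special.b_one_one, h1, h2, h3, h4, h5, h6,
    Derivation.map_ofNat_eq_zero] at hc
  linear_combination -hc

/-- The `sndDeriv_*` lemmas are the six components of `d²a = 0`; the derivatives of `ω₁¹` cancel
because `Ω₁¹ = 0`. -/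
lemma sndDeriv_12 : W.e (.inl 0) p2 - W.e (.inl 1) p1 =
    -W.w 0 0 (.inl 1) * p1 + (W.w 1 1 (.inl 0) - W.w 0 1 (.inl 1) - 3 * a) * p2 + W.w 0 0 (.inl 0) * p2 - W.w 0 0 (.inl 1) * p1 := by
  have hc := h.comm12 a
  simp only [h.e_a_1, h.e_a_2, h.e_a_3, h.e_a_4, map_add, Derivation.leibniz, smul_eq_mul] at hc
  linear_combination hc - a * h.curv_g12

lemma sndDeriv_13 : W.e (.inl 0) q1 - W.e (.inr 0) p1 =
    -W.w 0 0 (.inr 0) * p1 - W.w 0 1 (.inr 0) * p2 + W.w 0 0 (.inl 0) * q1 + W.w 0 1 (.inl 0) * q2 + W.w 0 0 (.inl 0) * q1 - W.w 0 0 (.inr 0) * p1 := by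
  have hc := W.commutator_inl_zero_inr_zero a
  simp only [h.e_a_1, h.e_a_2, h.e_a_3, h.e_a_4, map_add, Derivation.leibniz, smul_eq_mul] at hc
  linear_combination hc - a * h.curv_g13

lemma sndDeriv_14 : W.e (.inl 0) q2 - W.e (.inr 1) p1 =
    -W.w 0 0 (.inr 1) * p1 - W.w 0 1 (.inr 1) * p2 + W.w 1 1 (.inl 0) * q2 + W.w 0 0 (.inl 0) * q2 - W.w 0 0 (.inr 1) * p1 := by
  have hc := h.comm14 a
  simp only [h.e_a_1, h.e_a_2, h.e_a_3, h.e_a_4, map_add, Derivation.leibniz, smul_eq_mul] at hc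
  linear_combination hc - a * h.curv_g14

lemma sndDeriv_23 : W.e (.inl 1) q1 - W.e (.inr 0) p2 =
    -W.w 1 1 (.inr 0) * p2 + W.w 0 0 (.inl 1) * q1 + W.w 0 1 (.inl 1) * q2 + W.w 0 0 (.inl 1) * q1 - W.w 0 0 (.inr 0) * p2 := by
  have hc := h.comm23 a
  simp only [h.e_a_1, h.e_a_2, h.e_a_3, h.e_a_4, map_add, Derivation.leibniz, smul_eq_mul] at hc
  linear_combination hc - a * h.curv_g23

lemma sndDeriv_24 : W.e (.inl 1) q2 - W.e (.inr 1) p2 =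
    -W.w 1 1 (.inr 1) * p2 + W.w 1 1 (.inl 1) * q2 + W.w 0 0 (.inl 1) * q2 - W.w 0 0 (.inr 1) * p2 := by
  have hc := h.comm24 a
  simp only [h.e_a_1, h.e_a_2, h.e_a_3, h.e_a_4, map_add, Derivation.leibniz, smul_eq_mul] at hc
  linear_combination hc - a * h.curv_g24

lemma sndDeriv_34 : W.e (.inr 0) q2 - W.e (.inr 1) q1 =
    -W.w 0 0 (.inr 1) * q1 + (W.w 1 1 (.inr 0) - W.w 0 1 (.inr 1) + 3 * a) * q2 + W.w 0 0 (.inr 0) * q2 - W.w 0 0 (.inr 1) * q1 := by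
  have hc := h.comm34 a
  simp only [h.e_a_1, h.e_a_2, h.e_a_3, h.e_a_4, map_add, Derivation.leibniz, smul_eq_mul] at hc
  linear_combination hc - a * h.curv_g34

/-- The second covariant derivatives of the covector of a reduced web depend on four functions. -/
lemma exists_sndDeriv : ∃ B F G R : A,
    (W.e (.inl 0) p1 = 2 * (p1 * W.w 0 0 (.inl 0)) + p2 * W.w 0 1 (.inl 0) + (2 * R + 3 * (a * (2 * q1 - p1))) ∧
    W.e (.inl 1) p1 = 2 * (p1 * W.w 0 0 (.inl 1)) + p2 * W.w 0 1 (.inl 1) + (F + G + 3 * (a * q2)) ∧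
    W.e (.inr 0) p1 = 2 * (p1 * W.w 0 0 (.inr 0)) + p2 * W.w 0 1 (.inr 0) + (R) ∧
    W.e (.inr 1) p1 = 2 * (p1 * W.w 0 0 (.inr 1)) + p2 * W.w 0 1 (.inr 1) + (G)) ∧
    (W.e (.inl 0) p2 = p2 * (W.w 0 0 (.inl 0) + W.w 1 1 (.inl 0)) + (F + G + 3 * (a * (q2 - p2))) ∧
    W.e (.inl 1) p2 = p2 * (W.w 0 0 (.inl 1) + W.w 1 1 (.inl 1)) + (2 * B) ∧
    W.e (.inr 0) p2 = p2 * (W.w 0 0 (.inr 0) + W.w 1 1 (.inr 0)) + (F) ∧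
    W.e (.inr 1) p2 = p2 * (W.w 0 0 (.inr 1) + W.w 1 1 (.inr 1)) + (B)) ∧
    (W.e (.inl 0) q1 = 2 * (q1 * W.w 0 0 (.inl 0)) + q2 * W.w 0 1 (.inl 0) + (R) ∧
    W.e (.inl 1) q1 = 2 * (q1 * W.w 0 0 (.inl 1)) + q2 * W.w 0 1 (.inl 1) + (F) ∧
    W.e (.inr 0) q1 = 2 * (q1 * W.w 0 0 (.inr 0)) + q2 * W.w 0 1 (.inr 0) + (2 * R - 3 * (a * (2 * p1 - q1))) ∧
    W.e (.inr 1) q1 = 2 * (q1 * W.w 0 0 (.inr 1)) + q2 * W.w 0 1 (.inr 1) + (F + G - 3 * (a * p2))) ∧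
    (W.e (.inl 0) q2 = q2 * (W.w 0 0 (.inl 0) + W.w 1 1 (.inl 0)) + (G) ∧
    W.e (.inl 1) q2 = q2 * (W.w 0 0 (.inl 1) + W.w 1 1 (.inl 1)) + (B) ∧
    W.e (.inr 0) q2 = q2 * (W.w 0 0 (.inr 0) + W.w 1 1 (.inr 0)) + (F + G + 3 * (a * (q2 - p2))) ∧
    W.e (.inr 1) q2 = q2 * (W.w 0 0 (.inr 1) + W.w 1 1 (.inr 1)) + (2 * B)) := by
  -- The free functions are four of the sixteen covariant derivatives of `p₁, p₂, q₁, q₂`. The six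
  -- Bianchi equations and the six commutators on `a` determine the other twelve.
  obtain ⟨B, hB⟩ : ∃ B, B = W.e (.inr 1) p2 - p2 * (W.w 0 0 (.inr 1) + W.w 1 1 (.inr 1)) := ⟨_, rfl⟩
  obtain ⟨F, hF⟩ : ∃ F, F = W.e (.inr 0) p2 - p2 * (W.w 0 0 (.inr 0) + W.w 1 1 (.inr 0)) := ⟨_, rfl⟩
  obtain ⟨G, hG⟩ : ∃ G, G = W.e (.inr 1) p1 - (2 * (p1 * W.w 0 0 (.inr 1)) + p2 * W.w 0 1 (.inr 1)) := ⟨_, rfl⟩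
  obtain ⟨R, hR⟩ : ∃ R, R = W.e (.inr 0) p1 - (2 * (p1 * W.w 0 0 (.inr 0)) + p2 * W.w 0 1 (.inr 0)) := ⟨_, rfl⟩
  have q1_1 : W.e (.inl 0) q1 = 2 * (q1 * W.w 0 0 (.inl 0)) + q2 * W.w 0 1 (.inl 0) + (R) := by linear_combination h.sndDeriv_13 - hR
  have q2_1 : W.e (.inl 0) q2 = q2 * (W.w 0 0 (.inl 0) + W.w 1 1 (.inl 0)) + (G) := by linear_combination h.sndDeriv_14 - hG
  have q1_2 : W.e (.inl 1) q1 = 2 * (q1 * W.w 0 0 (.inl 1)) + q2 * W.w 0 1 (.inl 1) + (F) := by linear_combination h.sndDeriv_23 - hF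
  have q2_2 : W.e (.inl 1) q2 = q2 * (W.w 0 0 (.inl 1) + W.w 1 1 (.inl 1)) + (B) := by linear_combination h.sndDeriv_24 - hB
  have p2_2 : W.e (.inl 1) p2 = p2 * (W.w 0 0 (.inl 1) + W.w 1 1 (.inl 1)) + (2 * B) := by linear_combination h.bianchi_one_124 + 2 * q2_2
  have q2_4 : W.e (.inr 1) q2 = q2 * (W.w 0 0 (.inr 1) + W.w 1 1 (.inr 1)) + (2 * B) := by linear_combination h.bianchi_one_234 - 2 * hB
  have p1_1 : W.e (.inl 0) p1 = 2 * (p1 * W.w 0 0 (.inl 0)) + p2 * W.w 0 1 (.inl 0) + (2 * R + 3 * (a * (2 * q1 - p1))) := by linear_combination -h.bianchi_zero_123 + 2 * q1_1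
  have q1_3 : W.e (.inr 0) q1 = 2 * (q1 * W.w 0 0 (.inr 0)) + q2 * W.w 0 1 (.inr 0) + (2 * R - 3 * (a * (2 * p1 - q1))) := by linear_combination -h.bianchi_zero_134 - 2 * hR
  have p2_1 : W.e (.inl 0) p2 = p2 * (W.w 0 0 (.inl 0) + W.w 1 1 (.inl 0)) + (F + G + 3 * (a * (q2 - p2))) := by
    linear_combination -h.bianchi_one_123 - h.sndDeriv_12 + q1_2 + q2_1
  have p1_2 : W.e (.inl 1) p1 = 2 * (p1 * W.w 0 0 (.inl 1)) + p2 * W.w 0 1 (.inl 1) + (F + G + 3 * (a * q2)) := by linear_combination p2_1 - h.sndDeriv_12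
  have q2_3 : W.e (.inr 0) q2 = q2 * (W.w 0 0 (.inr 0) + W.w 1 1 (.inr 0)) + (F + G + 3 * (a * (q2 - p2))) := by
    linear_combination -h.bianchi_one_134 - h.sndDeriv_34 - hF - hG
  have q1_4 : W.e (.inr 1) q1 = 2 * (q1 * W.w 0 0 (.inr 1)) + q2 * W.w 0 1 (.inr 1) + (F + G - 3 * (a * p2)) := by linear_combination q2_3 - h.sndDeriv_34
  refine ⟨B, F, G, R, ⟨p1_1, p1_2, ?_, ?_⟩, ⟨p2_1, p2_2, ?_, ?_⟩, ⟨q1_1, q1_2, q1_3, q1_4⟩,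
    q2_1, q2_2, q2_3, q2_4⟩
  · linear_combination -hR
  · linear_combination -hG
  · linear_combination -hF
  · linear_combination -hB

lemma exists_reducedWeb : ∃ W' : ReducedWeb A, W'.p2 = p2 ∧ W'.q2 = q2 := by
  obtain ⟨B, F, G, R, ⟨p11, p12, p13, p14⟩, ⟨p21, p22, p23, p24⟩, ⟨q11, q12, q13, q14⟩,
    q21, q22, q23, q24⟩ := h.exists_sndDeriv
  refine ⟨⟨W.e (.inl 0), W.e (.inl 1), W.e (.inr 0), W.e (.inr 1),
    W.w 0 0 (.inl 0), W.w 0 0 (.inl 1), W.w 0 0 (.inr 0), W.w 0 0 (.inr 1),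
    W.w 0 1 (.inl 0), W.w 0 1 (.inl 1), W.w 0 1 (.inr 0), W.w 0 1 (.inr 1),
    W.w 1 1 (.inl 0), W.w 1 1 (.inl 1), W.w 1 1 (.inr 0), W.w 1 1 (.inr 1),
    a, p1, p2, q1, q2, B, F, G, R,
    h.comm12, h.comm14, h.comm23, h.comm24, h.comm34,
    h.curv_g12, h.curv_g14, h.curv_g23, h.curv_g24, h.curv_g34,
    h.curv_l12, h.curv_l14, h.curv_l23, h.curv_l34,
    h.curv_m12, h.curv_m14, h.curv_m23, h.curv_m24, h.curv_m34,
    h.e_a_1, h.e_a_2, h.e_a_3, h.e_a_4, p11, p12, p13, p14, p21, p22, p23, p24,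
    q11, q12, q13, q14, q21, q22, q23, q24⟩, rfl, rfl⟩

end IsReduced

/-- A transversally geodesic web with `b¹ = 0` cannot be nonisoclinic everywhere. -/
theorem IsSpecial.not_isUnit {A : Type*} [CommRing A] [Algebra ℝ A] [Nontrivial A]
    {W : WebFrame A} (hW : W.IsSpecial) :
    ¬ IsUnit (W.covA 0 (.inl 1) ^ 2 + W.covA 0 (.inr 1) ^ 2) := by
  intro hu
  obtain ⟨hw, ha⟩ := hW.w_and_a_eq_zero hu
  -- `3` is invertible in a real algebra, so the normalization required by `IsReduced` is always
  -- available.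
  have third : ∀ x : A, ∃ y, x = 3 * y := fun x =>
    ⟨(1 / 3 : ℝ) • x, by
      rw [← Nat.cast_ofNat (R := A), ← nsmul_eq_mul, ← Nat.cast_smul_eq_nsmul ℝ, smul_smul]
      norm_num⟩
  obtain ⟨a, h0⟩ := third (W.a 0)
  obtain ⟨p1, h1⟩ := third (W.covA 0 (.inl 0))
  obtain ⟨p2, h2⟩ := third (W.covA 0 (.inl 1))
  obtain ⟨q1, h3⟩ := third (W.covA 0 (.inr 0))
  obtain ⟨q2, h4⟩ := third (W.covA 0 (.inr 1))
  obtain ⟨W', hp, hq⟩ :=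
    (IsReduced.mk hW hw ha h0 h1 h2 h3 h4 : W.IsReduced a p1 p2 q1 q2).exists_reducedWeb
  apply W'.not_isUnit
  rw [h2, h4] at hu
  rw [hp, hq]
  have : (3 * p2) ^ 2 + (3 * q2) ^ 2 = 9 * (p2 ^ 2 + q2 ^ 2) := by ring
  rw [this] at hu
  exact isUnit_of_mul_isUnit_right hu

end WebFrame

end Reduction


/-! ### Integrability of the foliations in coordinates; the dual frame. -/

section Coframe

variable {M : Type*} [TopologicalSpace M] [ChartedSpace R4 M]

namespace ThreeWeb

/-- If the covectors `θ` vanish on the kernel of the differential of `u`, then the exterior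
differential of `θ` vanishes on vector fields that are tangent to the level sets of `u`. -/
lemma extD_eq_zero_of_ker {θ : R4 → R4 →L[ℝ] ℝ} {u : R4 → R2} {e f : R4 → R4} {y : R4}
    (hθ : DifferentiableAt ℝ θ y) (hu : ContDiffAt ℝ ∞ u y) (he : DifferentiableAt ℝ e y)
    (hf : DifferentiableAt ℝ f y) (hker : ∀ v, fderiv ℝ u y v = 0 → θ y v = 0)
    (hue : ∀ᶠ z in 𝓝 y, fderiv ℝ u z (e z) = 0) (huf : ∀ᶠ z in 𝓝 y, fderiv ℝ u z (f z) = 0)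
    (hθe : ∀ᶠ z in 𝓝 y, θ z (e z) = 0) (hθf : ∀ᶠ z in 𝓝 y, θ z (f z) = 0) :
    extD θ y (e y) (f y) = 0 := by
  have hu' : DifferentiableAt ℝ (fderiv ℝ u) y :=
    (hu.fderiv_right (m := ∞) (by simp)).differentiableAt (by simp)
  have hsymm : IsSymmSndFDerivAt ℝ u y := hu.isSymmSndFDerivAt (by
    simpa using (WithTop.coe_le_coe.2 le_top : (((2 : ℕ∞) : WithTop ℕ∞)) ≤ ∞))
  have h1 : ∀ v : R4, fderiv ℝ (fderiv ℝ u) y v (e y) + fderiv ℝ u y (fderiv ℝ e y v) = 0 := by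
    intro v
    have hz : (fun z => fderiv ℝ u z (e z)) =ᶠ[𝓝 y] fun _ => 0 := hue
    have := hz.fderiv_eq (𝕜 := ℝ)
    rw [fderiv_clm_apply hu' he] at this
    have := congrArg (fun L : R4 →L[ℝ] R2 => L v) this
    simpa [add_comm] using this
  have h2 : ∀ v : R4, fderiv ℝ (fderiv ℝ u) y v (f y) + fderiv ℝ u y (fderiv ℝ f y v) = 0 := by
    intro v
    have hz : (fun z => fderiv ℝ u z (f z)) =ᶠ[𝓝 y] fun _ => 0 := huf
    have := hz.fderiv_eq (𝕜 := ℝ)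
    rw [fderiv_clm_apply hu' hf] at this
    have := congrArg (fun L : R4 →L[ℝ] R2 => L v) this
    simpa [add_comm] using this
  have h3 : ∀ v : R4, fderiv ℝ θ y v (e y) + θ y (fderiv ℝ e y v) = 0 := by
    intro v
    have hz : (fun z => θ z (e z)) =ᶠ[𝓝 y] fun _ => 0 := hθe
    have := hz.fderiv_eq (𝕜 := ℝ)
    rw [fderiv_clm_apply hθ he] at this
    have := congrArg (fun L : R4 →L[ℝ] ℝ => L v) this
    simpa [add_comm] using this
  have h4 : ∀ v : R4, fderiv ℝ θ y v (f y) + θ y (fderiv ℝ f y v) = 0 := by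
    intro v
    have hz : (fun z => θ z (f z)) =ᶠ[𝓝 y] fun _ => 0 := hθf
    have := hz.fderiv_eq (𝕜 := ℝ)
    rw [fderiv_clm_apply hθ hf] at this
    have := congrArg (fun L : R4 →L[ℝ] ℝ => L v) this
    simpa [add_comm] using this
  -- The Lie bracket of two fields tangent to the level sets of `u` is tangent to them, by symmetry
  -- of the second derivative.
  have h5 : fderiv ℝ u y (fderiv ℝ f y (e y) - fderiv ℝ e y (f y)) = 0 := by
    rw [map_sub, eq_neg_of_add_eq_zero_right (h2 (e y)), eq_neg_of_add_eq_zero_right (h1 (f y)),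
      hsymm (e y) (f y), sub_self]
  have h6 := hker _ h5
  rw [map_sub] at h6
  have h7 := h3 (f y)
  have h8 := h4 (e y)
  rw [extD]
  linear_combination h8 - h7 - h6

namespace AdaptedCoframe

variable {W : ThreeWeb M} (C : W.AdaptedCoframe)

lemma mdifferentiable_chart : C.chart.MDifferentiable 𝓘(ℝ, R4) 𝓘(ℝ, R4) :=
  ⟨(contMDiffOn_of_mem_maximalAtlas C.chart_mem).mdifferentiableOn (by simp),
    (contMDiffOn_symm_of_mem_maximalAtlas C.chart_mem).mdifferentiableOn (by simp)⟩

lemma mfderiv_chart_symm {y : R4} (hy : y ∈ C.chart.target) (v : R4) :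
    mfderiv 𝓘(ℝ, R4) 𝓘(ℝ, R4) C.chart (C.chart.symm y)
      (mfderiv 𝓘(ℝ, R4) 𝓘(ℝ, R4) C.chart.symm y v) = v :=
  congrArg (fun L : R4 →L[ℝ] R4 => L v) (C.mdifferentiable_chart.comp_symm_deriv hy)

/-- The defining forms of the three foliations. -/
def distForm (ξ : Fin 3) (i : Fin 2) (y : R4) : R4 →L[ℝ] ℝ :=
  match ξ with
  | 0 => C.form 0 i y
  | 1 => C.form 1 i y
  | 2 => -(C.form 0 i y + C.form 1 i y)

lemma mem_dist (ξ : Fin 3) {x : M} (hx : x ∈ C.chart.source) (v : TangentSpace 𝓘(ℝ, R4) x) :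
    v ∈ W.dist ξ x ↔
      ∀ i, C.distForm ξ i (C.chart x) (mfderiv 𝓘(ℝ, R4) 𝓘(ℝ, R4) C.chart x v) = 0 := by
  fin_cases ξ
  · exact C.mem_dist₁ x hx v
  · exact C.mem_dist₂ x hx v
  · exact C.mem_dist₃ x hx v

lemma mem_dist_symm (ξ : Fin 3) {y : R4} (hy : y ∈ C.chart.target) (v : R4) :
    (mfderiv 𝓘(ℝ, R4) 𝓘(ℝ, R4) C.chart.symm y v) ∈ W.dist ξ (C.chart.symm y) ↔
      ∀ i, C.distForm ξ i y v = 0 := by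
  rw [C.mem_dist ξ (C.chart.map_target hy), C.chart.right_inv hy]
  exact forall_congr' fun i =>
    Iff.of_eq (congrArg (fun w : R4 => C.distForm ξ i y w = 0) (C.mfderiv_chart_symm hy v))

lemma contDiffOn_distForm (ξ : Fin 3) (i : Fin 2) :
    ContDiffOn ℝ ∞ (C.distForm ξ i) C.chart.target := by
  fin_cases ξ
  · exact C.smooth 0 i
  · exact C.smooth 1 i
  · exact ((C.smooth 0 i).add (C.smooth 1 i)).neg

/-- Integrability of the three foliations in terms of their defining forms. -/
lemma extD_distForm (ξ : Fin 3) (i : Fin 2) {y : R4} (hy : y ∈ C.chart.target) {e f : R4 → R4}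
    (he : ContDiffOn ℝ ∞ e C.chart.target) (hf : ContDiffOn ℝ ∞ f C.chart.target)
    (hθe : ∀ z ∈ C.chart.target, ∀ k, C.distForm ξ k z (e z) = 0)
    (hθf : ∀ z ∈ C.chart.target, ∀ k, C.distForm ξ k z (f z) = 0) :
    extD (C.distForm ξ i) y (e y) (f y) = 0 := by
  obtain ⟨V, u, hV, hyV, hu, hker⟩ := W.foliation ξ (C.chart.symm y)
  have hT : C.chart.target ∈ 𝓝 y := C.chart.open_target.mem_nhds hy
  have hVn : C.chart.target ∩ C.chart.symm ⁻¹' V ∈ 𝓝 y :=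
    Filter.inter_mem hT ((C.chart.continuousAt_symm hy).preimage_mem_nhds (hV.mem_nhds hyV))
  have hsymm : ∀ z ∈ C.chart.target, ContMDiffAt 𝓘(ℝ, R4) 𝓘(ℝ, R4) ∞ C.chart.symm z :=
    fun z hz => contMDiffAt_symm_of_mem_maximalAtlas C.chart_mem hz
  have huz : ∀ z ∈ C.chart.target ∩ C.chart.symm ⁻¹' V, ContDiffAt ℝ ∞ (u ∘ C.chart.symm) z :=
    fun z hz => (((hu _ hz.2).contMDiffAt (hV.mem_nhds hz.2)).comp z (hsymm z hz.1)).contDiffAt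
  have hk : ∀ z ∈ C.chart.target ∩ C.chart.symm ⁻¹' V, ∀ v,
      fderiv ℝ (u ∘ C.chart.symm) z v = 0 ↔ ∀ i, C.distForm ξ i z v = 0 := by
    intro z hz v
    rw [← C.mem_dist_symm ξ hz.1, (hker _ hz.2).2, ← mfderiv_eq_fderiv,
      mfderiv_comp z (((hu _ hz.2).contMDiffAt (hV.mem_nhds hz.2)).mdifferentiableAt (by simp))
        ((hsymm z hz.1).mdifferentiableAt (by simp))]
    rfl
  have hyV' := mem_of_mem_nhds hVn
  refine extD_eq_zero_of_ker (u := u ∘ C.chart.symm)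
    (((C.contDiffOn_distForm ξ i).contDiffAt hT).differentiableAt (by simp)) (huz y hyV')
    ((he.contDiffAt hT).differentiableAt (by simp)) ((hf.contDiffAt hT).differentiableAt (by simp))
    (fun v hv => (hk y hyV' v).1 hv i) ?_ ?_ ?_ ?_
  · filter_upwards [hVn] with z hz using (hk z hz _).2 (hθe z hz.1)
  · filter_upwards [hVn] with z hz using (hk z hz _).2 (hθf z hz.1)
  · filter_upwards [hT] with z hz using hθe z hz i
  · filter_upwards [hT] with z hz using hθf z hz i

lemma eq_zero_of_forms_eq_zero {y : R4} (hy : y ∈ C.chart.target) {v : R4}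
    (h : ∀ α i, C.form α i y v = 0) : v = 0 := by
  have h0 := (C.mem_dist_symm 0 hy v).2 fun i => h 0 i
  have h1 := (C.mem_dist_symm 1 hy v).2 fun i => h 1 i
  have := Submodule.disjoint_def.1 (W.transversal (C.chart.symm y) 0 1 (by decide)) _ h0 h1
  rw [← C.mfderiv_chart_symm hy v, this, map_zero]
  rfl

/-- The coframe at a point of the domain as a linear isomorphism. -/
lemma exists_coframeEquiv {y : R4} (hy : y ∈ C.chart.target) :
    ∃ L : R4 ≃L[ℝ] (Fin 2 → Fin 2 → ℝ), (L : R4 →L[ℝ] (Fin 2 → Fin 2 → ℝ)) = C.coframeMap y := by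
  have hinj : Function.Injective (C.coframeMap y) := by
    refine (injective_iff_map_eq_zero (C.coframeMap y)).2 fun v hv => ?_
    exact C.eq_zero_of_forms_eq_zero hy fun α i => congrFun (congrFun hv α) i
  have hfin : Module.finrank ℝ R4 = Module.finrank ℝ (Fin 2 → Fin 2 → ℝ) := by
    simp [Module.finrank_pi_fintype]
  refine ⟨(LinearEquiv.ofInjectiveOfFinrankEq (C.coframeMap y).toLinearMap hinj
    hfin).toContinuousLinearEquiv, ?_⟩
  ext v : 1
  rfl

lemma form_frame {y : R4} (hy : y ∈ C.chart.target) (α k β i : Fin 2) :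
    C.form β i y (C.frame α k y) = if α = β ∧ k = i then 1 else 0 := by
  obtain ⟨L, hL⟩ := C.exists_coframeEquiv hy
  have h : C.coframeMap y (C.frame α k y) = Pi.single α (Pi.single k 1) := by
    rw [frame, ← hL, ContinuousLinearMap.inverse_equiv]
    exact L.apply_symm_apply _
  have := congrFun (congrFun h β) i
  change C.form β i y (C.frame α k y) = _ at this
  rw [this]
  by_cases hα : α = β
  · subst hα
    by_cases hk : k = i
    · subst hk
      simp
    · simp [hk, Ne.symm hk]
  · simp [hα, Ne.symm hα]

/-- Inversion of linear maps is smooth at an isomorphism, and the coframe is one at each point of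
the domain. -/
lemma contDiffOn_frame (α k : Fin 2) : ContDiffOn ℝ ∞ (C.frame α k) C.chart.target := by
  have h : ContDiffOn ℝ ∞ C.coframeMap C.chart.target := by
    intro y hy
    have : C.coframeMap = fun y => ∑ β, ∑ i,
        (ContinuousLinearMap.smulRightL ℝ R4 (Fin 2 → Fin 2 → ℝ)).flip
          (Pi.single β (Pi.single i 1)) (C.form β i y) := by
      ext y v β i
      fin_cases β <;> fin_cases i <;> simp [coframeMap, Fin.sum_univ_two]
    rw [this]
    exact ContDiffWithinAt.sum fun β _ => ContDiffWithinAt.sum fun i _ =>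
      (ContinuousLinearMap.contDiff _).contDiffAt.comp_contDiffWithinAt y (C.smooth β i y hy)
  intro y hy
  obtain ⟨L, hL⟩ := C.exists_coframeEquiv hy
  have hinv : ContDiffAt ℝ ∞ ContinuousLinearMap.inverse (C.coframeMap y) := by
    rw [← hL]
    exact contDiffAt_map_inverse L
  exact (hinv.comp_contDiffWithinAt y (h y hy)).clm_apply contDiffWithinAt_const

end AdaptedCoframe

end ThreeWeb

end Coframe


/-! ### The structure equations of a coframe, and its web frame over the ring of smooth functions.
-/

section CoframeRing

open TopologicalSpace

lemma webCoeff_map {A B : Type*} [CommRing A] [CommRing B] (φ : A →+* B)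
    (w : Fin 2 → Fin 2 → Fin 2 ⊕ Fin 2 → A) (a : Fin 2 → A) (r s t : Fin 2 ⊕ Fin 2) :
    φ (webCoeff w a r s t) = webCoeff (fun j i r => φ (w j i r)) (fun j => φ (a j)) r s t := by
  rcases r with r | r <;> rcases s with s | s <;> rcases t with t | t <;>
    simp [webCoeff, apply_ite φ]

namespace smoothFunctions

/-- Evaluation at a point. -/
def eval {E : Type*} [NormedAddCommGroup E] [NormedSpace ℝ E] {V : Opens E} (y : V) :
    smoothFunctions V →+* ℝ :=
  (Pi.evalRingHom (fun _ : V => ℝ) y).comp (smoothFunctions V).subtype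

lemma eval_apply {E : Type*} [NormedAddCommGroup E] [NormedSpace ℝ E] {V : Opens E} (y : V)
    (f : smoothFunctions V) : eval y f = (f : V → ℝ) y := rfl

end smoothFunctions

variable {M : Type*} [TopologicalSpace M] [ChartedSpace R4 M]

namespace ThreeWeb

lemma contDiffOn_extD {U : Set R4} (hU : IsOpen U) {θ : R4 → R4 →L[ℝ] ℝ} {e f : R4 → R4}
    (hθ : ContDiffOn ℝ ∞ θ U) (he : ContDiffOn ℝ ∞ e U) (hf : ContDiffOn ℝ ∞ f U) :
    ContDiffOn ℝ ∞ (fun y => extD θ y (e y) (f y)) U := by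
  have h : ContDiffOn ℝ ∞ (fderiv ℝ θ) U := hθ.fderiv_of_isOpen hU (by simp)
  exact ((h.clm_apply he).clm_apply hf).sub ((h.clm_apply hf).clm_apply he)

lemma extD_swap (θ : R4 → R4 →L[ℝ] ℝ) (y u v : R4) : extD θ y u v = -extD θ y v u := by
  simp [extD]

lemma extD_sub_sub (θ : R4 → R4 →L[ℝ] ℝ) (y u u' v v' : R4) :
    extD θ y (u - u') (v - v') =
      extD θ y u v - extD θ y u v' - extD θ y u' v + extD θ y u' v' := by
  simp [extD]
  ring

/-- Cartan's formula for the exterior differential of a one-form on two vector fields. -/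
lemma extD_eq_lieBracket {θ : R4 → R4 →L[ℝ] ℝ} {e f : R4 → R4} {y : R4}
    (hθ : DifferentiableAt ℝ θ y) (he : DifferentiableAt ℝ e y) (hf : DifferentiableAt ℝ f y) :
    extD θ y (e y) (f y) = fderiv ℝ (fun z => θ z (f z)) y (e y)
      - fderiv ℝ (fun z => θ z (e z)) y (f y) - θ y (VectorField.lieBracket ℝ e f y) := by
  rw [fderiv_clm_apply hθ hf, fderiv_clm_apply hθ he]
  simp [extD, VectorField.lieBracket]
  ring

namespace AdaptedCoframe

variable {W : ThreeWeb M} (C : W.AdaptedCoframe)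

/-- The frame dual to the coframe, with one index. -/
def frameSum : Fin 2 ⊕ Fin 2 → R4 → R4 := Sum.elim (C.frame 0) (C.frame 1)

/-- The coframe, with one index. -/
def formSum : Fin 2 ⊕ Fin 2 → R4 → R4 →L[ℝ] ℝ := Sum.elim (C.form 0) (C.form 1)

lemma contDiffOn_frameSum (r : Fin 2 ⊕ Fin 2) :
    ContDiffOn ℝ ∞ (C.frameSum r) C.chart.target := by
  rcases r with k | k
  · exact C.contDiffOn_frame 0 k
  · exact C.contDiffOn_frame 1 k

lemma contDiffOn_formSum (r : Fin 2 ⊕ Fin 2) :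
    ContDiffOn ℝ ∞ (C.formSum r) C.chart.target := by
  rcases r with k | k
  · exact C.smooth 0 k
  · exact C.smooth 1 k

lemma formSum_frameSum {y : R4} (hy : y ∈ C.chart.target) (r s : Fin 2 ⊕ Fin 2) :
    C.formSum r y (C.frameSum s y) = if r = s then 1 else 0 := by
  rcases r with k | k <;> rcases s with l | l <;>
    simp [formSum, frameSum, C.form_frame hy, eq_comm]

lemma contDiffOn_conn (j i : Fin 2) : ContDiffOn ℝ ∞ (C.conn j i) C.chart.target := by
  refine ContDiffOn.sum fun k _ => ContDiffOn.add ?_ ?_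
  · exact (contDiffOn_extD C.chart.open_target (C.smooth _ _) (C.contDiffOn_frame _ _)
      (C.contDiffOn_frame _ _)).smul (C.smooth _ _)
  · exact (contDiffOn_extD C.chart.open_target (C.smooth _ _) (C.contDiffOn_frame _ _)
      (C.contDiffOn_frame _ _)).smul (C.smooth _ _)

lemma contDiffOn_a (j : Fin 2) : ContDiffOn ℝ ∞ (C.a j) C.chart.target := by
  refine ContDiffOn.sum fun k _ => ContDiffOn.sub ?_ (ContDiffOn.sum fun m _ => ?_)
  · exact contDiffOn_extD C.chart.open_target (C.smooth _ _) (C.contDiffOn_frame _ _)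
      (C.contDiffOn_frame _ _)
  · exact (((C.smooth _ _).clm_apply (C.contDiffOn_frame _ _)).mul
      ((C.contDiffOn_conn _ _).clm_apply (C.contDiffOn_frame _ _))).sub
      (((C.smooth _ _).clm_apply (C.contDiffOn_frame _ _)).mul
      ((C.contDiffOn_conn _ _).clm_apply (C.contDiffOn_frame _ _)))

lemma conn_frame_zero {y : R4} (hy : y ∈ C.chart.target) (j i k : Fin 2) :
    C.conn j i y (C.frame 0 k y) = extD (C.form 1 i) y (C.frame 1 j y) (C.frame 0 k y) := by
  fin_cases k <;> simp [conn, C.form_frame hy]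

lemma conn_frame_one {y : R4} (hy : y ∈ C.chart.target) (j i k : Fin 2) :
    C.conn j i y (C.frame 1 k y) = extD (C.form 0 i) y (C.frame 0 j y) (C.frame 1 k y) := by
  fin_cases k <;> simp [conn, C.form_frame hy]

lemma extD_form_zero_frame_one {y : R4} (hy : y ∈ C.chart.target) (i j k : Fin 2) :
    extD (C.form 0 i) y (C.frame 1 j y) (C.frame 1 k y) = 0 :=
  C.extD_distForm 0 i hy (C.contDiffOn_frame 1 j) (C.contDiffOn_frame 1 k)
    (fun z hz l => by simp [distForm, C.form_frame hz])
    (fun z hz l => by simp [distForm, C.form_frame hz])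

lemma extD_form_one_frame_zero {y : R4} (hy : y ∈ C.chart.target) (i j k : Fin 2) :
    extD (C.form 1 i) y (C.frame 0 j y) (C.frame 0 k y) = 0 :=
  C.extD_distForm 1 i hy (C.contDiffOn_frame 0 j) (C.contDiffOn_frame 0 k)
    (fun z hz l => by simp [distForm, C.form_frame hz])
    (fun z hz l => by simp [distForm, C.form_frame hz])

/-- Integrability of the third foliation: `e_{1j} - e_{2j}` annihilates `ω₁ⁱ + ω₂ⁱ`. This couples
the torsion of `ω₂` to that of `ω₁`. -/
lemma extD_third {y : R4} (hy : y ∈ C.chart.target) (i j k : Fin 2) :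
    extD (C.form 0 i) y (C.frame 0 j y - C.frame 1 j y) (C.frame 0 k y - C.frame 1 k y)
      + extD (C.form 1 i) y (C.frame 0 j y - C.frame 1 j y) (C.frame 0 k y - C.frame 1 k y)
      = 0 := by
  have h := C.extD_distForm 2 i hy ((C.contDiffOn_frame 0 j).sub (C.contDiffOn_frame 1 j))
    ((C.contDiffOn_frame 0 k).sub (C.contDiffOn_frame 1 k))
    (fun z hz l => by simp [distForm, C.form_frame hz])
    (fun z hz l => by simp [distForm, C.form_frame hz])
  have hd : ∀ α, DifferentiableAt ℝ (C.form α i) y := fun α =>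
    ((C.smooth α i).contDiffAt (C.chart.open_target.mem_nhds hy)).differentiableAt (by simp)
  have hf : fderiv ℝ (C.distForm 2 i) y = -(fderiv ℝ (C.form 0 i) y + fderiv ℝ (C.form 1 i) y) := by
    change fderiv ℝ (fun z => -(C.form 0 i z + C.form 1 i z)) y = _
    rw [fderiv_fun_neg, fderiv_fun_add (hd 0) (hd 1)]
  simp only [extD, hf] at h ⊢
  simp only [neg_apply, add_apply] at h
  linear_combination -h

/-- The structure equations: the torsion part of `dω₁ⁱ` and `dω₂ⁱ` is given by the covector `a`. -/
lemma extD_form_zero_frame_zero {y : R4} (hy : y ∈ C.chart.target) (i k l : Fin 2) :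
    extD (C.form 0 i) y (C.frame 0 k y) (C.frame 0 l y) =
      C.conn k i y (C.frame 0 l y) - C.conn l i y (C.frame 0 k y)
        + (if l = i then C.a k y else 0) - (if k = i then C.a l y else 0) := by
  -- The covector is the trace of the torsion. In dimension two a tensor `Tⁱ_{kl}` skew in `k, l` is
  -- determined by its trace, so the case analysis below closes.
  have ha : ∀ j, C.a j y = ∑ k, (extD (C.form 0 k) y (C.frame 0 j y) (C.frame 0 k y)
      - C.conn j k y (C.frame 0 k y) + C.conn k k y (C.frame 0 j y)) := by
    intro j
    refine Finset.sum_congr rfl fun k _ => ?_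
    simp [wedge, C.form_frame hy, Finset.sum_sub_distrib]
    ring
  have hs := fun i k => extD_swap (C.form 0 i) y (C.frame 0 k y) (C.frame 0 k y)
  have hs' := fun i => extD_swap (C.form 0 i) y (C.frame 0 1 y) (C.frame 0 0 y)
  simp only [ha, Fin.sum_univ_two]
  have h00 := hs 0 0
  have h01 := hs 0 1
  have h10 := hs 1 0
  have h11 := hs 1 1
  have h0 := hs' 0
  have h1 := hs' 1
  fin_cases i <;> fin_cases k <;> fin_cases l <;> simp <;> linarith

/-- The opposite sign of `a` comes from the third foliation: after the mixed terms are identified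
with the connection, the two torsions must add up to zero. -/
lemma extD_form_one_frame_one {y : R4} (hy : y ∈ C.chart.target) (i k l : Fin 2) :
    extD (C.form 1 i) y (C.frame 1 k y) (C.frame 1 l y) =
      C.conn k i y (C.frame 1 l y) - C.conn l i y (C.frame 1 k y)
        - (if l = i then C.a k y else 0) + (if k = i then C.a l y else 0) := by
  have h := C.extD_third hy i k l
  simp only [extD_sub_sub, C.extD_form_zero_frame_zero hy, C.extD_form_zero_frame_one hy,
    C.extD_form_one_frame_zero hy, ← C.conn_frame_one hy, ← C.conn_frame_zero hy,
    extD_swap (C.form 0 i) y (C.frame 1 k y) (C.frame 0 l y),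
    extD_swap (C.form 1 i) y (C.frame 0 k y) (C.frame 1 l y)] at h
  linear_combination h

/-- Forms have constant values on the dual frame, so Cartan's formula reduces to minus the exterior
differential. -/
lemma formSum_lieBracket {y : R4} (hy : y ∈ C.chart.target) (r s t : Fin 2 ⊕ Fin 2) :
    C.formSum t y (VectorField.lieBracket ℝ (C.frameSum r) (C.frameSum s) y) =
      webCoeff (fun j i r => C.conn j i y (C.frameSum r y)) (fun j => C.a j y) r s t := by
  have hT : C.chart.target ∈ 𝓝 y := C.chart.open_target.mem_nhds hy
  have hE : ∀ r, DifferentiableAt ℝ (C.frameSum r) y := fun r =>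
    ((C.contDiffOn_frameSum r).contDiffAt hT).differentiableAt (by simp)
  have hc : ∀ r, fderiv ℝ (fun z => C.formSum t z (C.frameSum r z)) y = 0 := by
    intro r
    have : (fun z => C.formSum t z (C.frameSum r z)) =ᶠ[𝓝 y] fun _ => if t = r then 1 else 0 := by
      filter_upwards [hT] with z hz using C.formSum_frameSum hz t r
    rw [this.fderiv_eq]
    simp
  have h := extD_eq_lieBracket
    (((C.contDiffOn_formSum t).contDiffAt hT).differentiableAt (by simp)) (hE r) (hE s)
  rw [hc, hc] at h
  have h' : C.formSum t y (VectorField.lieBracket ℝ (C.frameSum r) (C.frameSum s) y) =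
      -extD (C.formSum t) y (C.frameSum r y) (C.frameSum s y) := by
    rw [h]
    simp
  rw [h']
  rcases r with r | r <;> rcases s with s | s <;> rcases t with t | t <;>
    simp only [formSum, frameSum, Sum.elim_inl, Sum.elim_inr, webCoeff,
      C.extD_form_zero_frame_zero hy, C.extD_form_zero_frame_one hy,
      C.extD_form_one_frame_zero hy, C.extD_form_one_frame_one hy, ← C.conn_frame_one hy,
      ← C.conn_frame_zero hy, extD_swap (C.form 0 t) y (C.frame 1 r y) (C.frame 0 s y),
      extD_swap (C.form 1 t) y (C.frame 0 r y) (C.frame 1 s y)] <;> ring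

lemma eq_sum_frameSum {y : R4} (hy : y ∈ C.chart.target) (v : R4) :
    v = ∑ t, C.formSum t y v • C.frameSum t y := by
  rw [← sub_eq_zero]
  refine C.eq_zero_of_forms_eq_zero hy fun α i => ?_
  have h : ∀ t, C.formSum t y (v - ∑ t, C.formSum t y v • C.frameSum t y) = 0 := by
    intro t
    simp only [map_sub, map_sum, map_smul, smul_eq_mul, C.formSum_frameSum hy, mul_ite, mul_one,
      mul_zero, Finset.sum_ite_eq, Finset.mem_univ, if_true, sub_self]
  fin_cases α
  · exact h (.inl i)
  · exact h (.inr i)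

/-- The adapted moving frame of a coframe, on an open part of the coordinate domain. -/
def webFrame (V : Opens R4) (hV : (V : Set R4) ⊆ C.chart.target) :
    WebFrame (smoothFunctions V) where
  e r := smoothFunctions.vectorField (C.frameSum r) ((C.contDiffOn_frameSum r).mono hV)
  w j i r := smoothFunctions.mk (fun y => C.conn j i y (C.frameSum r y))
    (((C.contDiffOn_conn j i).clm_apply (C.contDiffOn_frameSum r)).mono hV)
  a j := smoothFunctions.mk (C.a j) ((C.contDiffOn_a j).mono hV)
  c := webCoeff
    (fun j i r => smoothFunctions.mk (fun y => C.conn j i y (C.frameSum r y))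
      (((C.contDiffOn_conn j i).clm_apply (C.contDiffOn_frameSum r)).mono hV))
    (fun j => smoothFunctions.mk (C.a j) ((C.contDiffOn_a j).mono hV))
  c_eq := rfl
  lie_e r s := by
    rw [smoothFunctions.bracket_vectorField]
    refine smoothFunctions.vectorField_eq_sum _ _ fun y => ?_
    refine (C.eq_sum_frameSum (hV y.2) _).trans (Finset.sum_congr rfl fun t _ => ?_)
    rw [C.formSum_lieBracket (hV y.2), ← smoothFunctions.eval_apply, webCoeff_map]
    rfl
  independent f h k := smoothFunctions.linearIndependent_vectorField
    (fun r => (C.contDiffOn_frameSum r).mono hV)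
    (fun y hy r s => C.formSum_frameSum (hV hy) r s) f h k

variable (V : Opens R4) (hV : (V : Set R4) ⊆ C.chart.target)

lemma webFrame_covA_inl (i j : Fin 2) (y : V) :
    ((C.webFrame V hV).covA i (.inl j) : V → ℝ) y = C.p i j y := by
  rw [← smoothFunctions.eval_apply, WebFrame.covA, map_sub, map_sum]
  simp only [map_mul, webFrame, smoothFunctions.vectorField_mk]
  rfl

lemma webFrame_covA_inr (i j : Fin 2) (y : V) :
    ((C.webFrame V hV).covA i (.inr j) : V → ℝ) y = C.q i j y := by
  rw [← smoothFunctions.eval_apply, WebFrame.covA, map_sub, map_sum]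
  simp only [map_mul, webFrame, smoothFunctions.vectorField_mk]
  rfl

lemma webFrame_extDeriv_w (j i : Fin 2) (r s : Fin 2 ⊕ Fin 2) (y : V) :
    ((C.webFrame V hV).extDeriv ((C.webFrame V hV).w j i) r s : V → ℝ) y =
      extD (C.conn j i) y (C.frameSum r y) (C.frameSum s y) := by
  have hT : C.chart.target ∈ 𝓝 (y : R4) := C.chart.open_target.mem_nhds (hV y.2)
  rw [extD_eq_lieBracket (((C.contDiffOn_conn j i).contDiffAt hT).differentiableAt (by simp))
    (((C.contDiffOn_frameSum r).contDiffAt hT).differentiableAt (by simp))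
    (((C.contDiffOn_frameSum s).contDiffAt hT).differentiableAt (by simp)),
    C.eq_sum_frameSum (hV y.2) (VectorField.lieBracket ℝ (C.frameSum r) (C.frameSum s) y), map_sum,
    ← smoothFunctions.eval_apply, MovingFrame.extDeriv, map_sub, map_sub, map_sum]
  simp only [map_mul, map_smul, smul_eq_mul, webFrame, smoothFunctions.vectorField_mk, webCoeff_map,
    C.formSum_lieBracket (hV y.2)]
  rfl

lemma webFrame_b (i j k l : Fin 2) (y : V) :
    ((C.webFrame V hV).b i j k l : V → ℝ) y = C.b i j k l y := by
  rw [← smoothFunctions.eval_apply, WebFrame.b, WebFrame.curv, map_sub, map_sum,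
    smoothFunctions.eval_apply, C.webFrame_extDeriv_w]
  simp only [map_mul, map_sub]
  rfl

end AdaptedCoframe

end ThreeWeb

end CoframeRing


/-! ### Renaming the two coframe indices. -/

section Relabelling

lemma webCoeff_relabel {A : Type*} [CommRing A] (w : Fin 2 → Fin 2 → Fin 2 ⊕ Fin 2 → A) (a : Fin 2 → A)
    (σ : Equiv.Perm (Fin 2)) (r s t : Fin 2 ⊕ Fin 2) :
    webCoeff w a (Sum.map σ σ r) (Sum.map σ σ s) (Sum.map σ σ t) =
      webCoeff (fun j i r => w (σ j) (σ i) (Sum.map σ σ r)) (fun j => a (σ j)) r s t := by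
  rcases r with r | r <;> rcases s with s | s <;> rcases t with t | t <;>
    simp [webCoeff]

namespace WebFrame

variable {A : Type*} [CommRing A] [Algebra ℝ A] (W : WebFrame A) (σ : Equiv.Perm (Fin 2))

/-- The web frame in which the index `i` of the coframe is renamed by a permutation. -/
def relabel : WebFrame A where
  e r := W.e (Sum.map σ σ r)
  c r s t := W.c (Sum.map σ σ r) (Sum.map σ σ s) (Sum.map σ σ t)
  w j i r := W.w (σ j) (σ i) (Sum.map σ σ r)
  a j := W.a (σ j)
  c_eq := by
    ext r s t
    rw [W.c_eq, webCoeff_relabel]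
  lie_e r s := by
    rw [W.lie_e]
    exact ((Equiv.sumCongr σ σ).sum_comp
      (fun k => W.c (Sum.map σ σ r) (Sum.map σ σ s) k • W.e k)).symm
  independent f h k := by
    have h' : ∑ k, f ((Equiv.sumCongr σ σ).symm k) • W.e k = 0 := by
      rw [← h, ← (Equiv.sumCongr σ σ).sum_comp]
      refine Finset.sum_congr rfl fun k _ => ?_
      rw [Equiv.symm_apply_apply]
      rfl
    simpa using W.independent _ h' (Equiv.sumCongr σ σ k)

lemma relabel_extDeriv (φ : Fin 2 ⊕ Fin 2 → A) (r s : Fin 2 ⊕ Fin 2) :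
    (W.relabel σ).extDeriv (fun r => φ (Sum.map σ σ r)) r s =
      W.extDeriv φ (Sum.map σ σ r) (Sum.map σ σ s) := by
  simp only [MovingFrame.extDeriv]
  congr 1
  exact (Equiv.sumCongr σ σ).sum_comp
      (fun k => W.c (Sum.map σ σ r) (Sum.map σ σ s) k * φ k)

lemma relabel_b (i j k l : Fin 2) : (W.relabel σ).b i j k l = W.b (σ i) (σ j) (σ k) (σ l) := by
  simp only [b, curv]
  congr 1
  · exact W.relabel_extDeriv σ (W.w (σ j) (σ i)) (.inl k) (.inr l)
  · exact Equiv.sum_comp σ fun m =>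
      (W.w (σ j) m (.inl (σ k)) * W.w m (σ i) (.inr (σ l))
        - W.w (σ j) m (.inr (σ l)) * W.w m (σ i) (.inl (σ k)))

lemma relabel_covA (i : Fin 2) (r : Fin 2 ⊕ Fin 2) :
    (W.relabel σ).covA i r = W.covA (σ i) (Sum.map σ σ r) := by
  simp only [covA]
  congr 1
  exact Equiv.sum_comp σ fun m => W.a m * W.w (σ i) m (Sum.map σ σ r)

end WebFrame

end Relabelling


/-! ### Transversal planes, and sections parallel up to a factor. -/

section GeodesicSurfaces

open TopologicalSpace

/-- Integrability condition for a section `ζ` that is parallel up to a factor, for a connection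
with the components `X`, `Y` and the curvature `B`: the curvature maps `ζ` to a multiple of `ζ`. -/
lemma Derivation.exists_curvature_eq {A : Type*} [CommRing A] [Algebra ℝ A]
    {D E : Derivation ℝ A A} {ζ : Fin 2 → A} {X Y B : Fin 2 → Fin 2 → A} {f g : A}
    (hE : ∀ m, E (ζ m) = -f * ζ m - ∑ k, ζ k * Y k m)
    (hD : ∀ m, D (ζ m) = g * ζ m - ∑ k, ζ k * X k m)
    (hB : ∀ k m, D (Y k m) - E (X k m) =
      f * X k m + g * Y k m + B k m + ∑ n, (X k n * Y n m - Y k n * X n m))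
    (hDE : ∀ x, D (E x) - E (D x) = f * D x + g * E x) (m : Fin 2) :
    ∑ k, ζ k * B k m = -(D f + E g) * ζ m := by
  have h := hDE (ζ m)
  rw [hE m, hD m] at h
  simp only [Fin.sum_univ_two, map_sub, map_add, map_neg, Derivation.leibniz, smul_eq_mul, hE, hD,
    neg_mul] at h hB ⊢
  linear_combination -h - ζ 0 * hB 0 m - ζ 1 * hB 1 m

/-- A plane that meets each of three planes in general position along a line. -/
lemma exists_direction_of_transversal {E : Type*} [AddCommGroup E] [Module ℝ E]
    {D : Fin 3 → Submodule ℝ E} (hdisj : ∀ ξ η, ξ ≠ η → Disjoint (D ξ) (D η))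
    {φ : Fin 2 → Fin 2 → E →ₗ[ℝ] ℝ} (h0 : ∀ v ∈ D 0, ∀ i, φ 0 i v = 0)
    (h1 : ∀ v ∈ D 1, ∀ i, φ 1 i v = 0) (h2 : ∀ v ∈ D 2, ∀ i, φ 0 i v + φ 1 i v = 0)
    {P : Submodule ℝ E} (hP : Module.finrank ℝ P = 2)
    (hPD : ∀ ξ, Module.finrank ℝ (P ⊓ D ξ : Submodule ℝ E) = 1) :
    ∃ ξ : Fin 2 → ℝ, ∀ v ∈ P, ∃ s r : ℝ, ∀ i, φ 0 i v = s * ξ i ∧ φ 1 i v = r * ξ i := by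
  have hex : ∀ ξ, ∃ v ∈ P ⊓ D ξ, v ≠ 0 := fun ξ =>
    Submodule.exists_mem_ne_zero_of_ne_bot fun h => by
      have := hPD ξ
      rw [h, finrank_bot] at this
      exact zero_ne_one this
  choose v hv hv0 using hex
  have hne : ∀ ξ η, ξ ≠ η → ∀ a : ℝ, v ξ ≠ a • v η := fun ξ η h a hva =>
    hv0 ξ (Submodule.disjoint_def.1 (hdisj ξ η h) _ (hv ξ).2
      (hva ▸ Submodule.smul_mem _ a (hv η).2))
  have hli : LinearIndependent ℝ ![v 0, v 1] := by
    rw [LinearIndependent.pair_iff' (hv0 0)]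
    exact fun a h => hne 1 0 (by decide) a h.symm
  have : FiniteDimensional ℝ P := Module.finite_of_finrank_eq_succ hP
  have hspan : Submodule.span ℝ {v 0, v 1} = P := by
    refine Submodule.eq_of_le_of_finrank_eq ?_ ?_
    · rw [Submodule.span_le]
      rintro _ (rfl | rfl)
      · exact (hv 0).1
      · exact (hv 1).1
    · have := finrank_span_eq_card hli
      rw [Matrix.range_cons_cons_empty] at this
      rw [this, hP, Fintype.card_fin]
  obtain ⟨a, b, hab⟩ := Submodule.mem_span_pair.1 (hspan ▸ (hv 2).1)
  have hb : b ≠ 0 := by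
    rintro rfl
    exact hne 2 0 (by decide) a (by rw [← hab, zero_smul, add_zero])
  -- The third line of intersection is spanned by `a v₀ + b v₁` with `b ≠ 0`, and `φ₀ + φ₁` vanishes
  -- on it. Hence `φ₀(v₁) = -(a/b) φ₁(v₀)`: both families of forms are proportional to the vector
  -- `φ₁(v₀)`.
  refine ⟨fun i => φ 1 i (v 0), fun w hw => ?_⟩
  obtain ⟨c, d, rfl⟩ := Submodule.mem_span_pair.1 (hspan ▸ hw)
  refine ⟨-(d * a / b), c, fun i => ?_⟩
  have e0 := h0 _ (hv 0).2 i
  have e1 := h1 _ (hv 1).2 i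
  have e2 := h2 _ (hv 2).2 i
  rw [← hab] at e2
  simp only [map_add, map_smul, smul_eq_mul, e0, e1] at e2 ⊢
  constructor
  · field_simp
    linear_combination d * e2
  · ring

namespace ThreeWeb

/-- Cartan's formula for the pull-back of a one-form to a parametrised surface. -/
lemma extD_pullback {θ : R4 → R4 →L[ℝ] ℝ} {S : R2 → R4} {e f : R2 → R2} {t : R2}
    (hθ : DifferentiableAt ℝ θ (S t)) (hS : ContDiffAt ℝ ∞ S t) (he : DifferentiableAt ℝ e t)
    (hf : DifferentiableAt ℝ f t) :
    extD θ (S t) (fderiv ℝ S t (e t)) (fderiv ℝ S t (f t)) =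
      fderiv ℝ (fun z => θ (S z) (fderiv ℝ S z (f z))) t (e t)
      - fderiv ℝ (fun z => θ (S z) (fderiv ℝ S z (e z))) t (f t)
      - θ (S t) (fderiv ℝ S t (VectorField.lieBracket ℝ e f t)) := by
  have hdS : DifferentiableAt ℝ (fderiv ℝ S) t :=
    (hS.fderiv_right (m := ∞) (by simp)).differentiableAt (by simp)
  have hSd : DifferentiableAt ℝ S t := hS.differentiableAt (by simp)
  have hsymm : IsSymmSndFDerivAt ℝ S t := hS.isSymmSndFDerivAt (by
    simpa using (WithTop.coe_le_coe.2 le_top : (((2 : ℕ∞) : WithTop ℕ∞)) ≤ ∞))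
  have h : ∀ f : R2 → R2, DifferentiableAt ℝ f t → ∀ v : R2,
      fderiv ℝ (fun z => θ (S z) (fderiv ℝ S z (f z))) t v =
        fderiv ℝ θ (S t) (fderiv ℝ S t v) (fderiv ℝ S t (f t))
          + θ (S t) (fderiv ℝ (fderiv ℝ S) t v (f t)) + θ (S t) (fderiv ℝ S t (fderiv ℝ f t v)) := by
    intro f hf v
    have hθS : fderiv ℝ (fun z => θ (S z)) t = (fderiv ℝ θ (S t)).comp (fderiv ℝ S t) :=
      fderiv_comp t hθ hSd
    have hc : DifferentiableAt ℝ (fun z => θ (S z)) t := hθ.comp t hSd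
    rw [fderiv_clm_apply hc (hdS.clm_apply hf), fderiv_clm_apply hdS hf, hθS]
    simp
    ring
  rw [h f hf, h e he, hsymm (f t) (e t)]
  simp [extD, VectorField.lieBracket]
  ring

end ThreeWeb

end GeodesicSurfaces


/-! ### The curvature condition imposed by a transversally geodesic surface. -/

section IntegrabilityCondition

open TopologicalSpace

variable {M : Type*} [TopologicalSpace M] [ChartedSpace R4 M]

namespace ThreeWeb

namespace AdaptedCoframe

variable {W : ThreeWeb M} (C : W.AdaptedCoframe)

/-- Frame fields on a transversally geodesic surface, tangent to the lines which the first two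
foliations cut on the surface; `ζ` is the direction of the transversal bivectors. -/
lemma exists_surface_frame {S : R2 → R4} {N : Set R2} (hN : IsOpen N) (h0 : (0 : R2) ∈ N)
    (hS : ContDiffOn ℝ ∞ S N) (hmaps : ∀ t ∈ N, S t ∈ C.chart.target)
    (hplane : ∀ t ∈ N, ∃ ξ : Fin 2 → ℝ, ∀ v, ∃ s r : ℝ, ∀ i,
      C.form 0 i (S t) (fderiv ℝ S t v) = s * ξ i ∧ C.form 1 i (S t) (fderiv ℝ S t v) = r * ξ i)
    {j : Fin 2} {v : Fin 2 → R2}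
    (hv : ∀ α β, C.form α j (S 0) (fderiv ℝ S 0 (v β)) = if α = β then 1 else 0) :
    ∃ (U : Opens R2) (e : Fin 2 → R2 → R2) (ζ : Fin 2 → R2 → ℝ),
      (U : Set R2) ⊆ N ∧ (0 : R2) ∈ U ∧ (∀ α, ContDiffOn ℝ ∞ (e α) U) ∧
      (∀ i, ContDiffOn ℝ ∞ (ζ i) U) ∧
      (∀ t ∈ U, ∀ α β i, C.form α i (S t) (fderiv ℝ S t (e β t)) = if α = β then ζ i t else 0) ∧
      ∀ t ∈ U, ∀ w : R2, w = ∑ α, C.form α j (S t) (fderiv ℝ S t w) • e α t := by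
  have hdS : ContDiffOn ℝ ∞ (fderiv ℝ S) N := hS.fderiv_of_isOpen hN (by simp)
  have hsm : ∀ α i (f : R2 → R2), ContDiffOn ℝ ∞ f N →
      ContDiffOn ℝ ∞ (fun t => C.form α i (S t) (fderiv ℝ S t (f t))) N := fun α i f hf =>
    ((C.smooth α i).comp hS hmaps).clm_apply (hdS.clm_apply hf)
  let m : Fin 2 → Fin 2 → R2 → ℝ := fun α β t => C.form α j (S t) (fderiv ℝ S t (v β))
  have hm : ∀ α β, ContDiffOn ℝ ∞ (m α β) N := fun α β => hsm α j _ contDiffOn_const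
  -- The fields `e` come from Cramer's rule: they are dual to the pull-backs of `ω₁ʲ` and `ω₂ʲ`,
  -- which stay independent where the determinant `δ` is nonzero.
  let δ : R2 → ℝ := fun t => m 0 0 t * m 1 1 t - m 0 1 t * m 1 0 t
  have hδ : ContDiffOn ℝ ∞ δ N := ((hm 0 0).mul (hm 1 1)).sub ((hm 0 1).mul (hm 1 0))
  have hδ0 : δ 0 = 1 := by simp [δ, m, hv]
  let U : Opens R2 := ⟨N ∩ δ ⁻¹' {0}ᶜ, hδ.continuousOn.isOpen_inter_preimage hN
    isOpen_compl_singleton⟩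
  have hUN : (U : Set R2) ⊆ N := Set.inter_subset_left
  have hUδ : ∀ t ∈ U, δ t ≠ 0 := fun t ht => ht.2
  let e : Fin 2 → R2 → R2 := ![fun t => (δ t)⁻¹ • (m 1 1 t • v 0 - m 1 0 t • v 1),
    fun t => (δ t)⁻¹ • (m 0 0 t • v 1 - m 0 1 t • v 0)]
  have hinv : ContDiffOn ℝ ∞ (fun t => (δ t)⁻¹) U := (hδ.mono hUN).inv hUδ
  have he : ∀ α, ContDiffOn ℝ ∞ (e α) U := by
    intro α
    fin_cases α
    · exact hinv.smul ((((hm 1 1).smul contDiffOn_const).sub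
        ((hm 1 0).smul contDiffOn_const)).mono hUN)
    · exact hinv.smul ((((hm 0 0).smul contDiffOn_const).sub
        ((hm 0 1).smul contDiffOn_const)).mono hUN)
  have hej : ∀ t ∈ U, ∀ α β, C.form α j (S t) (fderiv ℝ S t (e β t)) = if α = β then 1 else 0 := by
    intro t ht α β
    have hm' : ∀ α β, C.form α j (S t) (fderiv ℝ S t (v β)) = m α β t := fun _ _ => rfl
    have hd := hUδ t ht
    fin_cases α <;> fin_cases β <;>
      simp only [e, Fin.zero_eta, Fin.mk_one, Matrix.cons_val_zero, Matrix.cons_val_one, map_smul,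
        map_sub, smul_eq_mul, hm', if_true, zero_ne_one, one_ne_zero, if_false] <;>
      field_simp <;> simp only [δ] <;> ring
  have hsurj : ∀ t ∈ U, ∀ w : R2, (∀ α, C.form α j (S t) (fderiv ℝ S t w) = 0) → w = 0 := by
    intro t ht
    let L : R2 →ₗ[ℝ] (Fin 2 → ℝ) :=
      LinearMap.pi fun α => ((C.form α j (S t)).comp (fderiv ℝ S t)).toLinearMap
    have hL : Function.Surjective L := by
      intro c
      refine ⟨∑ β, c β • e β t, ?_⟩
      ext α
      simp only [L, LinearMap.pi_apply, map_sum, map_smul, ContinuousLinearMap.coe_coe,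
        ContinuousLinearMap.comp_apply, hej t ht]
      simp
    have hLi : Function.Injective L :=
      (LinearMap.injective_iff_surjective_of_finrank_eq_finrank (by simp)).2 hL
    intro w hw
    exact hLi (by rw [map_zero]; exact funext hw)
  have hdec : ∀ t ∈ U, ∀ w : R2, w = ∑ α, C.form α j (S t) (fderiv ℝ S t w) • e α t := by
    intro t ht w
    rw [← sub_eq_zero]
    refine hsurj t ht _ fun α => ?_
    simp only [map_sub, map_sum, map_smul, smul_eq_mul, hej t ht, mul_ite, mul_one, mul_zero,
      Finset.sum_ite_eq, Finset.mem_univ, if_true, sub_self]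
  refine ⟨U, e, fun i t => C.form 0 i (S t) (fderiv ℝ S t (e 0 t)), hUN, ⟨h0, by simp [hδ0]⟩, he,
    fun i => ?_, fun t ht α β i => ?_, hdec⟩
  · exact (((C.smooth 0 i).comp hS hmaps).mono hUN).clm_apply ((hdS.mono hUN).clm_apply (he 0))
  · obtain ⟨ξ, hξ⟩ := hplane t (hUN ht)
    obtain ⟨s, r, h⟩ := hξ (e 0 t)
    obtain ⟨s', r', h'⟩ := hξ (e 1 t)
    have h00 := hej t ht 0 0
    have h01 := hej t ht 0 1
    have h10 := hej t ht 1 0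
    have h11 := hej t ht 1 1
    -- On a transversal bivector all values are multiples of one vector `ξ`, so the normalization of
    -- the component `j` fixes the other component too.
    simp only [(h _).1, (h _).2, (h' _).1, (h' _).2, if_true, zero_ne_one, one_ne_zero, if_false]
      at h00 h01 h10 h11
    have hξj : ξ j ≠ 0 := right_ne_zero_of_mul (h00 ▸ one_ne_zero)
    have hr : r = 0 := (mul_eq_zero.1 h10).resolve_right hξj
    have hs' : s' = 0 := (mul_eq_zero.1 h01).resolve_right hξj
    have hss : s = r' := mul_right_cancel₀ hξj (h00.trans h11.symm)
    fin_cases α <;> fin_cases β <;> simp [(h _).1, (h _).2, (h' _).1, (h' _).2, hr, hs', hss]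

lemma contDiffOn_pullback {θ : R4 → R4 →L[ℝ] ℝ} {T : Set R4} (hθ : ContDiffOn ℝ ∞ θ T)
    {S : R2 → R4} {U : Opens R2} (hS : ContDiffOn ℝ ∞ S U) (hmaps : ∀ t ∈ U, S t ∈ T)
    {e : R2 → R2} (he : ContDiffOn ℝ ∞ e U) :
    ContDiffOn ℝ ∞ (fun t => θ (S t) (fderiv ℝ S t (e t))) U :=
  (hθ.comp hS hmaps).clm_apply (smoothFunctions.contDiffOn_fderiv_apply hS he)

lemma extD_sum_smul (θ : R4 → R4 →L[ℝ] ℝ) (y : R4) (a : Fin 2 → ℝ) (u v : Fin 2 → R4) :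
    extD θ y (∑ k, a k • u k) (∑ l, a l • v l) =
      ∑ k, ∑ l, a k * a l * extD θ y (u k) (v l) := by
  simp [extD, Fin.sum_univ_two]
  ring

/-- The integrability condition for a transversally geodesic surface. -/
lemma exists_b_eq_of_surface {S : R2 → R4} {N : Set R2} (hN : IsOpen N) (h0 : (0 : R2) ∈ N)
    (hS : ContDiffOn ℝ ∞ S N) (hmaps : ∀ t ∈ N, S t ∈ C.chart.target)
    (hplane : ∀ t ∈ N, ∃ ξ : Fin 2 → ℝ, ∀ v, ∃ s r : ℝ, ∀ i,
      C.form 0 i (S t) (fderiv ℝ S t v) = s * ξ i ∧ C.form 1 i (S t) (fderiv ℝ S t v) = r * ξ i)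
    {j : Fin 2} {v : Fin 2 → R2}
    (hv : ∀ α β, C.form α j (S 0) (fderiv ℝ S 0 (v β)) = if α = β then 1 else 0)
    {η : Fin 2 → ℝ} (hη : ∀ i, C.form 0 i (S 0) (fderiv ℝ S 0 (v 0)) = η i) :
    ∃ c : ℝ, ∀ m, ∑ k, ∑ l, ∑ n, C.b m k l n (S 0) * η k * η l * η n = c * η m := by
  obtain ⟨U, e, ζ, hUN, h0U, he, hζ, hform, hdec⟩ :=
    C.exists_surface_frame hN h0 hS hmaps hplane hv
  have hSU : ContDiffOn ℝ ∞ S U := hS.mono hUN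
  have hmU : ∀ t ∈ U, S t ∈ C.chart.target := fun t ht => hmaps t (hUN ht)
  have hv0 : e 0 0 = v 0 := by
    have := hdec 0 h0U (v 0)
    simp only [hv, ite_smul, one_smul, zero_smul, Finset.sum_ite_eq', Finset.mem_univ, if_true]
      at this
    exact this.symm
  have hζ0 : ∀ i, ζ i 0 = η i := by
    intro i
    rw [← hη i, ← hv0, hform 0 h0U, if_pos rfl]
  have hvec : ∀ t ∈ U, ∀ β, fderiv ℝ S t (e β t) = ∑ k, ζ k t • C.frame β k (S t) := by
    intro t ht β
    rw [C.eq_sum_frameSum (hmU t ht) (fderiv ℝ S t (e β t))]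
    have h0 := hform t ht 0 β
    have h1 := hform t ht 1 β
    fin_cases β <;> simp [Fintype.sum_sum_type, formSum, frameSum] at h0 h1 ⊢ <;> simp [h0, h1]
  set br : R2 → R2 := VectorField.lieBracket ℝ (e 0) (e 1) with hbr
  have hbrs : ContDiffOn ℝ ∞ br U := smoothFunctions.contDiffOn_lieBracket (he 0) (he 1)
  let f : Fin 2 → smoothFunctions U := fun α =>
    smoothFunctions.mk _ (contDiffOn_pullback (C.smooth α j) hSU hmU hbrs)
  let Z : Fin 2 → smoothFunctions U := fun i => smoothFunctions.mk (ζ i) (hζ i)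
  let w : Fin 2 → Fin 2 → Fin 2 → smoothFunctions U := fun α k m =>
    smoothFunctions.mk _ (contDiffOn_pullback (C.contDiffOn_conn k m) hSU hmU (he α))
  let D : Fin 2 → Derivation ℝ (smoothFunctions U) (smoothFunctions U) := fun α =>
    smoothFunctions.vectorField (e α) (he α)
  have hbrt : ∀ t ∈ U, br t = ∑ α, C.form α j (S t) (fderiv ℝ S t (br t)) • e α t :=
    fun t ht => hdec t ht _
  have hlie : ∀ x, D 0 (D 1 x) - D 1 (D 0 x) = f 0 * D 0 x + f 1 * D 1 x := by
    intro x
    rw [← Derivation.commutator_apply, smoothFunctions.bracket_vectorField,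
      smoothFunctions.vectorField_eq_sum _ he (c := f) fun y => hbrt y y.2,
      smoothFunctions.sum_smul_apply, Fin.sum_univ_two]
  have hcartan : ∀ θ : R4 → R4 →L[ℝ] ℝ, ContDiffOn ℝ ∞ θ C.chart.target → ∀ t ∈ U,
      ∑ k, ∑ l, ζ k t * ζ l t * extD θ (S t) (C.frame 0 k (S t)) (C.frame 1 l (S t)) =
        fderiv ℝ (fun z => θ (S z) (fderiv ℝ S z (e 1 z))) t (e 0 t)
        - fderiv ℝ (fun z => θ (S z) (fderiv ℝ S z (e 0 z))) t (e 1 t)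
        - ∑ α, C.form α j (S t) (fderiv ℝ S t (br t)) * θ (S t) (fderiv ℝ S t (e α t)) := by
    intro θ hθ t ht
    have h := extD_pullback
      ((hθ.contDiffAt (C.chart.open_target.mem_nhds (hmU t ht))).differentiableAt (by simp))
      (smoothFunctions.contDiffAt_of_mem hSU ht) (smoothFunctions.differentiableAt_of_mem (he 0) ht)
      (smoothFunctions.differentiableAt_of_mem (he 1) ht)
    rw [hvec t ht, hvec t ht, extD_sum_smul, ← hbr] at h
    rw [h]
    congr 1
    conv_lhs => rw [hbrt t ht]
    simp only [map_sum, map_smul, smul_eq_mul]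
  have hfd : ∀ α β i, ∀ t ∈ U, ∀ x,
      fderiv ℝ (fun z => C.form α i (S z) (fderiv ℝ S z (e β z))) t x =
        if α = β then fderiv ℝ (ζ i) t x else 0 := by
    intro α β i t ht x
    have : (fun z => C.form α i (S z) (fderiv ℝ S z (e β z))) =ᶠ[𝓝 t]
        fun z => if α = β then ζ i z else 0 := by
      filter_upwards [U.isOpen.mem_nhds ht] with z hz using hform z hz α β i
    rw [this.fderiv_eq]
    split_ifs
    · rfl
    · simp
  -- The surface fields push forward to `ζᵏe_{1k}` and `ζᵏe_{2k}`, so only mixed components of `dω₁`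
  -- and `dω₂` enter and the torsion drops out. The equation for `ω₁` differentiates `ζ` along `e
  -- 1`, the one for `ω₂` along `e 0`.
  have hE : ∀ m, D 1 (Z m) = -f 0 * Z m - ∑ k, Z k * w 1 k m := by
    intro m
    ext t
    have h := hcartan _ (C.smooth 0 m) t t.2
    simp only [hfd _ _ _ t t.2, hform t t.2, ← C.conn_frame_one (hmU t t.2)] at h
    rw [← smoothFunctions.eval_apply, ← smoothFunctions.eval_apply]
    simp only [D, Z, smoothFunctions.vectorField_mk, map_sub, map_mul, map_neg, map_sum]
    simp only [smoothFunctions.eval_apply, smoothFunctions.mk_apply, f, w, hvec t t.2]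
    simp [Fin.sum_univ_two] at h ⊢
    linear_combination h
  have hD : ∀ m, D 0 (Z m) = f 1 * Z m - ∑ k, Z k * w 0 k m := by
    intro m
    ext t
    have h := hcartan _ (C.smooth 1 m) t t.2
    simp only [hfd _ _ _ t t.2, hform t t.2, extD_swap (C.form 1 m) _ (C.frame 0 _ _),
      ← C.conn_frame_zero (hmU t t.2)] at h
    rw [← smoothFunctions.eval_apply, ← smoothFunctions.eval_apply]
    simp only [D, Z, smoothFunctions.vectorField_mk, map_sub, map_mul, map_sum]
    simp only [smoothFunctions.eval_apply, smoothFunctions.mk_apply, f, w, hvec t t.2]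
    simp [Fin.sum_univ_two] at h ⊢
    linear_combination -h
  -- Defined as the curvature of the connection pulled back to the surface; `hB` then identifies its
  -- value at `0` with the contraction of `b` with `η` twice.
  let B : Fin 2 → Fin 2 → smoothFunctions U := fun k m =>
    D 0 (w 1 k m) - D 1 (w 0 k m) - f 0 * w 0 k m - f 1 * w 1 k m
      - ∑ n, (w 0 k n * w 1 n m - w 1 k n * w 0 n m)
  have hcurv := Derivation.exists_curvature_eq hE hD
    (fun k m => by simp only [B]; ring) hlie (B := B)
  have hB : ∀ k m, smoothFunctions.eval ⟨0, h0U⟩ (B k m) =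
      ∑ l, ∑ n, C.b m k l n (S 0) * η l * η n := by
    intro k m
    have h := hcartan _ (C.contDiffOn_conn k m) 0 h0U
    simp only [B, D, w, smoothFunctions.vectorField_mk, map_sub, map_mul, map_sum]
    simp only [smoothFunctions.eval_apply, smoothFunctions.mk_apply, f]
    simp only [hvec 0 h0U, hζ0, b, wedge, Fin.sum_univ_two, map_add, map_smul, smul_eq_mul] at h ⊢
    linear_combination -h
  refine ⟨smoothFunctions.eval ⟨0, h0U⟩ (-(D 0 (f 0) + D 1 (f 1))), fun m => ?_⟩
  have := congrArg (smoothFunctions.eval ⟨0, h0U⟩) (hcurv m)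
  rw [map_mul, map_sum] at this
  have hZ : ∀ i, smoothFunctions.eval ⟨0, h0U⟩ (Z i) = η i := hζ0
  rw [hZ] at this
  rw [← this]
  refine Finset.sum_congr rfl fun k _ => ?_
  rw [map_mul, hZ, hB]
  simp only [Finset.mul_sum]
  refine Finset.sum_congr rfl fun l _ => Finset.sum_congr rfl fun n _ => ?_
  ring

end AdaptedCoframe

end ThreeWeb

end IntegrabilityCondition


/-! ### Every direction satisfies the cubic curvature condition. -/

section CubicCondition

variable {M : Type*} [TopologicalSpace M] [ChartedSpace R4 M]

namespace ThreeWeb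

namespace AdaptedCoframe

variable {W : ThreeWeb M} (C : W.AdaptedCoframe)

/-- The coframe pulled back to the tangent space of the manifold. -/
def tangentForm (x : M) (α i : Fin 2) : TangentSpace 𝓘(ℝ, R4) x →ₗ[ℝ] ℝ :=
  (C.form α i (C.chart x)).toLinearMap ∘ₗ (mfderiv 𝓘(ℝ, R4) 𝓘(ℝ, R4) C.chart x).toLinearMap

lemma distForm_two_apply (i : Fin 2) (y v : R4) :
    C.distForm 2 i y v = -(C.form 0 i y v + C.form 1 i y v) := rfl

lemma exists_direction {x : M} (hx : x ∈ C.chart.source)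
    {P : Submodule ℝ (TangentSpace 𝓘(ℝ, R4) x)} (hP : W.IsTransversalBivector x P) :
    ∃ ξ : Fin 2 → ℝ, ∀ v ∈ P, ∃ s r : ℝ, ∀ i,
      C.tangentForm x 0 i v = s * ξ i ∧ C.tangentForm x 1 i v = r * ξ i := by
  refine exists_direction_of_transversal (W.transversal x) (φ := C.tangentForm x) ?_ ?_ ?_ hP.1 hP.2
  · exact fun v hv => (C.mem_dist₁ x hx v).1 hv
  · exact fun v hv => (C.mem_dist₂ x hx v).1 hv
  · intro v hv i
    exact neg_eq_zero.1 ((C.distForm_two_apply i _ _).symm.trans ((C.mem_dist 2 hx v).1 hv i))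

/-- The coordinate expression of a transversally geodesic surface. -/
lemma exists_surface (hW : W.IsTransversallyGeodesic) {x : M} (hx : x ∈ C.chart.source)
    {P : Submodule ℝ (TangentSpace 𝓘(ℝ, R4) x)} (hP : W.IsTransversalBivector x P) :
    ∃ (N : Set R2) (S : R2 → R4), IsOpen N ∧ (0 : R2) ∈ N ∧ ContDiffOn ℝ ∞ S N ∧
      (∀ t ∈ N, S t ∈ C.chart.target) ∧
      (∀ t ∈ N, ∃ ξ : Fin 2 → ℝ, ∀ v, ∃ s r : ℝ, ∀ i,
        C.form 0 i (S t) (fderiv ℝ S t v) = s * ξ i ∧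
        C.form 1 i (S t) (fderiv ℝ S t v) = r * ξ i) ∧
      S 0 = C.chart x ∧
      ∀ v ∈ P, ∃ w : R2, fderiv ℝ S 0 w = mfderiv 𝓘(ℝ, R4) 𝓘(ℝ, R4) C.chart x v := by
  obtain ⟨N, s, hs, hN, h0, ⟨hsm, htr⟩, hrange⟩ := hW x P hP
  subst hs
  have hN' : IsOpen (N ∩ s ⁻¹' C.chart.source) :=
    hsm.continuousOn.isOpen_inter_preimage hN C.chart.open_source
  have hst : ∀ t ∈ N ∩ s ⁻¹' C.chart.source, ContMDiffAt 𝓘(ℝ, R2) 𝓘(ℝ, R4) ∞ s t :=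
    fun t ht => (hsm t ht.1).contMDiffAt (hN.mem_nhds ht.1)
  have hct : ∀ t ∈ N ∩ s ⁻¹' C.chart.source,
      ContMDiffAt 𝓘(ℝ, R4) 𝓘(ℝ, R4) ∞ C.chart (s t) :=
    fun t ht => contMDiffAt_of_mem_maximalAtlas C.chart_mem ht.2
  have hd : ∀ t ∈ N ∩ s ⁻¹' C.chart.source, ∀ v : R2, fderiv ℝ (C.chart ∘ s) t v =
      mfderiv 𝓘(ℝ, R4) 𝓘(ℝ, R4) C.chart (s t) (mfderiv 𝓘(ℝ, R2) 𝓘(ℝ, R4) s t v) := by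
    intro t ht v
    rw [← mfderiv_eq_fderiv, mfderiv_comp t ((hct t ht).mdifferentiableAt (by simp))
      ((hst t ht).mdifferentiableAt (by simp))]
    rfl
  refine ⟨N ∩ s ⁻¹' C.chart.source, C.chart ∘ s, hN', ⟨h0, hx⟩, ?_, ?_, ?_, rfl, ?_⟩
  · exact fun t ht => ((hct t ht).comp t (hst t ht)).contDiffAt.contDiffWithinAt
  · exact fun t ht => C.chart.map_source ht.2
  · intro t ht
    obtain ⟨ξ, hξ⟩ := C.exists_direction ht.2 (htr t ht.1)
    refine ⟨ξ, fun v => ?_⟩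
    obtain ⟨a, b, hab⟩ := hξ _ (LinearMap.mem_range_self _ v)
    refine ⟨a, b, fun i => ?_⟩
    rw [hd t ht]
    exact hab i
  · intro v hv
    -- After `subst` the transport of `P` is along a reflexive equality and disappears
    -- definitionally.
    replace hrange : LinearMap.range (mfderiv 𝓘(ℝ, R2) 𝓘(ℝ, R4) s 0).toLinearMap = P := hrange
    rw [← hrange] at hv
    obtain ⟨w, rfl⟩ := hv
    exact ⟨w, hd 0 ⟨h0, hx⟩ w⟩

/-- A combination `a u + b v` has form values `a ξ` and `b ξ`, so the foliations cut the plane along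
`a = 0`, `b = 0` and `a + b = 0`. This makes every `ξ ≠ 0` available to the geodesic hypothesis. -/
lemma isTransversalBivector_span {y : R4} (hy : y ∈ C.chart.target) {u v : R4} {ξ : Fin 2 → ℝ}
    (hξ : ξ ≠ 0) (hu0 : ∀ i, C.form 0 i y u = ξ i) (hu1 : ∀ i, C.form 1 i y u = 0)
    (hv0 : ∀ i, C.form 0 i y v = 0) (hv1 : ∀ i, C.form 1 i y v = ξ i) :
    W.IsTransversalBivector (C.chart.symm y) (Submodule.span ℝ
      {mfderiv 𝓘(ℝ, R4) 𝓘(ℝ, R4) C.chart.symm y u,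
        mfderiv 𝓘(ℝ, R4) 𝓘(ℝ, R4) C.chart.symm y v}) := by
  set T := mfderiv 𝓘(ℝ, R4) 𝓘(ℝ, R4) C.chart.symm y with hT
  obtain ⟨m, hm⟩ := Function.ne_iff.1 hξ
  have hlin : ∀ a b : ℝ, a • T u + b • T v = T (a • u + b • v) := fun a b =>
    ((map_add T _ _).trans (congrArg₂ _ (map_smul T a u) (map_smul T b v))).symm
  have hmem : ∀ (η : Fin 3) (a b : ℝ), a • T u + b • T v ∈ W.dist η (C.chart.symm y) ↔
      (match η with | 0 => a | 1 => b | 2 => a + b) = 0 := by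
    intro η a b
    rw [hlin, C.mem_dist_symm η hy]
    have h0 : ∀ i, C.form 0 i y (a • u + b • v) = a * ξ i := fun i => by simp [hu0, hv0]
    have h1 : ∀ i, C.form 1 i y (a • u + b • v) = b * ξ i := fun i => by simp [hu1, hv1]
    fin_cases η
    · exact ⟨fun h => (mul_eq_zero.1 ((h0 m).symm.trans (h m))).resolve_right hm,
        fun h i => (h0 i).trans (by simp_all)⟩
    · exact ⟨fun h => (mul_eq_zero.1 ((h1 m).symm.trans (h m))).resolve_right hm,
        fun h i => (h1 i).trans (by simp_all)⟩
    · have h2 : ∀ i, C.distForm 2 i y (a • u + b • v) = -((a + b) * ξ i) := fun i => by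
        rw [distForm_two_apply, h0, h1]
        ring
      exact ⟨fun h => (mul_eq_zero.1 (neg_eq_zero.1 ((h2 m).symm.trans (h m)))).resolve_right hm,
        fun h i => (h2 i).trans (by simp_all)⟩
  have hzero : ∀ a b : ℝ, a • T u + b • T v = 0 → a = 0 ∧ b = 0 := fun a b h =>
    ⟨(hmem 0 a b).1 (h ▸ Submodule.zero_mem _), (hmem 1 a b).1 (h ▸ Submodule.zero_mem _)⟩
  have hli : LinearIndependent ℝ ![T u, T v] := LinearIndependent.pair_iff.2 hzero
  have hline : ∀ (η : Fin 3) (c d : ℝ), (c ≠ 0 ∨ d ≠ 0) →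
      (∀ a b : ℝ, (match η with | 0 => a | 1 => b | 2 => a + b) = 0 ↔
        ∃ r : ℝ, a = r * c ∧ b = r * d) →
      Module.finrank ℝ (Submodule.span ℝ {T u, T v} ⊓ W.dist η (C.chart.symm y) :
        Submodule ℝ (TangentSpace 𝓘(ℝ, R4) (C.chart.symm y))) = 1 := by
    intro η c d hcd h
    have : Submodule.span ℝ {T u, T v} ⊓ W.dist η (C.chart.symm y) =
        Submodule.span ℝ {c • T u + d • T v} := by
      ext w
      rw [Submodule.mem_inf, Submodule.mem_span_pair, Submodule.mem_span_singleton]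
      constructor
      · rintro ⟨⟨a, b, rfl⟩, hw⟩
        obtain ⟨r, rfl, rfl⟩ := (h a b).1 ((hmem η a b).1 hw)
        exact ⟨r, by rw [smul_add, smul_smul, smul_smul]⟩
      · rintro ⟨r, rfl⟩
        rw [smul_add, smul_smul, smul_smul]
        exact ⟨⟨_, _, rfl⟩, (hmem η _ _).2 ((h _ _).2 ⟨r, rfl, rfl⟩)⟩
    rw [this]
    refine finrank_span_singleton fun h0 => ?_
    obtain ⟨rfl, rfl⟩ := hzero c d h0
    simp at hcd
  refine ⟨?_, fun η => ?_⟩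
  · have := finrank_span_eq_card hli
    rw [Matrix.range_cons_cons_empty] at this
    rw [this, Fintype.card_fin]
  · fin_cases η
    · exact hline 0 0 1 (by simp) fun a b => by simp
    · exact hline 1 1 0 (by simp) fun a b => by simp
    · exact hline 2 1 (-1) (by simp) fun a b => by
        simp only [mul_one, mul_neg]
        exact ⟨fun h => ⟨a, rfl, by linarith⟩, by rintro ⟨r, rfl, rfl⟩; ring⟩

/-- The curvature tensor of a transversally geodesic web maps every direction, cubically, to a
multiple of itself. -/
lemma cubic_of_isTransversallyGeodesic (hW : W.IsTransversallyGeodesic) {y : R4}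
    (hy : y ∈ C.chart.target) {ξ : Fin 2 → ℝ} {j : Fin 2} (hj : ξ j = 1) (m : Fin 2) :
    ∑ k, ∑ l, ∑ n, C.b m k l n y * ξ k * ξ l * ξ n =
      (∑ k, ∑ l, ∑ n, C.b j k l n y * ξ k * ξ l * ξ n) * ξ m := by
  have hξ : ξ ≠ 0 := fun h => by simp [h] at hj
  have hform : ∀ α β i, C.form α i y (∑ k, ξ k • C.frame β k y) = if α = β then ξ i else 0 := by
    intro α β i
    fin_cases α <;> fin_cases β <;> fin_cases i <;>
      simp [Fin.sum_univ_two, C.form_frame hy]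
  obtain ⟨N, S, hN, h0, hS, hmaps, hplane, hS0, hrange⟩ :=
    C.exists_surface hW (C.chart.map_target hy) (C.isTransversalBivector_span hy hξ
      (hform 0 0) (hform 1 0) (hform 0 1) (hform 1 1))
  rw [C.chart.right_inv hy] at hS0
  obtain ⟨w₀, hw₀⟩ := hrange _ (Submodule.subset_span (Set.mem_insert _ _))
  obtain ⟨w₁, hw₁⟩ := hrange _ (Submodule.subset_span (Set.mem_insert_of_mem _ rfl))
  have hw₀' := hw₀.trans (C.mfderiv_chart_symm hy _)
  have hw₁' := hw₁.trans (C.mfderiv_chart_symm hy _)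
  have hv : ∀ α β, C.form α j (S 0) (fderiv ℝ S 0 (![w₀, w₁] β)) = if α = β then 1 else 0 := by
    intro α β
    have h0 := hform α 0 j
    have h1 := hform α 1 j
    rw [hj] at h0 h1
    rw [hS0]
    fin_cases β
    · exact (congrArg _ hw₀').trans h0
    · exact (congrArg _ hw₁').trans h1
  obtain ⟨c, hc⟩ := C.exists_b_eq_of_surface hN h0 hS hmaps hplane hv (η := ξ) fun i => by
    rw [hS0]
    exact (congrArg _ hw₀').trans (hform 0 0 i)
  rw [hS0] at hc
  -- The normalization `ξ j = 1` identifies the unknown factor `c` with the component `j` of the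
  -- cubic.
  rw [hc m, hc j, hj, mul_one]

end AdaptedCoframe

end ThreeWeb

end CubicCondition


/-! ### The dichotomy on the open nonisoclinic set and the conclusion. -/

section Nonisoclinic

open TopologicalSpace

variable {M : Type*} [TopologicalSpace M] [ChartedSpace R4 M]

namespace ThreeWeb

namespace AdaptedCoframe

variable {W : ThreeWeb M} (C : W.AdaptedCoframe)

lemma contDiffOn_pfaffian (i : Fin 2) (α j : Fin 2) :
    ContDiffOn ℝ ∞ (fun y => fderiv ℝ (C.a i) y (C.frame α j y)
      - ∑ m, C.a m y * C.conn i m y (C.frame α j y)) C.chart.target := by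
  refine ContDiffOn.sub ?_ (ContDiffOn.sum fun m _ => ?_)
  · exact ((C.contDiffOn_a i).fderiv_of_isOpen C.chart.open_target (by simp)).clm_apply
      (C.contDiffOn_frame α j)
  · exact (C.contDiffOn_a m).mul ((C.contDiffOn_conn i m).clm_apply (C.contDiffOn_frame α j))

lemma contDiffOn_p (i j : Fin 2) : ContDiffOn ℝ ∞ (C.p i j) C.chart.target :=
  C.contDiffOn_pfaffian i 0 j

lemma contDiffOn_q (i j : Fin 2) : ContDiffOn ℝ ∞ (C.q i j) C.chart.target :=
  C.contDiffOn_pfaffian i 1 j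

lemma b_eq_zero_of_isTransversallyGeodesic (hW : W.IsTransversallyGeodesic) {y : R4}
    (hy : y ∈ C.chart.target) {i j : Fin 2} (hij : i ≠ j) : C.b i j j j y = 0 := by
  have h := C.cubic_of_isTransversallyGeodesic hW hy (ξ := Pi.single j 1) (j := j)
    (Pi.single_eq_same j 1) i
  rw [Pi.single_eq_of_ne hij, mul_zero] at h
  simpa [Pi.single_apply] using h

variable {σ : Equiv.Perm (Fin 2)}
  (hb : ∀ j k l : Fin 2, ∀ y ∈ C.chart.target, C.b (σ 0) j k l y = 0)
include hb

/-- The direction is normalized in the index `σ 0`, where the curvature vanishes, so the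
proportionality factor is zero. -/
lemma cubic_eq_zero (hW : W.IsTransversallyGeodesic) {y : R4} (hy : y ∈ C.chart.target) (t : ℝ) :
    ∑ k, ∑ l, ∑ n, C.b (σ 1) (σ k) (σ l) (σ n) y * ![1, t] k * ![1, t] l * ![1, t] n = 0 := by
  have h := C.cubic_of_isTransversallyGeodesic hW hy (ξ := fun k => ![1, t] (σ.symm k))
    (j := σ 0) (by simp) (σ 1)
  simp only [hb _ _ _ y hy, zero_mul, Finset.sum_const_zero] at h
  rw [← h]
  refine Eq.trans ?_ (Equiv.sum_comp σ _)
  refine Finset.sum_congr rfl fun k _ => ?_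
  refine Eq.trans ?_ (Equiv.sum_comp σ _)
  refine Finset.sum_congr rfl fun l _ => ?_
  refine Eq.trans ?_ (Equiv.sum_comp σ _)
  simp only [Equiv.symm_apply_apply]

/-- The conditions on `b²` are the four coefficients of a cubic polynomial in `t` that vanishes
identically; the values at `0, 1, -1, 2` recover them. -/
lemma isSpecial_relabel (hW : W.IsTransversallyGeodesic) (V : Opens R4)
    (hV : (V : Set R4) ⊆ C.chart.target) : ((C.webFrame V hV).relabel σ).IsSpecial := by
  have h := fun (y : V) (t : ℝ) => C.cubic_eq_zero hb hW (hV y.2) t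
  simp only [Fin.sum_univ_two, Matrix.cons_val_zero, Matrix.cons_val_one] at h
  have e : ∀ (i j k l : Fin 2) (y : V), (((C.webFrame V hV).relabel σ).b i j k l : V → ℝ) y =
      C.b (σ i) (σ j) (σ k) (σ l) y := fun i j k l y => by
    rw [WebFrame.relabel_b, C.webFrame_b]
  constructor
  · intro j k l
    ext y
    rw [e]
    exact hb _ _ _ y (hV y.2)
  · ext y
    rw [e]
    change _ = (0 : ℝ)
    linarith [h y 0]
  · ext y
    rw [e]
    change _ = (0 : ℝ)
    linarith [h y 0, h y 1, h y (-1), h y 2]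
  · ext y
    rw [← smoothFunctions.eval_apply, map_add, map_add]
    simp only [smoothFunctions.eval_apply, e]
    change _ = (0 : ℝ)
    linarith [h y 0, h y 1, h y (-1), h y 2]
  · ext y
    rw [← smoothFunctions.eval_apply, map_add, map_add]
    simp only [smoothFunctions.eval_apply, e]
    change _ = (0 : ℝ)
    linarith [h y 0, h y 1, h y (-1), h y 2]

/-- A transversally geodesic web with `b¹ = 0` or `b² = 0` is isoclinic. -/
lemma p_and_q_eq_zero (hW : W.IsTransversallyGeodesic) {y : R4} (hy : y ∈ C.chart.target) :
    (C.p (σ 1) (σ 0) y = 0 ∧ C.q (σ 1) (σ 0) y = 0) ∧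
      C.p (σ 0) (σ 1) y ^ 2 + C.q (σ 0) (σ 1) y ^ 2 = 0 := by
  constructor
  · let T : Opens R4 := ⟨C.chart.target, C.chart.open_target⟩
    have h := (C.isSpecial_relabel hb hW T subset_rfl).covA_one
    simp only [WebFrame.relabel_covA] at h
    have h0 := congrArg (smoothFunctions.eval (⟨y, hy⟩ : T)) (h (.inl 0))
    have h1 := congrArg (smoothFunctions.eval (⟨y, hy⟩ : T)) (h (.inr 0))
    rw [map_zero, smoothFunctions.eval_apply] at h0 h1
    exact ⟨(C.webFrame_covA_inl T subset_rfl _ _ _).symm.trans h0,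
      (C.webFrame_covA_inr T subset_rfl _ _ _).symm.trans h1⟩
  · let δ : R4 → ℝ := fun y => C.p (σ 0) (σ 1) y ^ 2 + C.q (σ 0) (σ 1) y ^ 2
    have hδ : ContDiffOn ℝ ∞ δ C.chart.target :=
      ((C.contDiffOn_p _ _).pow 2).add ((C.contDiffOn_q _ _).pow 2)
    -- A point with `δ ≠ 0` makes `V` nonempty, so its ring of smooth functions is nontrivial, and
    -- on `V` the function `δ` is a unit; this contradicts `IsSpecial.not_isUnit`.
    let V : Opens R4 := ⟨C.chart.target ∩ δ ⁻¹' {0}ᶜ,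
      hδ.continuousOn.isOpen_inter_preimage C.chart.open_target isOpen_compl_singleton⟩
    have hV : (V : Set R4) ⊆ C.chart.target := Set.inter_subset_left
    by_contra hy0
    have : Nonempty V := ⟨⟨y, hy, hy0⟩⟩
    have hS := C.isSpecial_relabel hb hW V hV
    refine hS.not_isUnit (IsUnit.of_mul_eq_one
      (smoothFunctions.mk (fun y => (δ y)⁻¹) ((hδ.mono hV).inv fun y hy => hy.2)) ?_)
    simp only [WebFrame.relabel_covA]
    ext z
    rw [← smoothFunctions.eval_apply, map_mul, map_add, map_pow, map_pow]
    simp only [smoothFunctions.eval_apply, smoothFunctions.mk_apply, Sum.map_inl, Sum.map_inr,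
      C.webFrame_covA_inl, C.webFrame_covA_inr]
    exact mul_inv_cancel₀ z.2.2

lemma not_isNonisoclinicAt (hW : W.IsTransversallyGeodesic) {y : R4} (hy : y ∈ C.chart.target) :
    (C.p (σ 0) (σ 1) y - C.p (σ 1) (σ 0) y) ^ 2
      + (C.q (σ 0) (σ 1) y - C.q (σ 1) (σ 0) y) ^ 2 = 0 := by
  obtain ⟨⟨h0, h1⟩, h2⟩ := C.p_and_q_eq_zero hb hW hy
  rw [h0, h1, sub_zero, sub_zero, h2]

end AdaptedCoframe

end ThreeWeb

end Nonisoclinic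

end

theorem corollary8 {M : Type*} [TopologicalSpace M] [ChartedSpace R4 M]
    [IsManifold 𝓘(ℝ, R4) ∞ M] (W : ThreeWeb M) (C : W.AdaptedCoframe) :
    (∀ i j : Fin 2, i ≠ j → ∀ y ∈ C.chart.target, C.b i j j j y ≠ 0 →
      ¬ W.IsTransversallyGeodesic) ∧
    ((∃ y ∈ C.chart.target, C.IsNonisoclinicAt y) →
      ¬ W.IsGroupWeb →
      ((∀ j k l : Fin 2, ∀ y ∈ C.chart.target, C.b 0 j k l y = 0) ∨
        (∀ j k l : Fin 2, ∀ y ∈ C.chart.target, C.b 1 j k l y = 0)) →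
      ¬ W.IsTransversallyGeodesic) := by
  refine ⟨fun i j hij y hy hb hW => hb (C.b_eq_zero_of_isTransversallyGeodesic hW hy hij), ?_⟩
  rintro ⟨y, hy, hiso⟩ - hb hW
  rw [ThreeWeb.AdaptedCoframe.IsNonisoclinicAt] at hiso
  rcases hb with hb | hb
  · have := C.not_isNonisoclinicAt (σ := 1) hb hW hy
    simp only [Equiv.Perm.one_apply] at this
    linarith
  · have := C.not_isNonisoclinicAt (σ := Equiv.swap 0 1) (by simpa using hb) hW hy
    simp only [Equiv.swap_apply_left, Equiv.swap_apply_right] at this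
    linarith
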